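/- Let $M$ be a closed oriented surface (compact, smooth, without boundary) with a smooth Riemannian metric $g$. Let $J$ be the rotation of tangent vectors by $\pi/2$, $K_g$ the Gauss curvature, $\delta_g$ the co-differential ($\delta_g\theta=-\mathrm{tr}_g\nabla\theta$), $\star_g$ the Hodge star, and $K_M$ the canonical bundle of the Riemann surface determined by $g$ and the orientation. Let $m\geqslant 2$ be an integer, let $A$ be a differential of degree $m$, that is, a smooth section of $K_M^m$, and let $\theta$ be a smooth $1$-form on $M$, such that $$K_g=-1+\delta_g\theta+(m-1)|A|_g^2\qquad\text{and}\qquad \overline{\partial}A=\frac{m-1}{2}\,(\theta-i\star_g\theta)\otimes A,$$ where $|A|_g=|A(v,\dots,v)|$ for unit vectors $v$. Let $SM$ be the unit tangent bundle, $X$ and $V$ its geodesic and vertical vector fields ($V$ generates the rotation of the fibres), and $H=[V,X]$. Regard $\theta$ as the function $\theta(x,v)=\theta_x(v)$ on $SM$, let $a(x,v)=\mathrm{Im}\,A_x(v,\dots,v)$, and put $\lambda=a-V\theta$. The associated thermostat flow $\phi$ is the smooth flow on $SM$ generated by $F=X+\lambda V$, i.e. the flow defined by the equation $\frac{D\dot\gamma}{dt}=\lambda(\gamma,\dot\gamma)J\dot\gamma$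 for unit speed curves $\gamma$. Let $E=TSM/\mathbb{R}F$, identified with $SM\times\mathbb{R}^2$ by means of the frame $[H],[V]$, and let $\Psi_t(x,v)\in GL(2,\mathbb{R})$ be the matrix of the map from the fibre of $E$ over $(x,v)$ to the fibre over $\phi_t(x,v)$ induced by $d\phi_t$. Then $\phi$ has a dominated splitting: there are continuous line subbundles $E^u,E^s$ of $E$ with $E=E^u\oplus E^s$ which are invariant under $\Psi$, and constants $C>0$ and $0<\tau<1$, such that for all $(x,v)\in SM$ and all $t>0$ $$\big\Vert\Psi_t|_{E^s(x,v)}\big\Vert\,\big\Vert\Psi_{-t}|_{E^u(\phi_t(x,v))}\big\Vert\leqslant C\,\tau^t .$$ -/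

import Mathlib

open Bundle Set Filter Topology Manifold
open scoped ContDiff Matrix

namespace Thermostat

/-- The model plane `ℝ²` with its Euclidean norm. -/
abbrev R2 : Type := EuclideanSpace ℝ (Fin 2)

/-- The standard basis vectors of `ℝ²`. -/
noncomputable def basisVec (i : Fin 2) : R2 := EuclideanSpace.single i (1 : ℝ)

/-- The tangent bundle `TM` of a surface `M`. -/
abbrev TM (M : Type*) [TopologicalSpace M] [ChartedSpace R2 M] [IsManifold (𝓡 2) ∞ M] : Type _ :=
  TangentBundle (𝓡 2) M

/-- Smooth Riemannian metrics on a surface `M`. -/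
abbrev Metric (M : Type*) [TopologicalSpace M] [ChartedSpace R2 M] [IsManifold (𝓡 2) ∞ M] :
    Type _ :=
  ContMDiffRiemannianMetric (𝓡 2) ∞ R2 (fun x : M => TangentSpace (𝓡 2) x)

section Geometry

variable {M : Type*} [TopologicalSpace M] [ChartedSpace R2 M] [IsManifold (𝓡 2) ∞ M]

/-- An orientation of a Riemannian surface `(M, g)`, given by its rotation `J` by the angle `π/2`:
a smooth field of linear isometries of the tangent planes with `J² = -1`. For a unit vector `v`,
`J v` is the unit vector for which `{v, J v}` is an oriented orthonormal basis. -/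
structure Orientation (g : Metric M) where
  J : ∀ x : M, TangentSpace (𝓡 2) x →ₗ[ℝ] TangentSpace (𝓡 2) x
  sq : ∀ (x : M) (v : TangentSpace (𝓡 2) x), J x (J x v) = -v
  isometry : ∀ (x : M) (v w : TangentSpace (𝓡 2) x), g.inner x (J x v) (J x w) = g.inner x v w
  smooth : ContMDiff (𝓡 2).tangent (𝓡 2).tangent ∞ (fun v : TM M => (⟨v.1, J v.1 v.2⟩ : TM M))

variable (M) in
/-- Smooth `1`-forms on `M`. -/
structure OneForm where
  form : ∀ x : M, TangentSpace (𝓡 2) x →ₗ[ℝ] ℝ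
  smooth : ContMDiff (𝓡 2).tangent 𝓘(ℝ, ℝ) ∞ (fun v : TM M => form v.1 v.2)

/-- Differentials of degree `m`, that is, smooth sections of the `m`-th tensor power of the
canonical bundle of the Riemann surface determined by `g` and the orientation: at every point a
complex valued form in `m` tangent vectors which is complex linear in each of them, where the
tangent plane is a complex line through `i v = J v`. (Smoothness of the polynomial
`v ↦ A(v, …, v)` on `TM` is smoothness of the section.) -/
structure Differential {g : Metric M} (o : Orientation g) (m : ℕ) where
  form : ∀ x : M, MultilinearMap ℝ (fun _ : Fin m => TangentSpace (𝓡 2) x) ℂ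
  complexLinear : ∀ (x : M) (v : Fin m → TangentSpace (𝓡 2) x) (i : Fin m),
    form x (Function.update v i (o.J x (v i))) = Complex.I * form x v
  smooth : ContMDiff (𝓡 2).tangent 𝓘(ℝ, ℂ) ∞ (fun v : TM M => form v.1 (fun _ => v.2))

/-! ### Local coordinates

The chart used near a point `c` is the preferred chart `extChartAt (𝓡 2) c`. -/

/-- The point of `M` with coordinates `y` in the chart at `c`. -/
noncomputable def coordPt (c : M) (y : R2) : M := (extChartAt (𝓡 2) c).symm y

/-- The tangent vector at `x` with components `v` in the chart at `c`. -/
noncomputable def coordVec (c x : M) (v : R2) : TangentSpace (𝓡 2) x :=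
  (trivializationAt R2 (fun x : M => TangentSpace (𝓡 2) x) c).symm x v

/-- The components in the chart at `c` of a tangent vector. -/
noncomputable def components (c : M) (v : TM M) : R2 :=
  (trivializationAt R2 (fun x : M => TangentSpace (𝓡 2) x) c v).2

/-- The coordinates of `x` in the chart at `x` itself. -/
noncomputable def center (x : M) : R2 := extChartAt (𝓡 2) x x

/-- The metric in the chart at `c`. -/
noncomputable def metricCoord (g : Metric M) (c : M) (y v w : R2) : ℝ :=
  g.inner (coordPt c y) (coordVec c (coordPt c y) v) (coordVec c (coordPt c y) w)

/-- The matrix `(g_{ij})` of the metric in the chart at `c`. -/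
noncomputable def gram (g : Metric M) (c : M) (y : R2) : Matrix (Fin 2) (Fin 2) ℝ :=
  Matrix.of fun i j => metricCoord g c y (basisVec i) (basisVec j)

/-- Christoffel symbols of the first kind:
`(∂_u g(v, w) + ∂_v g(u, w) - ∂_w g(u, v)) / 2`. -/
noncomputable def christoffelLower (g : Metric M) (c : M) (y u v w : R2) : ℝ :=
  (fderiv ℝ (fun z => metricCoord g c z v w) y u + fderiv ℝ (fun z => metricCoord g c z u w) y v
    - fderiv ℝ (fun z => metricCoord g c z u v) y w) / 2

/-- Christoffel symbols of the Levi-Civita connection: the vector with components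
`∑ g^{kl} Γ_{ij,l} uⁱ vʲ` in the chart at `c`. -/
noncomputable def christoffel (g : Metric M) (c : M) (y u v : R2) : R2 :=
  WithLp.toLp 2 ((gram g c y)⁻¹ *ᵥ fun l => christoffelLower g c y u v (basisVec l))

/-- The Riemann curvature tensor `R(u, v) w` in the chart at `c`. -/
noncomputable def riemann (g : Metric M) (c : M) (y u v w : R2) : R2 :=
  fderiv ℝ (fun z => christoffel g c z v w) y u - fderiv ℝ (fun z => christoffel g c z u w) y v
    + christoffel g c y u (christoffel g c y v w) - christoffel g c y v (christoffel g c y u w)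

/-- The Gauss curvature `K_g = g(R(∂₁, ∂₂) ∂₂, ∂₁) / det (g_{ij})`. -/
noncomputable def gaussCurvature (g : Metric M) (x : M) : ℝ :=
  metricCoord g x (center x)
      (riemann g x (center x) (basisVec 0) (basisVec 1) (basisVec 1)) (basisVec 0)
    / (gram g x (center x)).det

/-- A `1`-form in the chart at `c`. -/
noncomputable def OneForm.coord (θ : OneForm M) (c : M) (y v : R2) : ℝ :=
  θ.form (coordPt c y) (coordVec c (coordPt c y) v)

/-- The covariant derivative `(∇_u θ)(v)` in the chart at `c`. -/
noncomputable def OneForm.covDeriv (g : Metric M) (θ : OneForm M) (c : M) (y u v : R2) : ℝ :=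
  fderiv ℝ (fun z => θ.coord c z v) y u - θ.coord c y (christoffel g c y u v)

/-- The co-differential `δ_g θ = - tr_g ∇θ = - ∑ g^{ij} (∇_i θ)_j`. -/
noncomputable def codifferential (g : Metric M) (θ : OneForm M) (x : M) : ℝ :=
  -∑ i, ∑ j, (gram g x (center x))⁻¹ i j *
    θ.covDeriv g x (center x) (basisVec i) (basisVec j)

/-- The Hodge star of a `1`-form on an oriented surface: `(⋆θ)(w) = -θ(J w)`. -/
noncomputable def hodgeStar {g : Metric M} (o : Orientation g) (θ : OneForm M) (x : M)
    (w : TangentSpace (𝓡 2) x) : ℝ := -θ.form x (o.J x w)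

/-- A differential of degree `m` in the chart at `c`. -/
noncomputable def Differential.coord {g : Metric M} {o : Orientation g} {m : ℕ}
    (A : Differential o m) (c : M) (y : R2) (v : Fin m → R2) : ℂ :=
  A.form (coordPt c y) (fun i => coordVec c (coordPt c y) (v i))

/-- The covariant derivative
`(∇_u A)(v₁, …, v_m) = ∂_u (A(v₁, …, v_m)) - ∑ A(v₁, …, Γ(u, v_i), …, v_m)` for the Levi-Civita
connection, in the chart at `c`. -/
noncomputable def Differential.covDeriv {g : Metric M} {o : Orientation g} {m : ℕ}
    (A : Differential o m) (c : M) (y u : R2) (v : Fin m → R2) : ℂ :=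
  fderiv ℝ (fun z => A.coord c z v) y u
    - ∑ i, A.coord c y (Function.update v i (christoffel g c y u (v i)))

/-- The Dolbeault operator on sections of the `m`-th power of the canonical bundle,
`(∂̄A)(w) = (∇_w A + i ∇_{J w} A) / 2`: the `(0,1)`-part of the Levi-Civita connection, which is the
Chern connection of the canonical bundle because every oriented Riemannian surface is Kähler. At a
point `x`, tangent vectors are identified with their components in the chart at `x`, which is the
definition of `TangentSpace`. -/
noncomputable def dbar {g : Metric M} {o : Orientation g} {m : ℕ} (A : Differential o m) (x : M)
    (w : TangentSpace (𝓡 2) x) (v : Fin m → TangentSpace (𝓡 2) x) : ℂ :=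
  (A.covDeriv x (center x) w v + Complex.I * A.covDeriv x (center x) (o.J x w) v) / 2

/-- The squared norm `|A|²_g = |A(v, …, v)|²` for unit vectors `v`; the value does not depend on
`v` since the tangent plane is a complex line, and it is written as a supremum. -/
noncomputable def normSq {g : Metric M} {o : Orientation g} {m : ℕ} (A : Differential o m)
    (x : M) : ℝ :=
  sSup {r : ℝ | ∃ v : TangentSpace (𝓡 2) x, g.inner x v v = 1 ∧ r = ‖A.form x (fun _ => v)‖ ^ 2}

/-- `K_g = -1 + δ_g θ + (m - 1) |A|²_g`. -/
def GeneralizedWang {g : Metric M} {o : Orientation g} {m : ℕ} (A : Differential o m)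
    (θ : OneForm M) : Prop :=
  ∀ x : M, gaussCurvature g x = -1 + codifferential g θ x + ((m : ℝ) - 1) * normSq A x

/-- `∂̄A = ((m - 1) / 2) (θ - i ⋆θ) ⊗ A`. -/
def WeaklyHolomorphic {g : Metric M} {o : Orientation g} {m : ℕ} (A : Differential o m)
    (θ : OneForm M) : Prop :=
  ∀ (x : M) (w : TangentSpace (𝓡 2) x) (v : Fin m → TangentSpace (𝓡 2) x),
    dbar A x w v = (((m : ℂ) - 1) / 2) *
      (((θ.form x w : ℝ) : ℂ) - Complex.I * ((hodgeStar o θ x w : ℝ) : ℂ)) * A.form x v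

/-! ### The unit tangent bundle and thermostat flows -/

/-- The unit tangent bundle `SM`. -/
def unitTangent (g : Metric M) : Set (TM M) := {v | g.inner v.1 v.2 v.2 = 1}

/-- The derivative along the generator `V` of the rotation of the fibres. -/
noncomputable def vertDeriv {g : Metric M} (o : Orientation g) (f : TM M → ℝ) (v : TM M) : ℝ :=
  deriv (fun t : ℝ => f ⟨v.1, Real.cos t • v.2 + Real.sin t • o.J v.1 v.2⟩) 0

/-- The real valued function `a` on `SM` representing `A`: `A(v, …, v) = (V a)(v) / m + i a(v)`. -/
noncomputable def Differential.toFunction {g : Metric M} {o : Orientation g} {m : ℕ} (A : Differential o m)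
    (v : TM M) : ℝ := (A.form v.1 (fun _ => v.2)).im

/-- A `1`-form as a real valued function on `SM`. -/
noncomputable def OneForm.toFunction (θ : OneForm M) (v : TM M) : ℝ := θ.form v.1 v.2

/-- The function `λ = a - V θ`. -/
noncomputable def thermostatFunction {g : Metric M} {o : Orientation g} {m : ℕ}
    (A : Differential o m) (θ : OneForm M) (v : TM M) : ℝ :=
  A.toFunction v - vertDeriv o θ.toFunction v

/-- A curve `σ` in `TM` is the velocity `σ = γ'` of a curve `γ` in `M` which solves
`D γ' / dt = lam(γ, γ') J γ'`, in all local coordinates `y`: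
`y' = w` and `w' = lam J w - Γ(w, w)`, with `w` the components of `γ'`. -/
def IsThermostatCurve {g : Metric M} (o : Orientation g) (lam : TM M → ℝ) (σ : ℝ → TM M) : Prop :=
  ∀ (c : M) (t : ℝ), (σ t).1 ∈ (chartAt R2 c).source →
    HasDerivAt (fun s => extChartAt (𝓡 2) c (σ s).1) (components c (σ t)) t ∧
    HasDerivAt (fun s => components c (σ s))
      (lam (σ t) • components c ⟨(σ t).1, o.J (σ t).1 (σ t).2⟩
        - christoffel g c (extChartAt (𝓡 2) c (σ t).1) (components c (σ t)) (components c (σ t))) t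

/-- `φ` is the thermostat flow on `SM` with the function `lam`: a smooth action of `ℝ` on `SM` whose
orbits are the velocities of the solutions of `D γ' / dt = lam(γ, γ') J γ'`. Only the values of `φ`
on `SM` matter; `φ` is given off `SM` by some extension that is smooth around `SM` (such as
`v ↦ φ_t(v / |v|)`), so that smoothness and derivatives can be taken in `TM`. -/
structure IsThermostatFlow {g : Metric M} (o : Orientation g) (lam : TM M → ℝ)
    (φ : ℝ → TM M → TM M) : Prop where
  smooth : ∀ (t : ℝ), ∀ v ∈ unitTangent g,
    ContMDiffAt (𝓘(ℝ, ℝ).prod (𝓡 2).tangent) (𝓡 2).tangent ∞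
      (fun p : ℝ × TM M => φ p.1 p.2) (t, v)
  mapsTo : ∀ t : ℝ, MapsTo (φ t) (unitTangent g) (unitTangent g)
  map_zero : ∀ v ∈ unitTangent g, φ 0 v = v
  map_add : ∀ s t : ℝ, ∀ v ∈ unitTangent g, φ (s + t) v = φ s (φ t v)
  isThermostatCurve : ∀ v ∈ unitTangent g, IsThermostatCurve o lam (fun t => φ t v)

/-! ### The quotient cocycle

A tangent vector of `TM` at `v` is a pair `ξ = (ξ₁, ξ₂)` in `ℝ² × ℝ²`: the derivatives of the
position and of the components of a curve in `TM`, in the chart at the base point of `v`. -/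

/-- The vector `H`: the horizontal lift of `J v`. -/
noncomputable def frameH {g : Metric M} (o : Orientation g) (v : TM M) :
    TangentSpace (𝓡 2).tangent v :=
  let w : R2 := v.2
  let Jw : R2 := o.J v.1 v.2
  ((Jw, -christoffel g v.1 (center v.1) Jw w) : R2 × R2)

/-- The vertical vector `V`. -/
noncomputable def frameV {g : Metric M} (o : Orientation g) (v : TM M) :
    TangentSpace (𝓡 2).tangent v :=
  let Jw : R2 := o.J v.1 v.2
  ((0, Jw) : R2 × R2)

/-- The form `ω₁(ξ) = g(dπ(ξ), v)`. -/
noncomputable def omega1 (g : Metric M) (v : TM M) (ξ : TangentSpace (𝓡 2).tangent v) : ℝ :=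
  let ξ' : R2 × R2 := ξ
  g.inner v.1 (ξ'.1 : R2) v.2

/-- The form `ω₂(ξ) = g(dπ(ξ), J v)`. -/
noncomputable def omega2 {g : Metric M} (o : Orientation g) (v : TM M)
    (ξ : TangentSpace (𝓡 2).tangent v) : ℝ :=
  let ξ' : R2 × R2 := ξ
  g.inner v.1 (ξ'.1 : R2) (o.J v.1 v.2)

/-- The Levi-Civita connection form `ψ(ξ) = g(DZ/dt, J v)`, for `Z` a curve with `Z' = ξ`. -/
noncomputable def connectionForm {g : Metric M} (o : Orientation g) (v : TM M)
    (ξ : TangentSpace (𝓡 2).tangent v) : ℝ :=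
  let ξ' : R2 × R2 := ξ
  let w : R2 := v.2
  g.inner v.1 (ξ'.2 + christoffel g v.1 (center v.1) ξ'.1 w : R2) (o.J v.1 v.2)

/-- The coordinates `(y, u)` of the class of `ξ = x F + y H + u V` in `T SM / ℝ F`, where
`F = X + lam V` generates the flow and `X, H, V` is the frame dual to `ω₁, ω₂, ψ`. -/
noncomputable def quotientCoord {g : Metric M} (o : Orientation g) (lam : TM M → ℝ) (v : TM M)
    (ξ : TangentSpace (𝓡 2).tangent v) : Fin 2 → ℝ :=
  ![omega2 o v ξ, connectionForm o v ξ - lam v * omega1 g v ξ]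

/-- The matrix `Ψ_t(v)` of the map of `T SM / ℝ F` induced by `dφ_t`, in the frame `[H], [V]`: its
columns are the coordinates of `[dφ_t(H)]` and `[dφ_t(V)]`. -/
noncomputable def cocycle {g : Metric M} (o : Orientation g) (lam : TM M → ℝ)
    (φ : ℝ → TM M → TM M) (t : ℝ) (v : TM M) : Matrix (Fin 2) (Fin 2) ℝ :=
  Matrix.of fun i j => quotientCoord o lam (φ t v)
    (mfderiv (𝓡 2).tangent (𝓡 2).tangent (φ t) v (![frameH o v, frameV o v] j)) i

end Geometry

/-! ### Dominated splittings -/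

/-- A continuous line subbundle of the trivial bundle `S × ℝ²`. -/
def IsContinuousLineField {S : Type*} [TopologicalSpace S] (L : S → Submodule ℝ R2) : Prop :=
  ∀ v₀ : S, ∃ U ∈ 𝓝 v₀, ∃ s : S → R2, ContinuousOn s U ∧
    ∀ v ∈ U, s v ≠ 0 ∧ L v = Submodule.span ℝ {s v}

/-- A cocycle `Ψ` of `2 × 2` matrices over a flow `φ` has a dominated splitting: there are
continuous invariant line bundles with `S × ℝ² = E^u ⊕ E^s` and constants `C > 0`, `0 < τ < 1` with
`‖Ψ_t|E^s(v)‖ ‖Ψ_{-t}|E^u(φ_t v)‖ ≤ C τ^t` for all `t > 0`. -/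
def HasDominatedSplitting {S : Type*} [TopologicalSpace S] (φ : ℝ → S → S)
    (Ψ : ℝ → S → Matrix (Fin 2) (Fin 2) ℝ) : Prop :=
  ∃ Eu Es : S → Submodule ℝ R2,
    IsContinuousLineField Eu ∧ IsContinuousLineField Es ∧
    (∀ v, IsCompl (Eu v) (Es v)) ∧
    (∀ t v, (Eu v).map (Matrix.toEuclideanLin (Ψ t v)) = Eu (φ t v)) ∧
    (∀ t v, (Es v).map (Matrix.toEuclideanLin (Ψ t v)) = Es (φ t v)) ∧
    ∃ C τ : ℝ, 0 < C ∧ 0 < τ ∧ τ < 1 ∧ ∀ (v : S) (t : ℝ), 0 < t →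
      ‖(Matrix.toEuclideanCLM (𝕜 := ℝ) (Ψ t v)).comp (Es v).subtypeL‖ *
        ‖(Matrix.toEuclideanCLM (𝕜 := ℝ) (Ψ (-t) (φ t v))).comp (Eu (φ t v)).subtypeL‖
      ≤ C * τ ^ t

/-- The thermostat flow `φ` on `SM` has a dominated splitting: its cocycle `Ψ` on `T SM / ℝ F`
has one. -/
def IsThermostatFlow.AdmitsDominatedSplitting {M : Type*} [TopologicalSpace M] [ChartedSpace R2 M]
    [IsManifold (𝓡 2) ∞ M] {g : Metric M} {o : Orientation g} {lam : TM M → ℝ}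
    {φ : ℝ → TM M → TM M} (hφ : IsThermostatFlow o lam φ) : Prop :=
  HasDominatedSplitting (S := unitTangent g)
    (fun t v => ⟨φ t v.1, hφ.mapsTo t v.2⟩) (fun t v => cocycle o lam φ t v.1)

end Thermostat

/-!
Let `Y H + U V` represent a vector of `T SM / ℝ F` that is transported by the thermostat flow. In a
chart, a variation of an orbit satisfies a Jacobi equation
(`IsThermostatFlow.hasDerivAt_quotientCoord`):
`Y' = U` and `U' = -(K - Hλ + λ²) Y + (Vλ) U`.

With `p(v) = Re A(v, …, v) + θ(v)`, `q(v) = (m - 1) Re A(v, …, v)` and `Z = U - p Y`, the two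
equations for `g`, `A` and `θ` turn this into the planar system `Y' = p Y + Z`, `Z' = Y + q Z`.
Two identities on `SM` are behind this: `Vλ = p + q`, and `K = -1 + Hλ - λ² - F p + p q`. They are
checked from the derivatives of `A`, `θ` and `θ ∘ J` along the frame `X, H, V`
(`Differential.hasFrameDeriv`, `OneForm.hasFrameDeriv`, `OneForm.hasFrameDeriv_rotation`). The first
order derivatives of `A` only enter through the real part of `∂̄A`, and those of `θ` only through the
trace of `∇θ`, so that both are given by the hypotheses.

Since the off-diagonal coefficients of the planar system are `1`, the cone `Y Z > 0` is invariant in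
forward time, and there the logarithm `s` of the slope `Z / Y` solves `s' = -2 sinh s + q - p`. This
equation contracts distances exponentially (`sq_sub_le_of_sinh_ode`), and `q - p` is bounded because
`M` is compact. Hence the slopes at time `0` of the solutions with slope `1` at time `-T` converge
uniformly as `T → ∞`, to a continuous invariant slope (`exists_invariant_slope`): this is `E^u`. The
bundle `E^s` is obtained in the same way from the reversed flow, inside the cone `Y Z < 0`. Both
slopes are bounded away from `0`, and so the ratio of the growth rates along the two lines decays
exponentially (`hasDominatedSplitting_of_isPlanarSolution`).

The law of transformation of the Christoffel symbols between charts is not proved from the formula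
for them: the orbits of the flow satisfy the same second order equation in all charts, which gives
the law for unit vectors, and it is quadratic (`IsThermostatFlow.christoffel_transition`).
-/

set_option maxSynthPendingDepth 3

namespace Thermostat

/-! ### Planar linear systems with constant off-diagonal entries -/

/-- `(y, z)` solves the linear system `y' = p y + z`, `z' = y + q z` on the real line. -/
def IsPlanarSolution (p q y z : ℝ → ℝ) : Prop :=
  ∀ t, HasDerivAt y (z t + p t * y t) t ∧ HasDerivAt z (y t + q t * z t) t

namespace IsPlanarSolution

variable {p q y z y' z' : ℝ → ℝ}

theorem comp_add (h : IsPlanarSolution p q y z) (a : ℝ) :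
    IsPlanarSolution (fun t => p (t + a)) (fun t => q (t + a)) (fun t => y (t + a))
      (fun t => z (t + a)) :=
  fun t => ⟨(h (t + a)).1.comp_add_const t a, (h (t + a)).2.comp_add_const t a⟩

/-- Reversing time and reflecting `z` gives a system of the same shape. -/
theorem reverse (h : IsPlanarSolution p q y z) :
    IsPlanarSolution (fun t => -p (-t)) (fun t => -q (-t)) (fun t => y (-t))
      (fun t => -z (-t)) := by
  intro t
  have h1 := (h (-t)).1.scomp t (hasDerivAt_neg t)
  have h2 := ((h (-t)).2.scomp t (hasDerivAt_neg t)).neg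
  exact ⟨h1.congr_deriv (by simp; ring), h2.congr_deriv (by simp)⟩

theorem linearComb (h : IsPlanarSolution p q y z) (h' : IsPlanarSolution p q y' z') (a b : ℝ) :
    IsPlanarSolution p q (fun t => a * y t + b * y' t) (fun t => a * z t + b * z' t) := by
  intro t
  refine ⟨(((h t).1.const_mul a).add ((h' t).1.const_mul b)).congr_deriv ?_,
    (((h t).2.const_mul a).add ((h' t).2.const_mul b)).congr_deriv ?_⟩ <;> ring

/-- Uniqueness for the homogeneous system: a solution that vanishes at one time vanishes. -/
theorem eq_zero {B : ℝ} (hp : ∀ t, |p t| ≤ B) (hq : ∀ t, |q t| ≤ B)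
    (h : IsPlanarSolution p q y z) {a : ℝ} (hy : y a = 0) (hz : z a = 0) (t : ℝ) :
    y t = 0 ∧ z t = 0 := by
  -- Grönwall's argument for the energy `y² + z²`, in both directions of time
  have hd : ∀ x, HasDerivAt (fun x => y x ^ 2 + z x ^ 2)
      (2 * y x * (z x + p x * y x) + 2 * z x * (y x + q x * z x)) x := fun x =>
    (((h x).1.pow 2).add ((h x).2.pow 2)).congr_deriv (by norm_num)
  have hb : ∀ x, |2 * y x * (z x + p x * y x) + 2 * z x * (y x + q x * z x)| ≤
      (2 * B + 2) * (y x ^ 2 + z x ^ 2) := by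
    intro x
    obtain ⟨p1, p2⟩ := abs_le.1 (hp x)
    obtain ⟨q1, q2⟩ := abs_le.1 (hq x)
    rw [abs_le]
    constructor <;>
      nlinarith [sq_nonneg (y x + z x), sq_nonneg (y x - z x),
        mul_nonneg (sub_nonneg.2 p2) (sq_nonneg (y x)),
        mul_nonneg (sub_nonneg.2 q2) (sq_nonneg (z x)),
        mul_nonneg (sub_nonneg.2 p1) (sq_nonneg (y x)),
        mul_nonneg (sub_nonneg.2 q1) (sq_nonneg (z x))]
  set K := 2 * B + 2
  have hmul : ∀ k x, HasDerivAt (fun x => (y x ^ 2 + z x ^ 2) * Real.exp (k * x))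
      ((2 * y x * (z x + p x * y x) + 2 * z x * (y x + q x * z x)
        + k * (y x ^ 2 + z x ^ 2)) * Real.exp (k * x)) x := by
    intro k x
    refine ((hd x).mul (((hasDerivAt_id x).const_mul k).exp)).congr_deriv ?_
    simp; ring
  have h1 : Monotone (fun x => (y x ^ 2 + z x ^ 2) * Real.exp (K * x)) :=
    monotone_of_hasDerivAt_nonneg (hmul K) fun x =>
      mul_nonneg (by linarith [(abs_le.1 (hb x)).1]) (Real.exp_pos _).le
  have h2 : Antitone (fun x => (y x ^ 2 + z x ^ 2) * Real.exp (-K * x)) :=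
    antitone_of_hasDerivAt_nonpos (hmul (-K)) fun x =>
      mul_nonpos_of_nonpos_of_nonneg (by linarith [(abs_le.1 (hb x)).2]) (Real.exp_pos _).le
  have key : y t ^ 2 + z t ^ 2 ≤ 0 := by
    rcases le_total t a with hta | hta
    · have := h1 hta
      simp only [hy, hz] at this
      by_contra hc
      exact absurd this (not_le.2 (by have := mul_pos (not_le.1 hc) (Real.exp_pos (K * t)); simpa))
    · have := h2 hta
      simp only [hy, hz] at this
      by_contra hc
      exact absurd this
        (not_le.2 (by have := mul_pos (not_le.1 hc) (Real.exp_pos (-K * t)); simpa using this))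
  constructor <;> nlinarith [sq_nonneg (y t), sq_nonneg (z t)]

theorem unique {B : ℝ} (hp : ∀ t, |p t| ≤ B) (hq : ∀ t, |q t| ≤ B)
    (h : IsPlanarSolution p q y z) (h' : IsPlanarSolution p q y' z') {a : ℝ} (hy : y a = y' a)
    (hz : z a = z' a) (t : ℝ) : y t = y' t ∧ z t = z' t := by
  have := eq_zero hp hq (h.linearComb h' 1 (-1)) (a := a) (by simp [hy]) (by simp [hz]) t
  constructor <;> linarith [this.1, this.2]

/-- The cone `y z > 0` is forward invariant: `(y z)' - (p + q) y z = y² + z² ≥ 0`. -/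
theorem mul_pos_of_le (hp : Continuous p) (hq : Continuous q)
    (h : IsPlanarSolution p q y z) {a : ℝ} (ha : 0 < y a * z a) {t : ℝ} (ht : a ≤ t) :
    0 < y t * z t := by
  set F : ℝ → ℝ := fun t => ∫ x in a..t, (p x + q x)
  have hF : ∀ x, HasDerivAt F (p x + q x) x := fun x =>
    ((hp.add hq).integral_hasStrictDerivAt a x).hasDerivAt
  have hd : ∀ x, HasDerivAt (fun x => y x * z x * Real.exp (-F x))
      ((y x ^ 2 + z x ^ 2) * Real.exp (-F x)) x := by
    intro x
    refine (((h x).1.mul (h x).2).mul (hF x).neg.exp).congr_deriv ?_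
    simp; ring
  have hm := monotone_of_hasDerivAt_nonneg hd fun x =>
    mul_nonneg (add_nonneg (sq_nonneg _) (sq_nonneg _)) (Real.exp_pos _).le
  have := lt_of_lt_of_le (mul_pos ha (Real.exp_pos (-F a))) (hm ht)
  exact pos_of_mul_pos_left this (Real.exp_pos _).le

/-- In the cone `y z > 0` the logarithm of the slope `z / y` solves `s' = -2 sinh s + q - p`. -/
theorem hasDerivAt_log_slope (h : IsPlanarSolution p q y z) {t : ℝ} (ht : 0 < y t * z t) :
    HasDerivAt (fun t => Real.log (z t / y t))
      (-2 * Real.sinh (Real.log (z t / y t)) + (q t - p t)) t := by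
  have hy : y t ≠ 0 := fun h0 => by simp [h0] at ht
  have hz : z t ≠ 0 := fun h0 => by simp [h0] at ht
  have hr : 0 < z t / y t := by
    have : z t / y t = y t * z t / (y t) ^ 2 := by field_simp
    rw [this]; positivity
  refine (((h t).2.div (h t).1 hy).log hr.ne').congr_deriv ?_
  rw [Real.sinh_log hr, Pi.div_apply]
  field_simp
  ring

end IsPlanarSolution

/-- The flow of `s' = -2 sinh s + b` contracts distances at rate `e^{-t}`, up to the size of
the perturbation of `b`. -/
theorem sq_sub_le_of_sinh_ode {s₁ s₂ b₁ b₂ : ℝ → ℝ} {a t ε : ℝ} (hat : a ≤ t)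
    (h₁ : ∀ x ∈ Icc a t, HasDerivAt s₁ (-2 * Real.sinh (s₁ x) + b₁ x) x)
    (h₂ : ∀ x ∈ Icc a t, HasDerivAt s₂ (-2 * Real.sinh (s₂ x) + b₂ x) x)
    (hb : ∀ x ∈ Icc a t, |b₁ x - b₂ x| ≤ ε) :
    (s₁ t - s₂ t) ^ 2 ≤ Real.exp (-2 * (t - a)) * (s₁ a - s₂ a) ^ 2 + ε ^ 2 / 4 := by
  have hd : ∀ x ∈ Icc a t, HasDerivAt
      (fun x => ((s₁ x - s₂ x) ^ 2 - ε ^ 2 / 4) * Real.exp (2 * x))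
      ((2 * (s₁ x - s₂ x) * (-2 * (Real.sinh (s₁ x) - Real.sinh (s₂ x)) + (b₁ x - b₂ x))
        + 2 * ((s₁ x - s₂ x) ^ 2 - ε ^ 2 / 4)) * Real.exp (2 * x)) x := by
    intro x hx
    refine (((((h₁ x hx).sub (h₂ x hx)).pow 2).sub_const (ε ^ 2 / 4)).mul
      (((hasDerivAt_id x).const_mul 2).exp)).congr_deriv ?_
    simp; ring
  have hanti : AntitoneOn (fun x => ((s₁ x - s₂ x) ^ 2 - ε ^ 2 / 4) * Real.exp (2 * x))
      (Icc a t) := by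
    refine antitoneOn_of_deriv_nonpos (convex_Icc a t)
      (fun x hx => (hd x hx).continuousAt.continuousWithinAt)
      (fun x hx => (hd x (interior_subset hx)).differentiableAt.differentiableWithinAt) ?_
    intro x hx
    have hx := interior_subset hx
    rw [(hd x hx).deriv]
    refine mul_nonpos_of_nonpos_of_nonneg ?_ (Real.exp_pos _).le
    -- `sinh` expands distances, because `sinh x - x` is increasing
    have hs : (s₁ x - s₂ x) ^ 2 ≤ (s₁ x - s₂ x) * (Real.sinh (s₁ x) - Real.sinh (s₂ x)) := by
      have hmono := Real.sinh_sub_id_strictMono.monotone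
      rcases le_total (s₁ x) (s₂ x) with hle | hle
      · have := hmono hle
        simp only at this
        nlinarith
      · have := hmono hle
        simp only at this
        nlinarith
    have hε := abs_le.1 (hb x hx)
    -- the cross term `2 (s₁ - s₂) (b₁ - b₂)` is absorbed by completing the square
    nlinarith [sq_nonneg (2 * (s₁ x - s₂ x) - (b₁ x - b₂ x)), hε.1, hε.2]
  have := hanti (left_mem_Icc.2 hat) (right_mem_Icc.2 hat) hat
  simp only at this
  have e1 : Real.exp (-2 * (t - a)) = Real.exp (2 * a) / Real.exp (2 * t) := by
    rw [← Real.exp_sub]; ring_nf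
  have e2 : Real.exp (2 * a) ≤ Real.exp (2 * t) := Real.exp_le_exp.2 (by linarith)
  have e3 := Real.exp_pos (2 * t)
  rw [e1, ← sub_nonneg]
  rw [← sub_nonneg] at this
  have h4 : 0 ≤ ε ^ 2 / 4 * Real.exp (2 * a) := by positivity
  have : 0 ≤ (Real.exp (2 * a) / Real.exp (2 * t) * (s₁ a - s₂ a) ^ 2 + ε ^ 2 / 4
      - (s₁ t - s₂ t) ^ 2) * Real.exp (2 * t) := by
    have : (Real.exp (2 * a) / Real.exp (2 * t) * (s₁ a - s₂ a) ^ 2 + ε ^ 2 / 4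
      - (s₁ t - s₂ t) ^ 2) * Real.exp (2 * t) = Real.exp (2 * a) * (s₁ a - s₂ a) ^ 2 +
      (ε ^ 2 / 4 - (s₁ t - s₂ t) ^ 2) * Real.exp (2 * t) := by field_simp; ring
    rw [this]; linarith
  exact nonneg_of_mul_nonneg_left this e3

/-! ### Invariant slopes -/

section Dynamics

variable {S : Type*} [TopologicalSpace S]

/-- A continuous invariant slope for the systems `y' = p y + z`, `z' = y + q z` along the orbits of
a flow: the attracting direction inside the cone `y z > 0`. It is the limit as `T → ∞` of the
slopes at time `0` of the solutions which start with slope `1` at time `-T`. -/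
theorem exists_invariant_slope (ψ : ℝ → S → S) (hψ : Continuous fun x : ℝ × S => ψ x.1 x.2)
    (hadd : ∀ s t v, ψ (s + t) v = ψ s (ψ t v))
    (p q : S → ℝ) (hp : Continuous p) (hq : Continuous q) {B : ℝ}
    (hpB : ∀ v, |p v| ≤ B) (hqB : ∀ v, |q v| ≤ B)
    (hex : ∀ v a y₀ z₀, ∃ y z : ℝ → ℝ, IsPlanarSolution (fun t => p (ψ t v)) (fun t => q (ψ t v)) y z
      ∧ y a = y₀ ∧ z a = z₀) :
    ∃ r : S → ℝ, Continuous r ∧ (∀ v, Real.exp (-B) ≤ r v) ∧ (∀ v, r v ≤ Real.exp B) ∧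
      ∀ v y z, IsPlanarSolution (fun t => p (ψ t v)) (fun t => q (ψ t v)) y z →
        z 0 = r v * y 0 → ∀ t, z t = r (ψ t v) * y t := by
  have hψv : ∀ v, Continuous fun t => ψ t v := fun v =>
    hψ.comp (continuous_id.prodMk continuous_const)
  choose y z hsol hy hz using fun (T : ℝ) (v : S) => hex v (-T) 1 1
  have hpos : ∀ T v t, -T ≤ t → 0 < y T v t * z T v t := fun T v t ht =>
    (hsol T v).mul_pos_of_le (hp.comp (hψv v)) (hq.comp (hψv v)) (a := -T)
      (by rw [hy, hz]; norm_num) ht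
  set σ : ℝ → S → ℝ → ℝ := fun T v t => Real.log (z T v t / y T v t) with hσ
  have hσd : ∀ T v t, -T ≤ t →
      HasDerivAt (σ T v) (-2 * Real.sinh (σ T v t) + (q (ψ t v) - p (ψ t v))) t :=
    fun T v t ht => (hsol T v).hasDerivAt_log_slope (hpos T v t ht)
  have hσ0 : ∀ T v, σ T v (-T) = 0 := fun T v => by simp [hσ, hy, hz]
  have hβ : ∀ v, |q v - p v| ≤ 2 * B := fun v =>
    (abs_sub _ _).trans (by linarith [hpB v, hqB v])
  have hB : ∀ v : S, 0 ≤ B := fun v => (abs_nonneg _).trans (hpB v)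
  -- every slope stays bounded: compare with the solution `0` of the system with `b = 0`
  have hσB : ∀ T v t, -T ≤ t → |σ T v t| ≤ B := by
    intro T v t ht
    have := sq_sub_le_of_sinh_ode (s₂ := fun _ => 0) (b₂ := fun _ => 0) (ε := 2 * B) ht
      (fun x hx => hσd T v x hx.1) (fun x _ => by simpa using hasDerivAt_const x (0 : ℝ))
      (fun x _ => by simpa using hβ (ψ x v))
    simp only [sub_zero, hσ0] at this
    exact abs_le_of_sq_le_sq (by nlinarith) (hB v)
  have hexp2 : ∀ x : ℝ, Real.exp (-2 * x) = Real.exp (-x) ^ 2 := fun x => by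
    rw [← Real.exp_nat_mul]; congr 1; push_cast; ring
  -- two slopes that start at different times approach each other exponentially
  have hcauchy : ∀ v T T', 0 ≤ T → T ≤ T' → |σ T v 0 - σ T' v 0| ≤ Real.exp (-T) * B := by
    intro v T T' hT hTT
    have := sq_sub_le_of_sinh_ode (s₁ := σ T v) (s₂ := σ T' v) (ε := 0) (a := -T) (t := 0)
      (by linarith) (fun x hx => hσd T v x hx.1) (fun x hx => hσd T' v x (by linarith [hx.1]))
      (fun x _ => by simp)
    have h2 := sq_le_sq' (abs_le.1 (hσB T' v (-T) (by linarith))).1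
      (abs_le.1 (hσB T' v (-T) (by linarith))).2
    refine abs_le_of_sq_le_sq ?_ (mul_nonneg (Real.exp_pos _).le (hB v))
    rw [mul_pow, ← hexp2]
    rw [hσ0] at this
    have h3 := Real.exp_pos (-2 * (0 - -T))
    have h4 : (0 : ℝ) - -T = T := by ring
    rw [h4] at this h3
    nlinarith
  have hlim : ∀ v, ∃ l, Tendsto (fun T => σ T v 0) atTop (𝓝 l) := by
    intro v
    refine cauchySeq_tendsto_of_complete (Metric.cauchySeq_iff'.2 fun ε hε => ?_)
    have ht : Tendsto (fun T : ℝ => Real.exp (-T) * B) atTop (𝓝 0) := by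
      simpa using (Real.tendsto_exp_neg_atTop_nhds_zero).mul_const B
    obtain ⟨N, hN, hN0⟩ := ((ht.eventually (gt_mem_nhds hε)).and (eventually_ge_atTop 0)).exists
    refine ⟨N, fun n hn => ?_⟩
    rw [dist_comm, Real.dist_eq]
    exact (hcauchy v N n hN0 hn).trans_lt hN
  choose l hl using hlim
  have hest : ∀ v T, 0 ≤ T → |σ T v 0 - l v| ≤ Real.exp (-T) * B := fun v T hT =>
    le_of_tendsto ((tendsto_const_nhds.sub (hl v)).abs)
      ((eventually_ge_atTop T).mono fun T' hT' => hcauchy v T T' hT hT')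
  -- continuity in `v`, from the dependence of the slope on the coefficient `q - p`
  have hcont : ∀ T, 0 ≤ T → Continuous fun v => σ T v 0 := by
    intro T hT
    rw [continuous_iff_continuousAt]
    intro v
    rw [Metric.continuousAt_iff']
    intro ε hε
    have hK := (isCompact_Icc (a := -T) (b := (0 : ℝ))).eventually_forall_of_forall_eventually
      (x₀ := v) (P := fun v' t => |(q (ψ t v') - p (ψ t v')) - (q (ψ t v) - p (ψ t v))| < ε) ?_
    · filter_upwards [hK] with v' hv'
      have := sq_sub_le_of_sinh_ode (s₁ := σ T v') (s₂ := σ T v) (ε := ε) (a := -T) (t := 0)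
        (by linarith) (fun x hx => hσd T v' x hx.1) (fun x hx => hσd T v x hx.1)
        (fun x hx => (hv' x hx).le)
      rw [hσ0, hσ0] at this
      rw [Real.dist_eq]
      refine abs_lt_of_sq_lt_sq ?_ hε.le
      nlinarith
    · intro t _
      have hc : Continuous fun x : S × ℝ =>
          |(q (ψ x.2 x.1) - p (ψ x.2 x.1)) - (q (ψ x.2 v) - p (ψ x.2 v))| := by
        have h1 : Continuous fun x : S × ℝ => ψ x.2 x.1 :=
          hψ.comp (continuous_snd.prodMk continuous_fst)
        have h2 : Continuous fun x : S × ℝ => ψ x.2 v := (hψv v).comp continuous_snd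
        exact (((hq.comp h1).sub (hp.comp h1)).sub ((hq.comp h2).sub (hp.comp h2))).abs
      exact hc.continuousAt.eventually (gt_mem_nhds (by simpa using hε))
  have hlcont : Continuous l := by
    refine TendstoUniformly.continuous (F := fun T v => σ T v 0) (p := atTop) ?_
      ((eventually_ge_atTop 0).mono hcont).frequently
    rw [Metric.tendstoUniformly_iff]
    intro ε hε
    have ht : Tendsto (fun T : ℝ => Real.exp (-T) * B) atTop (𝓝 0) := by
      simpa using (Real.tendsto_exp_neg_atTop_nhds_zero).mul_const B
    filter_upwards [ht.eventually (gt_mem_nhds hε), eventually_ge_atTop 0] with T hT hT0 v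
    rw [dist_comm, Real.dist_eq]
    exact (hest v T hT0).trans_lt hT
  have hlB : ∀ v, |l v| ≤ B := fun v =>
    le_of_tendsto (hl v).abs ((eventually_ge_atTop 0).mono fun T hT => hσB T v 0 (by linarith))
  refine ⟨fun v => Real.exp (l v), Real.continuous_exp.comp hlcont,
    fun v => Real.exp_le_exp.2 (abs_le.1 (hlB v)).1,
    fun v => Real.exp_le_exp.2 (abs_le.1 (hlB v)).2, ?_⟩
  intro v y₁ z₁ hs hs0 t
  obtain ⟨e₁, e₂, he, he₁, he₂⟩ := hex v 0 1 0
  obtain ⟨f₁, f₂, hf, hf₁, hf₂⟩ := hex v 0 0 1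
  -- the slope at time `t` of the solution along `v` is the slope at time `0` along `ψ t v`
  have hslope : ∀ᶠ T in atTop, e₂ t + Real.exp (σ T v 0) * f₂ t =
      Real.exp (σ (T + t) (ψ t v) 0) * (e₁ t + Real.exp (σ T v 0) * f₁ t) := by
    filter_upwards [eventually_ge_atTop 0, eventually_ge_atTop (-t)] with T hT hTt
    have hpq : ∀ x, ψ x (ψ t v) = ψ (x + t) v := fun x => (hadd x t v).symm
    have hsh : IsPlanarSolution (fun x => p (ψ x (ψ t v))) (fun x => q (ψ x (ψ t v)))
        (fun x => y T v (x + t)) (fun x => z T v (x + t)) := by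
      have := (hsol T v).comp_add t
      simpa only [hpq] using this
    have hu := hsh.unique (fun x => hpB _) (fun x => hqB _) (hsol (T + t) (ψ t v)) (a := -(T + t))
      (by rw [hy]; simp [hy]) (by rw [hz]; simp [hz]) 0
    simp only [zero_add] at hu
    have hexp : ∀ T v, 0 ≤ T → z T v 0 = Real.exp (σ T v 0) * y T v 0 := by
      intro T v hT
      have h1 := hpos T v 0 (by linarith)
      have hy0 : y T v 0 ≠ 0 := fun h0 => by simp [h0] at h1
      have hr : 0 < z T v 0 / y T v 0 := by
        have : z T v 0 / y T v 0 = y T v 0 * z T v 0 / (y T v 0) ^ 2 := by field_simp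
        rw [this]; positivity
      rw [hσ]
      simp only
      rw [Real.exp_log hr]
      field_simp
    have hlin := (hsol T v).unique (fun x => hpB _) (fun x => hqB _)
      (he.linearComb hf (y T v 0) (z T v 0)) (a := 0) (by simp [he₁, hf₁]) (by simp [he₂, hf₂]) t
    have h1 := hexp (T + t) (ψ t v) (by linarith)
    rw [← hu.1, ← hu.2, hlin.1, hlin.2, hexp T v hT] at h1
    have hy0 : y T v 0 ≠ 0 := fun h0 => by
      have := hpos T v 0 (by linarith); simp [h0] at this
    apply mul_left_cancel₀ hy0
    linear_combination h1
  have hT1 : Tendsto (fun T => Real.exp (σ T v 0)) atTop (𝓝 (Real.exp (l v))) :=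
    (Real.continuous_exp.tendsto _).comp (hl v)
  have hT2 : Tendsto (fun T => Real.exp (σ (T + t) (ψ t v) 0)) atTop
      (𝓝 (Real.exp (l (ψ t v)))) :=
    (Real.continuous_exp.tendsto _).comp
      ((hl (ψ t v)).comp (tendsto_atTop_add_const_right _ t tendsto_id))
  have hfin : e₂ t + Real.exp (l v) * f₂ t =
      Real.exp (l (ψ t v)) * (e₁ t + Real.exp (l v) * f₁ t) :=
    tendsto_nhds_unique_of_eventuallyEq (tendsto_const_nhds.add (hT1.mul_const _))
      (hT2.mul (tendsto_const_nhds.add (hT1.mul_const _))) hslope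
  have hlin := hs.unique (fun x => hpB _) (fun x => hqB _)
      (he.linearComb hf (y₁ 0) (z₁ 0)) (a := 0) (by simp [he₁, hf₁]) (by simp [he₂, hf₂]) t
  rw [hlin.1, hlin.2, hs0]
  linear_combination y₁ 0 * hfin

end Dynamics

/-! ### Line fields spanned by slopes -/

/-- The vector `(1, c)` of slope `c`. -/
noncomputable def slopeVec (c : ℝ) : R2 := !₂[1, c]

theorem slopeVec_ne_zero (c : ℝ) : slopeVec c ≠ 0 := fun h => by
  have := congrArg (fun x : R2 => x 0) h
  simp [slopeVec] at this

theorem one_le_norm_slopeVec (c : ℝ) : 1 ≤ ‖slopeVec c‖ := by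
  rw [EuclideanSpace.norm_eq]
  exact Real.one_le_sqrt.2 (by simp [slopeVec, Fin.sum_univ_two]; positivity)

theorem norm_slopeVec_le (c : ℝ) : ‖slopeVec c‖ ≤ 1 + |c| := by
  rw [EuclideanSpace.norm_eq]
  refine Real.sqrt_le_iff.2 ⟨by positivity, ?_⟩
  simp only [slopeVec, Fin.sum_univ_two, Real.norm_eq_abs, sq_abs]
  simp
  nlinarith [abs_nonneg c, sq_abs c]

theorem continuous_slopeVec : Continuous slopeVec := by
  refine (PiLp.continuous_toLp 2 _).comp (continuous_pi fun i => ?_)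
  fin_cases i
  · exact continuous_const
  · exact continuous_id

theorem isCompl_span_slopeVec {a b : ℝ} (h : a ≠ b) :
    IsCompl (Submodule.span ℝ {slopeVec a}) (Submodule.span ℝ {slopeVec b}) := by
  have hab : a - b ≠ 0 := sub_ne_zero.2 h
  refine ⟨Submodule.disjoint_def.2 fun x hx hx' => ?_, codisjoint_iff.2 (eq_top_iff.2 ?_)⟩
  · obtain ⟨s, rfl⟩ := Submodule.mem_span_singleton.1 hx
    obtain ⟨t, ht⟩ := Submodule.mem_span_singleton.1 hx'
    have h0 := congrArg (fun x : R2 => x 0) ht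
    have h1 := congrArg (fun x : R2 => x 1) ht
    simp [slopeVec] at h0 h1
    subst h0
    have : t * (a - b) = 0 := by linear_combination -h1
    rw [(mul_eq_zero.1 this).resolve_right hab, zero_smul]
  · intro x _
    refine Submodule.mem_sup.2 ⟨((x 1 - b * x 0) / (a - b)) • slopeVec a,
      Submodule.smul_mem _ _ (Submodule.mem_span_singleton_self _),
      ((a * x 0 - x 1) / (a - b)) • slopeVec b,
      Submodule.smul_mem _ _ (Submodule.mem_span_singleton_self _), ?_⟩
    ext i
    fin_cases i <;> simp [slopeVec] <;> field_simp <;> ring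

theorem isContinuousLineField_span_slopeVec {S : Type*} [TopologicalSpace S] {c : S → ℝ}
    (hc : Continuous c) : IsContinuousLineField fun v => Submodule.span ℝ {slopeVec (c v)} :=
  fun _ => ⟨univ, univ_mem, fun v => slopeVec (c v), (continuous_slopeVec.comp hc).continuousOn,
    fun _ _ => ⟨slopeVec_ne_zero _, rfl⟩⟩

/-- A matrix that maps a line to a line by the scalar `k` has norm at most `|k|` on it, up to the
lengths of the chosen generators. -/
theorem norm_toEuclideanCLM_comp_subtypeL_span_le {A : Matrix (Fin 2) (Fin 2) ℝ} {a b k K : ℝ}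
    (h : Matrix.toEuclideanLin A (slopeVec a) = k • slopeVec b) (hK : ‖slopeVec b‖ ≤ K) :
    ‖(Matrix.toEuclideanCLM (𝕜 := ℝ) A).comp (Submodule.span ℝ {slopeVec a}).subtypeL‖
      ≤ |k| * K := by
  have hK0 : 0 ≤ K := (norm_nonneg _).trans hK
  refine ContinuousLinearMap.opNorm_le_bound _ (by positivity) fun x => ?_
  obtain ⟨s, hs⟩ := Submodule.mem_span_singleton.1 x.2
  have h1 : (Matrix.toEuclideanCLM (𝕜 := ℝ) A) (x : R2) = (s * k) • slopeVec b := by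
    rw [← hs, map_smul, mul_smul, ← h]; rfl
  have h2 : |s| ≤ ‖x‖ := by
    change |s| ≤ ‖(x : R2)‖
    rw [← hs, norm_smul, Real.norm_eq_abs]
    exact le_mul_of_one_le_right (abs_nonneg s) (one_le_norm_slopeVec a)
  simp only [ContinuousLinearMap.comp_apply, Submodule.subtypeL_apply]
  rw [h1, norm_smul, Real.norm_eq_abs, abs_mul]
  calc |s| * |k| * ‖slopeVec b‖ ≤ ‖x‖ * |k| * K := by gcongr
    _ = |k| * K * ‖x‖ := by ring

/-! ### Dominated splittings from planar systems -/

section Dynamics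

variable {S : Type*}

/-- An invariant slope `ρ` of the planar systems gives an invariant line field of the cocycle, on
which the cocycle acts by a scalar that solves `Y' = (ρ + p) Y`. -/
theorem exists_multiplier (ψ : ℝ → S → S)
    (h0 : ∀ v, ψ 0 v = v) (hadd : ∀ s t v, ψ (s + t) v = ψ s (ψ t v))
    (p q : S → ℝ) {B : ℝ} (hpB : ∀ v, |p v| ≤ B) (hqB : ∀ v, |q v| ≤ B)
    (Ψ : ℝ → S → Matrix (Fin 2) (Fin 2) ℝ) (hΨ0 : ∀ v, Ψ 0 v = 1)
    (hΨ : ∀ v j, IsPlanarSolution (fun t => p (ψ t v)) (fun t => q (ψ t v))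
      (fun t => Ψ t v 0 j) (fun t => Ψ t v 1 j - p (ψ t v) * Ψ t v 0 j))
    (ρ : S → ℝ) (hρ : ∀ v y z, IsPlanarSolution (fun t => p (ψ t v)) (fun t => q (ψ t v)) y z →
        z 0 = ρ v * y 0 → ∀ t, z t = ρ (ψ t v) * y t) :
    ∃ Y : ℝ → S → ℝ, (∀ v, Y 0 v = 1) ∧ (∀ t v, Y t v ≠ 0) ∧
      (∀ t v, Y (-t) (ψ t v) = (Y t v)⁻¹) ∧
      (∀ t v, Matrix.toEuclideanLin (Ψ t v) (slopeVec (ρ v + p v)) =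
        Y t v • slopeVec (ρ (ψ t v) + p (ψ t v))) ∧
      ∀ v t, HasDerivAt (fun t => Y t v) ((ρ (ψ t v) + p (ψ t v)) * Y t v) t := by
  set Y : ℝ → S → ℝ := fun t v => 1 * Ψ t v 0 0 + (ρ v + p v) * Ψ t v 0 1 with hY
  set Z : ℝ → S → ℝ := fun t v => 1 * (Ψ t v 1 0 - p (ψ t v) * Ψ t v 0 0)
    + (ρ v + p v) * (Ψ t v 1 1 - p (ψ t v) * Ψ t v 0 1) with hZ
  have hsol : ∀ v, IsPlanarSolution (fun t => p (ψ t v)) (fun t => q (ψ t v))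
      (fun t => Y t v) (fun t => Z t v) := fun v => (hΨ v 0).linearComb (hΨ v 1) _ _
  have hY0 : ∀ v, Y 0 v = 1 := fun v => by simp [hY, hΨ0]
  have hZ0 : ∀ v, Z 0 v = ρ v := fun v => by simp [hZ, hΨ0, h0]
  have hZY : ∀ v t, Z t v = ρ (ψ t v) * Y t v := fun v => hρ v _ _ (hsol v) (by simp [hY0, hZ0])
  -- the multiplier is a scalar cocycle, by uniqueness for the planar system
  have hmul : ∀ s t v, Y (s + t) v = Y t v * Y s (ψ t v) := by
    intro s t v
    have h1 := (hsol v).comp_add t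
    simp only [hadd] at h1
    have h2 := (hsol (ψ t v)).linearComb (hsol (ψ t v)) (Y t v) 0
    have := (h1.unique (fun _ => hpB _) (fun _ => hqB _) h2 (a := 0) (by simp [hY0])
      (by simp [hZ0, hZY]; ring) s).1
    simpa [hadd] using this
  have hinv : ∀ t v, Y t v * Y (-t) (ψ t v) = 1 := fun t v => by
    rw [← hmul, neg_add_cancel, hY0]
  refine ⟨Y, hY0, fun t v h => by simpa [h] using hinv t v,
    fun t v => eq_inv_of_mul_eq_one_right (hinv t v), fun t v => ?_, fun v t => ?_⟩
  · have h1 : Ψ t v 1 0 + (ρ v + p v) * Ψ t v 1 1 = (ρ (ψ t v) + p (ψ t v)) * Y t v := by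
      have h2 := hZY v t
      simp only [hZ, hY] at h2 ⊢
      linear_combination h2
    ext i
    fin_cases i
    · simp [slopeVec, hY]; ring
    · simp [slopeVec]
      linear_combination h1
  · refine (hsol v t).1.congr_deriv ?_
    simp only [hZY]; ring

/-- A cocycle whose columns, in the moving frame sheared by `p`, solve `y' = p y + z`,
`z' = y + q z` with `p` and `q` continuous and bounded has a dominated splitting: the off-diagonal
entries `1` make the cones `y z > 0` and `y z < 0` strictly invariant, in forward and in backward
time respectively. -/
theorem hasDominatedSplitting_of_isPlanarSolution [TopologicalSpace S] (ψ : ℝ → S → S)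
    (hψ : Continuous fun x : ℝ × S => ψ x.1 x.2)
    (h0 : ∀ v, ψ 0 v = v) (hadd : ∀ s t v, ψ (s + t) v = ψ s (ψ t v))
    (p q : S → ℝ) (hp : Continuous p) (hq : Continuous q) {B : ℝ}
    (hpB : ∀ v, |p v| ≤ B) (hqB : ∀ v, |q v| ≤ B)
    (Ψ : ℝ → S → Matrix (Fin 2) (Fin 2) ℝ) (hΨ0 : ∀ v, Ψ 0 v = 1)
    (hΨ : ∀ v j, IsPlanarSolution (fun t => p (ψ t v)) (fun t => q (ψ t v))
      (fun t => Ψ t v 0 j) (fun t => Ψ t v 1 j - p (ψ t v) * Ψ t v 0 j)) :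
    HasDominatedSplitting ψ Ψ := by
  have hex : ∀ v a y₀ z₀, ∃ y z : ℝ → ℝ,
      IsPlanarSolution (fun t => p (ψ t v)) (fun t => q (ψ t v)) y z ∧ y a = y₀ ∧ z a = z₀ := by
    intro v a y₀ z₀
    have h1 := ((hΨ (ψ a v) 0).linearComb (hΨ (ψ a v) 1) y₀
      (z₀ + p (ψ a v) * y₀)).comp_add (-a)
    simp only [← hadd, neg_add_cancel_right] at h1
    exact ⟨_, _, h1, by simp [hΨ0], by simp [hΨ0]; ring⟩
  obtain ⟨r, hr, hr1, hr2, hrinv⟩ := exists_invariant_slope ψ hψ hadd p q hp hq hpB hqB hex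
  -- the repelling slope is the attracting one for the reversed flow, reflected
  obtain ⟨l, hl, hl1, hl2, hlinv⟩ := exists_invariant_slope (fun t => ψ (-t))
    (hψ.comp (continuous_fst.neg.prodMk continuous_snd))
    (fun s t v => by rw [neg_add, hadd]) (fun v => -p v) (fun v => -q v) hp.neg hq.neg
    (B := B) (fun v => by simpa using hpB v) (fun v => by simpa using hqB v) (by
      intro v a y₀ z₀
      obtain ⟨y, z, h, hy, hz⟩ := hex v (-a) y₀ (-z₀)
      exact ⟨_, _, h.reverse, hy, by simp [hz]⟩)
  have hlinv' : ∀ v y z, IsPlanarSolution (fun t => p (ψ t v)) (fun t => q (ψ t v)) y z →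
        z 0 = -l v * y 0 → ∀ t, z t = -l (ψ t v) * y t := by
    intro v y z h hz t
    have := hlinv v _ _ h.reverse (by simp [hz]) (-t)
    simp only [neg_neg] at this
    linarith
  obtain ⟨Yu, hu0, hune, huinv, humap, hud⟩ :=
    exists_multiplier ψ h0 hadd p q hpB hqB Ψ hΨ0 hΨ r hrinv
  obtain ⟨Ys, hs0, hsne, hsinv, hsmap, hsd⟩ :=
    exists_multiplier ψ h0 hadd p q hpB hqB Ψ hΨ0 hΨ (fun v => -l v) hlinv'
  have hmap : ∀ (A : Matrix (Fin 2) (Fin 2) ℝ) (a b k : ℝ), k ≠ 0 →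
      Matrix.toEuclideanLin A (slopeVec a) = k • slopeVec b →
      (Submodule.span ℝ {slopeVec a}).map (Matrix.toEuclideanLin A) =
        Submodule.span ℝ {slopeVec b} := by
    intro A a b k hk h
    rw [Submodule.map_span, image_singleton, h, Submodule.span_singleton_smul_eq hk.isUnit]
  set c := Real.exp (-B)
  have hc : 0 < c := Real.exp_pos _
  set K := 1 + (Real.exp B + B)
  have hKu : ∀ v, ‖slopeVec (r v + p v)‖ ≤ K := fun v =>
    (norm_slopeVec_le _).trans (by
      have := abs_add_le (r v) (p v)
      rw [abs_of_pos (hc.trans_le (hr1 v))] at this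
      linarith [hr2 v, hpB v])
  have hKs : ∀ v, ‖slopeVec (-l v + p v)‖ ≤ K := fun v =>
    (norm_slopeVec_le _).trans (by
      have := abs_add_le (-l v) (p v)
      rw [abs_neg, abs_of_pos (hc.trans_le (hl1 v))] at this
      linarith [hl2 v, hpB v])
  rcases isEmpty_or_nonempty S with hS | ⟨⟨v₀⟩⟩
  · exact ⟨isEmptyElim, isEmptyElim, isEmptyElim, isEmptyElim, isEmptyElim, fun _ => isEmptyElim,
      fun _ => isEmptyElim, 1, 1 / 2, by norm_num, by norm_num, by norm_num, isEmptyElim⟩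
  have hK : 0 ≤ K := (norm_nonneg _).trans (hKu v₀)
  refine ⟨fun v => Submodule.span ℝ {slopeVec (r v + p v)},
    fun v => Submodule.span ℝ {slopeVec (-l v + p v)},
    isContinuousLineField_span_slopeVec (hr.add hp),
    isContinuousLineField_span_slopeVec (hl.neg.add hp),
    fun v => isCompl_span_slopeVec (by linarith [hr1 v, hl1 v]),
    fun t v => hmap _ _ _ _ (hune t v) (humap t v),
    fun t v => hmap _ _ _ _ (hsne t v) (hsmap t v),
    (1 + K) ^ 2, Real.exp (-2 * c), by positivity, Real.exp_pos _,
    Real.exp_lt_one_iff.2 (by linarith), fun v t ht => ?_⟩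
  -- the quotient `Ys / Yu` solves `f' = -(l + r) f`, so it decays at rate at least `2 c`
  have hdecay : |Ys t v / Yu t v| ≤ Real.exp (-2 * c * t) := by
    have hd : ∀ x, HasDerivAt (fun x => (Ys x v / Yu x v) ^ 2 * Real.exp (4 * c * x))
        ((Ys x v / Yu x v) ^ 2 * (-2 * (l (ψ x v) + r (ψ x v)) + 4 * c) *
          Real.exp (4 * c * x)) x := by
      intro x
      have hne := hune x v
      have hf : HasDerivAt (fun x => Ys x v / Yu x v)
          (-(l (ψ x v) + r (ψ x v)) * (Ys x v / Yu x v)) x := by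
        refine ((hsd v x).div (hud v x) hne).congr_deriv ?_
        field_simp
        ring
      refine ((hf.pow 2).mul (((hasDerivAt_id x).const_mul (4 * c)).exp)).congr_deriv ?_
      simp only [Pi.pow_apply, id]
      ring
    have hanti := antitone_of_hasDerivAt_nonpos hd fun x =>
      mul_nonpos_of_nonpos_of_nonneg (mul_nonpos_of_nonneg_of_nonpos (sq_nonneg _)
        (by linarith [hr1 (ψ x v), hl1 (ψ x v)])) (Real.exp_pos _).le
    have h1 := hanti ht.le
    simp only [hs0, hu0, mul_zero, Real.exp_zero] at h1
    refine abs_le_of_sq_le_sq ?_ (Real.exp_pos _).le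
    have h2 : Real.exp (-2 * c * t) ^ 2 * Real.exp (4 * c * t) = 1 := by
      rw [← Real.exp_nat_mul, ← Real.exp_add, Real.exp_eq_one_iff]; push_cast; ring
    refine le_of_mul_le_mul_right ?_ (Real.exp_pos (4 * c * t))
    rw [h2]; linarith
  have hn1 := norm_toEuclideanCLM_comp_subtypeL_span_le (hsmap t v) (hKs (ψ t v))
  have hn2 := norm_toEuclideanCLM_comp_subtypeL_span_le (humap (-t) (ψ t v))
    (K := K) (hKu _)
  rw [huinv] at hn2
  rw [← Real.exp_mul]
  calc _ ≤ (|Ys t v| * K) * (|(Yu t v)⁻¹| * K) := by gcongr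
    _ = K ^ 2 * |Ys t v / Yu t v| := by rw [div_eq_mul_inv, abs_mul]; ring
    _ ≤ (1 + K) ^ 2 * Real.exp (-2 * c * t) := by
      gcongr
      linarith

end Dynamics

/-! ### Local geometry of oriented surfaces -/

section LocalGeometry

variable {E : Type*} [NormedAddCommGroup E] [NormedSpace ℝ E]

/-- The coordinate expressions of a Riemannian metric `G`, its Levi-Civita connection `Γ` and the
rotation `J` on an open set `U` of the plane `E`. -/
structure IsSurfaceGeometry (U : Set E) (G : E → E →L[ℝ] E →L[ℝ] ℝ)
    (Γ : E → E →L[ℝ] E →L[ℝ] E) (J : E → E →L[ℝ] E) : Prop where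
  finrank_eq : Module.finrank ℝ E = 2
  isOpen : IsOpen U
  contDiffOn_metric : ContDiffOn ℝ ∞ G U
  contDiffOn_christoffel : ContDiffOn ℝ ∞ Γ U
  contDiffOn_rotation : ContDiffOn ℝ ∞ J U
  metric_symm : ∀ y ∈ U, ∀ v w, G y v w = G y w v
  metric_pos : ∀ y ∈ U, ∀ v, v ≠ 0 → 0 < G y v v
  christoffel_symm : ∀ y ∈ U, ∀ v w, Γ y v w = Γ y w v
  compat : ∀ y ∈ U, ∀ u v w, fderiv ℝ G y u v w = G y (Γ y u v) w + G y v (Γ y u w)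
  rotation_sq : ∀ y ∈ U, ∀ v, J y (J y v) = -v
  rotation_isometry : ∀ y ∈ U, ∀ v w, G y (J y v) (J y w) = G y v w

/-- The curvature `R(u, v) w` of a connection with Christoffel symbols `Γ`. -/
noncomputable def localCurvature (Γ : E → E →L[ℝ] E →L[ℝ] E) (y u v w : E) : E :=
  fderiv ℝ Γ y u v w - fderiv ℝ Γ y v u w + Γ y u (Γ y v w) - Γ y v (Γ y u w)

namespace IsSurfaceGeometry

variable {U : Set E} {G : E → E →L[ℝ] E →L[ℝ] ℝ} {Γ : E → E →L[ℝ] E →L[ℝ] E}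
  {J : E → E →L[ℝ] E} {y : E}

theorem differentiableAt_metric (h : IsSurfaceGeometry U G Γ J) (hy : y ∈ U) :
    DifferentiableAt ℝ G y :=
  (h.contDiffOn_metric.contDiffAt (h.isOpen.mem_nhds hy)).differentiableAt (by simp)

theorem differentiableAt_christoffel (h : IsSurfaceGeometry U G Γ J) (hy : y ∈ U) :
    DifferentiableAt ℝ Γ y :=
  (h.contDiffOn_christoffel.contDiffAt (h.isOpen.mem_nhds hy)).differentiableAt (by simp)

theorem differentiableAt_rotation (h : IsSurfaceGeometry U G Γ J) (hy : y ∈ U) :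
    DifferentiableAt ℝ J y :=
  (h.contDiffOn_rotation.contDiffAt (h.isOpen.mem_nhds hy)).differentiableAt (by simp)

theorem metric_rotation_left (h : IsSurfaceGeometry U G Γ J) (hy : y ∈ U) (v w : E) :
    G y (J y v) w = -G y v (J y w) := by
  have h1 := h.rotation_isometry y hy v (J y w)
  rw [h.rotation_sq y hy, map_neg] at h1
  linarith

theorem metric_self_rotation (h : IsSurfaceGeometry U G Γ J) (hy : y ∈ U) (v : E) :
    G y v (J y v) = 0 := by
  have h1 := h.metric_rotation_left hy v v
  rw [h.metric_symm y hy] at h1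
  linarith

/-- A nonzero vector `w` and `J w` form a basis. -/
theorem exists_eq_smul_add_smul (h : IsSurfaceGeometry U G Γ J) (hy : y ∈ U) {w : E}
    (hw : w ≠ 0) (x : E) : ∃ a b : ℝ, x = a • w + b • J y w := by
  have hli : LinearIndependent ℝ ![w, J y w] := by
    rw [LinearIndependent.pair_iff]
    intro s t hst
    have hp := h.metric_pos y hy w hw
    have h1 := congrArg (fun z => G y w z) hst
    have h2 := congrArg (fun z => G y (J y w) z) hst
    simp only [map_add, map_smul, map_zero, h.metric_self_rotation hy,
      h.rotation_isometry y hy, smul_eq_mul] at h1 h2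
    rw [h.metric_symm y hy, h.metric_self_rotation hy] at h2
    constructor
    · exact (mul_eq_zero.1 (by linarith : s * G y w w = 0)).resolve_right hp.ne'
    · exact (mul_eq_zero.1 (by linarith : t * G y w w = 0)).resolve_right hp.ne'
  have hspan := hli.span_eq_top_of_card_eq_finrank (by simp [h.finrank_eq])
  have hx : x ∈ Submodule.span ℝ (Set.range ![w, J y w]) := by rw [hspan]; trivial
  rw [Matrix.range_cons, Matrix.range_cons, Matrix.range_empty, union_empty,
    singleton_union, Submodule.mem_span_pair] at hx
  obtain ⟨a, b, hab⟩ := hx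
  exact ⟨a, b, hab.symm⟩

theorem eq_metric_smul_add (h : IsSurfaceGeometry U G Γ J) (hy : y ∈ U) {w : E}
    (hw : G y w w = 1) (x : E) : x = G y x w • w + G y x (J y w) • J y w := by
  have hw0 : w ≠ 0 := fun h0 => by simp [h0] at hw
  obtain ⟨a, b, rfl⟩ := h.exists_eq_smul_add_smul hy hw0 x
  simp only [map_add, map_smul, add_apply, smul_apply, hw,
    h.rotation_isometry y hy, h.metric_self_rotation hy, h.metric_rotation_left hy, smul_eq_mul]
  simp

theorem eq_zero_of_metric (h : IsSurfaceGeometry U G Γ J) (hy : y ∈ U) {w x : E} (hw : w ≠ 0)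
    (h1 : G y x w = 0) (h2 : G y x (J y w) = 0) : x = 0 := by
  by_contra hx
  obtain ⟨a, b, hab⟩ := h.exists_eq_smul_add_smul hy hw x
  have hp := h.metric_pos y hy x hx
  have : G y x x = 0 := by
    conv_lhs => enter [2]; rw [hab]
    rw [map_add, map_smul, map_smul, h1, h2]
    simp
  exact hp.ne' this

/-- On an oriented Riemannian surface the rotation `J` is parallel. -/
theorem fderiv_rotation (h : IsSurfaceGeometry U G Γ J) (hy : y ∈ U) (u v : E) :
    fderiv ℝ J y u v = J y (Γ y u v) - Γ y u (J y v) := by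
  have hU := h.isOpen.mem_nhds hy
  have hJd := (h.differentiableAt_rotation hy).hasFDerivAt
  have hGd := (h.differentiableAt_metric hy).hasFDerivAt
  -- `N` is the covariant derivative of `J` in the direction `u`
  set N : E → E := fun v => fderiv ℝ J y u v + Γ y u (J y v) - J y (Γ y u v) with hN
  have hNadd : ∀ v w, N (v + w) = N v + N w := fun v w => by simp only [hN, map_add]; abel
  -- differentiate `J² = -1`
  have h1 : ∀ v, N (J y v) = -J y (N v) := by
    intro v
    have hv : HasFDerivAt (fun z => J z v) ((fderiv ℝ J y).flip v) y := by
      simpa using hJd.clm_apply (hasFDerivAt_const v y)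
    have hd := hJd.clm_apply hv
    have hc : (fun z => J z (J z v)) =ᶠ[𝓝 y] fun _ => -v :=
      Filter.eventually_of_mem hU fun z hz => h.rotation_sq z hz v
    have := congrArg (fun L => L u) (hd.unique ((hasFDerivAt_const (-v) y).congr_of_eventuallyEq hc))
    simp at this
    have e2 : J y (Γ y u (J y v)) - J y (Γ y u (J y v)) = 0 := sub_self _
    simp only [hN, map_sub, map_add, h.rotation_sq y hy, map_neg]
    rw [← sub_eq_zero] at this ⊢
    rw [← this]
    abel
  -- differentiate `G(J v, J v) = G(v, v)`
  have h2 : ∀ v, G y (N v) (J y v) = 0 := by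
    intro v
    have hv : HasFDerivAt (fun z => J z v) ((fderiv ℝ J y).flip v) y := by
      simpa using hJd.clm_apply (hasFDerivAt_const v y)
    have hd := (hGd.clm_apply hv).clm_apply hv
    have hd' := (hGd.clm_apply (hasFDerivAt_const v y)).clm_apply (hasFDerivAt_const v y)
    have hc : (fun z => G z (J z v) (J z v)) =ᶠ[𝓝 y] fun z => G z v v :=
      Filter.eventually_of_mem hU fun z hz => h.rotation_isometry z hz v v
    have := congrArg (fun L => L u) (hd.unique (hd'.congr_of_eventuallyEq hc))
    simp only [add_apply, ContinuousLinearMap.comp_apply,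
      ContinuousLinearMap.flip_apply, h.compat y hy, zero_apply,
      map_zero] at this
    rw [h.metric_symm y hy (J y v) (Γ y u (J y v)), h.metric_symm y hy (J y v) (fderiv ℝ J y u v),
      h.metric_symm y hy v (Γ y u v), ← h.rotation_isometry y hy (Γ y u v) v] at this
    simp only [hN, map_add, map_sub, add_apply, sub_apply]
    linarith
  -- polarize `G(N v, J v) = 0` at `v + J v`
  have h3 : ∀ v, G y (N v) v = 0 := by
    intro v
    have e := h2 (v + J y v)
    rw [hNadd, map_add, map_add, map_add, add_apply,
      add_apply, h2 v, h2 (J y v), h1, h.rotation_sq y hy, map_neg, map_neg,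
      neg_apply, h.rotation_isometry y hy] at e
    linarith
  have h4 : N v = 0 := by
    by_cases hv : v = 0
    · simp [hN, hv]
    · exact h.eq_zero_of_metric hy hv (h3 v) (h2 v)
  rw [← sub_eq_zero, ← h4]
  simp only [hN]
  abel

/-! ### Derivatives along curves -/

section Curves

variable {c : ℝ → E} {a b : ℝ → E} {c' a' b' : E} {s : ℝ}

theorem hasDerivAt_metric (h : IsSurfaceGeometry U G Γ J) (hc : HasDerivAt c c' s)
    (ha : HasDerivAt a a' s) (hb : HasDerivAt b b' s) (hs : c s ∈ U) :
    HasDerivAt (fun x => G (c x) (a x) (b x))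
      (G (c s) (a' + Γ (c s) c' (a s)) (b s) + G (c s) (a s) (b' + Γ (c s) c' (b s))) s := by
  have hG := (h.differentiableAt_metric hs).hasFDerivAt.comp_hasDerivAt s hc
  refine ((hG.clm_apply ha).clm_apply hb).congr_deriv ?_
  simp only [add_apply, h.compat _ hs, map_add, Function.comp]
  ring

theorem hasDerivAt_rotation (h : IsSurfaceGeometry U G Γ J) (hc : HasDerivAt c c' s)
    (ha : HasDerivAt a a' s) (hs : c s ∈ U) :
    HasDerivAt (fun x => J (c x) (a x))
      (J (c s) (a' + Γ (c s) c' (a s)) - Γ (c s) c' (J (c s) (a s))) s := by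
  have hJ := (h.differentiableAt_rotation hs).hasFDerivAt.comp_hasDerivAt s hc
  refine (hJ.clm_apply ha).congr_deriv ?_
  simp only [h.fderiv_rotation hs, map_add, Function.comp]
  abel

theorem hasDerivAt_christoffel (h : IsSurfaceGeometry U G Γ J) (hc : HasDerivAt c c' s)
    (ha : HasDerivAt a a' s) (hb : HasDerivAt b b' s) (hs : c s ∈ U) :
    HasDerivAt (fun x => Γ (c x) (a x) (b x))
      (fderiv ℝ Γ (c s) c' (a s) (b s) + Γ (c s) a' (b s) + Γ (c s) (a s) b') s := by
  have hG := (h.differentiableAt_christoffel hs).hasFDerivAt.comp_hasDerivAt s hc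
  refine ((hG.clm_apply ha).clm_apply hb).congr_deriv ?_
  simp only [add_apply, Function.comp]

end Curves

/-! ### Curvature -/

/-- The curvature is skew: `∇` is metric and second derivatives of `G(x, x)` commute. -/
theorem metric_localCurvature_self (h : IsSurfaceGeometry U G Γ J) (hy : y ∈ U) (u v x : E) :
    G y (localCurvature Γ y u v x) x = 0 := by
  have hU := h.isOpen.mem_nhds hy
  have hGd := (h.differentiableAt_metric hy).hasFDerivAt
  have hΓd := (h.differentiableAt_christoffel hy).hasFDerivAt
  have hG2 : DifferentiableAt ℝ (fderiv ℝ G) y :=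
    ((h.contDiffOn_metric.contDiffAt hU).fderiv_right (m := 1) (by norm_cast)).differentiableAt
      (by simp)
  have hsymm : fderiv ℝ (fderiv ℝ G) y u v = fderiv ℝ (fderiv ℝ G) y v u :=
    (h.contDiffOn_metric.contDiffAt hU).isSymmSndFDerivAt
      (by simp only [minSmoothness_of_isRCLikeNormedField]; exact ENat.LEInfty.out) u v
  -- the second derivative of `G(x, x)`
  have key : ∀ u v, fderiv ℝ (fderiv ℝ G) y u v x x =
      2 * (G y (Γ y u (Γ y v x)) x + G y (Γ y v x) (Γ y u x) + G y (fderiv ℝ Γ y u v x) x) := by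
    intro u v
    have hd := ((hG2.hasFDerivAt.clm_apply (hasFDerivAt_const v y)).clm_apply
      (hasFDerivAt_const x y)).clm_apply (hasFDerivAt_const x y)
    have hΓ' := (hΓd.clm_apply (hasFDerivAt_const v y)).clm_apply (hasFDerivAt_const x y)
    have hd' := ((hGd.clm_apply hΓ').clm_apply (hasFDerivAt_const x y)).const_mul 2
    have hc : (fun z => fderiv ℝ G z v x x) =ᶠ[𝓝 y] fun z => 2 * G z (Γ z v x) x :=
      Filter.eventually_of_mem hU fun z hz => by
        simp only [h.compat z hz, h.metric_symm z hz x]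
        ring
    have := congrArg (fun L => L u) (hd.unique (hd'.congr_of_eventuallyEq hc))
    simp [h.compat y hy] at this
    rw [this]
    ring
  have h1 := key u v
  have h2 := key v u
  rw [hsymm, h2, h.metric_symm y hy (Γ y u x)] at h1
  simp only [localCurvature, map_add, map_sub, add_apply,
    sub_apply]
  linarith

theorem metric_localCurvature_swap (h : IsSurfaceGeometry U G Γ J) (hy : y ∈ U) (u v x z : E) :
    G y (localCurvature Γ y u v x) z = -G y (localCurvature Γ y u v z) x := by
  have hadd : localCurvature Γ y u v (x + z) =
      localCurvature Γ y u v x + localCurvature Γ y u v z := by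
    simp only [localCurvature, map_add]; abel
  have := h.metric_localCurvature_self hy u v (x + z)
  rw [hadd, map_add, map_add, add_apply, add_apply,
    h.metric_localCurvature_self hy, h.metric_localCurvature_self hy] at this
  linarith

theorem _root_.Thermostat.localCurvature_frame (Γ : E → E →L[ℝ] E →L[ℝ] E) (y u v x : E)
    (a b c d : ℝ) : localCurvature Γ y (a • u + b • v) (c • u + d • v) x =
      (a * d - b * c) • localCurvature Γ y u v x := by
  simp only [localCurvature, map_add, map_smul, add_apply,
    smul_apply]
  module

theorem _root_.Thermostat.localCurvature_smul_add_smul (Γ : E → E →L[ℝ] E →L[ℝ] E)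
    (y u v x z : E) (a b : ℝ) : localCurvature Γ y u v (a • x + b • z) =
      a • localCurvature Γ y u v x + b • localCurvature Γ y u v z := by
  simp only [localCurvature, map_add, map_smul]
  module

/-- The curvature term of the Jacobi equation is the Gauss curvature. -/
theorem metric_localCurvature_rotation (h : IsSurfaceGeometry U G Γ J) (hy : y ∈ U) {w : E}
    (hw : G y w w = 1) (η e₀ e₁ : E) (he : LinearIndependent ℝ ![e₀, e₁]) :
    G y (localCurvature Γ y w η w) (J y w) =
      -(G y (localCurvature Γ y e₀ e₁ e₁) e₀ / (G y e₀ e₀ * G y e₁ e₁ - G y e₀ e₁ * G y e₁ e₀))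
        * G y η (J y w) := by
  have hw0 : w ≠ 0 := fun h0 => by simp [h0] at hw
  obtain ⟨a, b, h0⟩ := h.exists_eq_smul_add_smul hy hw0 e₀
  obtain ⟨c, d, h1⟩ := h.exists_eq_smul_add_smul hy hw0 e₁
  obtain ⟨x, z, hη⟩ := h.exists_eq_smul_add_smul hy hw0 η
  have hD : a * d - b * c ≠ 0 := by
    intro hD
    rw [LinearIndependent.pair_iff] at he
    have e1 := he d (-b) (by
      rw [h0, h1]
      have : d • (a • w + b • J y w) + (-b) • (c • w + d • J y w) = (a * d - b * c) • w := by module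
      rw [this, hD, zero_smul])
    have e2 := he (-c) a (by
      rw [h0, h1]
      have : (-c) • (a • w + b • J y w) + a • (c • w + d • J y w) = (a * d - b * c) • J y w := by
        module
      rw [this, hD, zero_smul])
    have hb : b = 0 := by linarith [e1.2]
    have := (he 1 0 (by rw [h0, e2.2, hb]; simp)).1
    norm_num at this
  have hJw : G y (J y w) w = 0 := by rw [h.metric_symm y hy]; exact h.metric_self_rotation hy w
  have hk : ∀ p q : ℝ, localCurvature Γ y w (p • w + q • J y w) w =
      q • localCurvature Γ y w (J y w) w := by
    intro p q
    have := localCurvature_frame Γ y w (J y w) w 1 0 p q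
    simpa using this
  set k := G y (localCurvature Γ y w (J y w) w) (J y w) with hkdef
  have hk2 : G y (localCurvature Γ y w (J y w) (J y w)) w = -k := by
    rw [h.metric_localCurvature_swap hy]
  have hnum : G y (localCurvature Γ y e₀ e₁ e₁) e₀ = -(a * d - b * c) ^ 2 * k := by
    rw [h0, h1, localCurvature_frame, localCurvature_smul_add_smul]
    simp only [map_add, map_smul, add_apply, smul_apply,
      smul_eq_mul, h.metric_localCurvature_self hy, hk2, ← hkdef]
    ring
  have hden : G y e₀ e₀ * G y e₁ e₁ - G y e₀ e₁ * G y e₁ e₀ = (a * d - b * c) ^ 2 := by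
    rw [h0, h1]
    simp only [map_add, map_smul, add_apply, smul_apply,
      smul_eq_mul, h.rotation_isometry y hy, hw, h.metric_self_rotation hy, hJw]
    ring
  rw [hnum, hden, hη, hk]
  simp only [map_add, map_smul, add_apply, smul_apply,
      smul_eq_mul, h.rotation_isometry y hy, hw, h.metric_self_rotation hy, ← hkdef]
  field_simp
  ring

end IsSurfaceGeometry

/-! ### The Jacobi equation -/

/-- Partial derivatives of a function of two real variables commute, in the form that
`t ↦ ∂_r f(t, r₀)` is differentiable with derivative `∂_r ∂_t f`. -/
theorem hasDerivAt_deriv_snd {F : Type*} [NormedAddCommGroup F] [NormedSpace ℝ F]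
    {f : ℝ × ℝ → F} {t₀ r₀ : ℝ} (hf : ContDiffAt ℝ 2 f (t₀, r₀)) :
    HasDerivAt (fun t => deriv (fun r => f (t, r)) r₀)
      (deriv (fun r => deriv (fun t => f (t, r)) t₀) r₀) t₀ := by
  have hev : ∀ᶠ x in 𝓝 (t₀, r₀), DifferentiableAt ℝ f x :=
    (hf.eventually (by simp)).mono fun x hx => hx.differentiableAt (by simp)
  have h2 : DifferentiableAt ℝ (fderiv ℝ f) (t₀, r₀) :=
    (hf.fderiv_right (m := 1) (by norm_num)).differentiableAt (by simp)
  have hr : ∀ {t r : ℝ}, DifferentiableAt ℝ f (t, r) →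
      deriv (fun r => f (t, r)) r = fderiv ℝ f (t, r) (0, 1) := fun {t r} h =>
    (h.hasFDerivAt.comp_hasDerivAt r ((hasDerivAt_const r t).prodMk (hasDerivAt_id r))).deriv
  have ht : ∀ {t r : ℝ}, DifferentiableAt ℝ f (t, r) →
      deriv (fun t => f (t, r)) t = fderiv ℝ f (t, r) (1, 0) := fun {t r} h =>
    (h.hasFDerivAt.comp_hasDerivAt t ((hasDerivAt_id t).prodMk (hasDerivAt_const t r))).deriv
  have hct : Tendsto (fun t : ℝ => (t, r₀)) (𝓝 t₀) (𝓝 (t₀, r₀)) :=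
    (continuous_id.prodMk continuous_const).tendsto' _ _ rfl
  have hcr : Tendsto (fun r : ℝ => (t₀, r)) (𝓝 r₀) (𝓝 (t₀, r₀)) :=
    (continuous_const.prodMk continuous_id).tendsto' _ _ rfl
  have e1 : (fun t => deriv (fun r => f (t, r)) r₀) =ᶠ[𝓝 t₀]
      fun t => fderiv ℝ f (t, r₀) (0, 1) := (hct.eventually hev).mono fun t h => hr h
  have e2 : (fun r => deriv (fun t => f (t, r)) t₀) =ᶠ[𝓝 r₀]
      fun r => fderiv ℝ f (t₀, r) (1, 0) := (hcr.eventually hev).mono fun r h => ht h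
  have d1 : HasDerivAt (fun t => fderiv ℝ f (t, r₀) (0, 1))
      (fderiv ℝ (fderiv ℝ f) (t₀, r₀) (1, 0) (0, 1)) t₀ := by
    have hL : HasDerivAt (fun t => fderiv ℝ f (t, r₀))
        (fderiv ℝ (fderiv ℝ f) (t₀, r₀) (1, 0)) t₀ :=
      HasFDerivAt.comp_hasDerivAt (f := fun t : ℝ => (t, r₀)) t₀ h2.hasFDerivAt
        ((hasDerivAt_id t₀).prodMk (hasDerivAt_const t₀ r₀))
    simpa using hL.clm_apply (hasDerivAt_const t₀ ((0 : ℝ), (1 : ℝ)))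
  have d2 : HasDerivAt (fun r => fderiv ℝ f (t₀, r) (1, 0))
      (fderiv ℝ (fderiv ℝ f) (t₀, r₀) (0, 1) (1, 0)) r₀ := by
    have hL : HasDerivAt (fun r => fderiv ℝ f (t₀, r))
        (fderiv ℝ (fderiv ℝ f) (t₀, r₀) (0, 1)) r₀ :=
      HasFDerivAt.comp_hasDerivAt (f := fun r : ℝ => (t₀, r)) r₀ h2.hasFDerivAt
        ((hasDerivAt_const r₀ t₀).prodMk (hasDerivAt_id r₀))
    simpa using hL.clm_apply (hasDerivAt_const r₀ ((1 : ℝ), (0 : ℝ)))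
  rw [e2.deriv_eq, d2.deriv]
  have hsymm := hf.isSymmSndFDerivAt (by simp)
  rw [hsymm (0, 1) (1, 0)]
  exact d1.congr_of_eventuallyEq e1

/-- The Jacobi equation of a thermostat flow in coordinates. Here `r` is the parameter of a
variation `(f, k)` of solutions of `f' = k`, `k' = l J k - Γ(k, k)` through unit vectors, `η` and `ζ`
are the derivatives of `f` and `k` in `r`, and `ζ + Γ(η, k)` is the covariant derivative of `k`. -/
theorem IsSurfaceGeometry.hasDerivAt_jacobi {U : Set E} {G : E → E →L[ℝ] E →L[ℝ] ℝ}
    {Γ : E → E →L[ℝ] E →L[ℝ] E} {J : E → E →L[ℝ] E} (h : IsSurfaceGeometry U G Γ J)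
    {f k : ℝ × ℝ → E} {l : ℝ × ℝ → ℝ} {t₀ : ℝ} (hf : ContDiffAt ℝ ∞ f (t₀, 0))
    (hk : ContDiffAt ℝ ∞ k (t₀, 0)) (hU : f (t₀, 0) ∈ U)
    (hft : ∀ᶠ x in 𝓝 (t₀, (0 : ℝ)), HasDerivAt (fun t => f (t, x.2)) (k x) x.1)
    (hkt : ∀ᶠ x in 𝓝 (t₀, (0 : ℝ)), HasDerivAt (fun t => k (t, x.2))
      (l x • J (f x) (k x) - Γ (f x) (k x) (k x)) x.1)
    (hunit : ∀ᶠ x in 𝓝 (t₀, (0 : ℝ)), G (f x) (k x) (k x) = 1)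
    {lr lt : ℝ} (hlr : HasDerivAt (fun r => l (t₀, r)) lr 0)
    (hlt : HasDerivAt (fun t => l (t, 0)) lt t₀) {η ζ : ℝ → E}
    (hη : η = fun t => deriv (fun r => f (t, r)) 0) (hζ : ζ = fun t => deriv (fun r => k (t, r)) 0) :
    G (f (t₀, 0)) (ζ t₀ + Γ (f (t₀, 0)) (η t₀) (k (t₀, 0))) (k (t₀, 0)) = 0 ∧
    HasDerivAt (fun t => G (f (t, 0)) (η t) (J (f (t, 0)) (k (t, 0))))
      (G (f (t₀, 0)) (ζ t₀ + Γ (f (t₀, 0)) (η t₀) (k (t₀, 0))) (J (f (t₀, 0)) (k (t₀, 0)))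
        - l (t₀, 0) * G (f (t₀, 0)) (η t₀) (k (t₀, 0))) t₀ ∧
    HasDerivAt (fun t => G (f (t, 0)) (ζ t + Γ (f (t, 0)) (η t) (k (t, 0))) (J (f (t, 0)) (k (t, 0)))
        - l (t, 0) * G (f (t, 0)) (η t) (k (t, 0)))
      (lr + G (f (t₀, 0)) (localCurvature Γ (f (t₀, 0)) (k (t₀, 0)) (η t₀) (k (t₀, 0)))
          (J (f (t₀, 0)) (k (t₀, 0))) - lt * G (f (t₀, 0)) (η t₀) (k (t₀, 0))
        - l (t₀, 0) ^ 2 * G (f (t₀, 0)) (η t₀) (J (f (t₀, 0)) (k (t₀, 0)))) t₀ := by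
  have hct : Tendsto (fun t : ℝ => (t, (0 : ℝ))) (𝓝 t₀) (𝓝 (t₀, 0)) :=
    (continuous_id.prodMk continuous_const).tendsto' _ _ rfl
  have hcr : Tendsto (fun r : ℝ => (t₀, r)) (𝓝 0) (𝓝 (t₀, 0)) :=
    (continuous_const.prodMk continuous_id).tendsto' _ _ rfl
  have hfr : HasDerivAt (fun r => f (t₀, r)) (η t₀) 0 := by
    rw [hη]
    exact (((hf.differentiableAt (by simp)).comp (0 : ℝ)
      ((differentiableAt_const t₀).prodMk differentiableAt_id)).hasDerivAt)
  have hkr : HasDerivAt (fun r => k (t₀, r)) (ζ t₀) 0 := by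
    rw [hζ]
    exact (((hk.differentiableAt (by simp)).comp (0 : ℝ)
      ((differentiableAt_const t₀).prodMk differentiableAt_id)).hasDerivAt)
  have hf0 : HasDerivAt (fun t => f (t, 0)) (k (t₀, 0)) t₀ := hft.self_of_nhds
  have hk0 : HasDerivAt (fun t => k (t, 0))
      (l (t₀, 0) • J (f (t₀, 0)) (k (t₀, 0)) - Γ (f (t₀, 0)) (k (t₀, 0)) (k (t₀, 0))) t₀ :=
    hkt.self_of_nhds
  have hηt : HasDerivAt η (ζ t₀) t₀ := by
    have h1 := hasDerivAt_deriv_snd (hf.of_le (m := 2) ENat.LEInfty.out)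
    have h2 : (fun r => deriv (fun t => f (t, r)) t₀) =ᶠ[𝓝 0] fun r => k (t₀, r) :=
      (hcr.eventually hft).mono fun r hr => hr.deriv
    rw [h2.deriv_eq, hkr.deriv, ← hη] at h1
    exact h1
  have hx₀ : HasDerivAt ζ (lr • J (f (t₀, 0)) (k (t₀, 0)) + l (t₀, 0) •
      (J (f (t₀, 0)) (ζ t₀ + Γ (f (t₀, 0)) (η t₀) (k (t₀, 0)))
        - Γ (f (t₀, 0)) (η t₀) (J (f (t₀, 0)) (k (t₀, 0))))
      - (fderiv ℝ Γ (f (t₀, 0)) (η t₀) (k (t₀, 0)) (k (t₀, 0))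
        + Γ (f (t₀, 0)) (ζ t₀) (k (t₀, 0)) + Γ (f (t₀, 0)) (k (t₀, 0)) (ζ t₀))) t₀ := by
    have h1 := hasDerivAt_deriv_snd (hk.of_le (m := 2) ENat.LEInfty.out)
    have h2 : (fun r => deriv (fun t => k (t, r)) t₀) =ᶠ[𝓝 0] fun r =>
        l (t₀, r) • J (f (t₀, r)) (k (t₀, r)) - Γ (f (t₀, r)) (k (t₀, r)) (k (t₀, r)) :=
      (hcr.eventually hkt).mono fun r hr => hr.deriv
    have h3 := (hlr.smul (h.hasDerivAt_rotation hfr hkr hU)).sub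
      (h.hasDerivAt_christoffel hfr hkr hkr hU)
    rw [h2.deriv_eq, ← hζ] at h1
    refine h1.congr_deriv (h3.deriv.trans ?_)
    abel
  have hsymm := h.christoffel_symm _ hU
  have hunit0 : G (f (t₀, 0)) (k (t₀, 0)) (k (t₀, 0)) = 1 := hunit.self_of_nhds
  have hZw : G (f (t₀, 0)) (ζ t₀ + Γ (f (t₀, 0)) (η t₀) (k (t₀, 0))) (k (t₀, 0)) = 0 := by
    have h1 := h.hasDerivAt_metric hfr hkr hkr hU
    have h2 : (fun r => G (f (t₀, r)) (k (t₀, r)) (k (t₀, r))) =ᶠ[𝓝 0] fun _ => 1 :=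
      hcr.eventually hunit
    have h3 := h1.unique ((hasDerivAt_const (0 : ℝ) (1 : ℝ)).congr_of_eventuallyEq h2)
    rw [h.metric_symm _ hU (k (t₀, 0))] at h3
    linarith
  have hZ := hx₀.add (h.hasDerivAt_christoffel hf0 hηt hk0 hU)
  have hJk := h.hasDerivAt_rotation hf0 hk0 hU
  have hY := h.hasDerivAt_metric hf0 hηt hJk hU
  have hV := h.hasDerivAt_metric hf0 hZ hJk hU
  have hX := h.hasDerivAt_metric hf0 hηt hk0 hU
  have hW := hV.sub (hlt.mul hX)
  set y := f (t₀, 0)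
  set w := k (t₀, 0)
  set L := l (t₀, 0)
  have hcov : L • J y w - Γ y w w + Γ y w w = L • J y w := by abel
  have hJcov : J y (L • J y w - Γ y w w + Γ y w w) - Γ y w (J y w) + Γ y w (J y w) = -(L • w) := by
    rw [hcov, map_smul, h.rotation_sq y hU]; simp
  refine ⟨hZw, hY.congr_deriv ?_, hW.congr_deriv ?_⟩
  · rw [hJcov, hsymm w]
    simp only [map_neg, map_smul, smul_eq_mul]
    ring
  · rw [hJcov, hcov]
    have hcurv : lr • J y w + L • (J y (ζ t₀ + Γ y (η t₀) w) - Γ y (η t₀) (J y w))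
        - (fderiv ℝ Γ y (η t₀) w w + Γ y (ζ t₀) w + Γ y w (ζ t₀))
        + (fderiv ℝ Γ y w (η t₀) w + Γ y (ζ t₀) w + Γ y (η t₀) (L • J y w - Γ y w w))
        + Γ y w (ζ t₀ + Γ y (η t₀) w) = lr • J y w + L • J y (ζ t₀ + Γ y (η t₀) w)
          + localCurvature Γ y w (η t₀) w := by
      simp only [localCurvature, map_add, map_sub, map_smul]
      module
    simp only [Pi.add_apply]
    rw [hcurv, hsymm w (η t₀)]
    have e1 := h.rotation_isometry y hU (ζ t₀ + Γ y (η t₀) w) w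
    have e2 := h.rotation_isometry y hU w w
    generalize ζ t₀ + Γ y (η t₀) w = Z at *
    simp only [map_neg, map_smul, map_add, add_apply, smul_apply, smul_eq_mul, e1, e2, hZw, hunit0]
    ring

end LocalGeometry

/-! ### Linear and bilinear maps from their values on the standard basis -/

section Basis

variable {F : Type*} [NormedAddCommGroup F] [NormedSpace ℝ F]

theorem eq_sum_basisVec (v : R2) : v = v 0 • basisVec 0 + v 1 • basisVec 1 := by
  ext i
  fin_cases i <;> simp [basisVec]

/-- The linear map on `ℝ²` with the same values on the standard basis as `L`. -/
noncomputable def linOfBasis (L : R2 → F) : R2 →L[ℝ] F :=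
  ∑ i, (EuclideanSpace.proj i : R2 →L[ℝ] ℝ).smulRight (L (basisVec i))

/-- The bilinear map on `ℝ²` with the same values on the standard basis as `B`. -/
noncomputable def bilinOfBasis (B : R2 → R2 → F) : R2 →L[ℝ] R2 →L[ℝ] F :=
  linOfBasis fun u => linOfBasis (B u)

theorem linOfBasis_apply {L : R2 → F} (hadd : ∀ u v, L (u + v) = L u + L v)
    (hsmul : ∀ (a : ℝ) u, L (a • u) = a • L u) (v : R2) : linOfBasis L v = L v := by
  conv_rhs => rw [eq_sum_basisVec v, hadd, hsmul, hsmul]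
  simp [linOfBasis, Fin.sum_univ_two]

theorem bilinOfBasis_apply {B : R2 → R2 → F} (hadd : ∀ u u' v, B (u + u') v = B u v + B u' v)
    (hsmul : ∀ (a : ℝ) u v, B (a • u) v = a • B u v)
    (hadd' : ∀ u v v', B u (v + v') = B u v + B u v')
    (hsmul' : ∀ (a : ℝ) u v, B u (a • v) = a • B u v) (u v : R2) : bilinOfBasis B u v = B u v := by
  have h : ∀ u v, linOfBasis (B u) v = B u v := fun u v =>
    linOfBasis_apply (hadd' u) (fun a => hsmul' a u) v
  rw [bilinOfBasis, linOfBasis_apply, h]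
  · intro u u'; ext v; simp [h, hadd]
  · intro a u; ext v; simp [h, hsmul]

theorem contDiffOn_linOfBasis {E : Type*} [NormedAddCommGroup E] [NormedSpace ℝ E] {U : Set E}
    {n : ℕ∞ω} {L : E → R2 → F} (h : ∀ i, ContDiffOn ℝ n (fun y => L y (basisVec i)) U) :
    ContDiffOn ℝ n (fun y => linOfBasis (L y)) U := by
  unfold linOfBasis
  exact ContDiffOn.sum fun i _ =>
    ((ContinuousLinearMap.smulRightL ℝ R2 F (EuclideanSpace.proj i)).contDiff).comp_contDiffOn (h i)

theorem contDiffOn_bilinOfBasis {E : Type*} [NormedAddCommGroup E] [NormedSpace ℝ E] {U : Set E}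
    {n : ℕ∞ω} {B : E → R2 → R2 → F}
    (h : ∀ i j, ContDiffOn ℝ n (fun y => B y (basisVec i) (basisVec j)) U) :
    ContDiffOn ℝ n (fun y => bilinOfBasis (B y)) U :=
  contDiffOn_linOfBasis fun i => contDiffOn_linOfBasis fun j => h i j

end Basis

section Geometry

variable {M : Type*} [TopologicalSpace M] [ChartedSpace R2 M]

/-! ### Charts of the tangent bundle -/

theorem coordPt_mem_source {c : M} {y : R2} (hy : y ∈ (extChartAt (𝓡 2) c).target) :
    coordPt c y ∈ (chartAt R2 c).source := by
  have := (extChartAt (𝓡 2) c).map_target hy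
  rwa [extChartAt_source] at this

theorem extChartAt_mem_target {c x : M} (hx : x ∈ (chartAt R2 c).source) :
    extChartAt (𝓡 2) c x ∈ (extChartAt (𝓡 2) c).target :=
  (extChartAt (𝓡 2) c).map_source (by rwa [extChartAt_source])

theorem coordPt_extChartAt {c x : M} (hx : x ∈ (chartAt R2 c).source) :
    coordPt c (extChartAt (𝓡 2) c x) = x :=
  (extChartAt (𝓡 2) c).left_inv (by rwa [extChartAt_source])

theorem extChartAt_coordPt {c : M} {y : R2} (hy : y ∈ (extChartAt (𝓡 2) c).target) :
    extChartAt (𝓡 2) c (coordPt c y) = y :=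
  (extChartAt (𝓡 2) c).right_inv hy

variable [IsManifold (𝓡 2) ∞ M]

/-- The tangent vector with base point and components `(y, v)` in the chart at `c`. -/
noncomputable def tangentPt (c : M) (y v : R2) : TM M := ⟨coordPt c y, coordVec c (coordPt c y) v⟩

theorem coordVec_eq_symmL {c x : M} (hx : x ∈ (chartAt R2 c).source) (v : R2) :
    coordVec c x v =
      (trivializationAt R2 (fun x : M => TangentSpace (𝓡 2) x) c).symmL ℝ x v :=
  (Trivialization.symmL_apply (R := ℝ) _ hx v).symm

theorem coordVec_add {c x : M} (hx : x ∈ (chartAt R2 c).source) (v w : R2) :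
    coordVec c x (v + w) = coordVec c x v + coordVec c x w := by
  simp only [coordVec_eq_symmL hx, map_add]

theorem coordVec_smul {c x : M} (hx : x ∈ (chartAt R2 c).source) (a : ℝ) (v : R2) :
    coordVec c x (a • v) = a • coordVec c x v := by
  simp only [coordVec_eq_symmL hx, map_smul]

theorem components_eq {c x : M} (hx : x ∈ (chartAt R2 c).source) (v : TangentSpace (𝓡 2) x) :
    components c (⟨x, v⟩ : TM M) =
      (trivializationAt R2 (fun x : M => TangentSpace (𝓡 2) x) c).continuousLinearMapAt ℝ x v :=
  (Trivialization.continuousLinearMapAt_apply_of_mem (R := ℝ)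
    (trivializationAt R2 (fun x : M => TangentSpace (𝓡 2) x) c) hx v).symm

theorem components_add {c x : M} (hx : x ∈ (chartAt R2 c).source) (v w : TangentSpace (𝓡 2) x) :
    components c (⟨x, v + w⟩ : TM M) = components c ⟨x, v⟩ + components c ⟨x, w⟩ := by
  simp only [components_eq hx, map_add]

theorem components_smul {c x : M} (hx : x ∈ (chartAt R2 c).source) (a : ℝ)
    (v : TangentSpace (𝓡 2) x) :
    components c (⟨x, a • v⟩ : TM M) = a • components c ⟨x, v⟩ := by
  simp only [components_eq hx, map_smul]

theorem coordVec_components {c x : M} (hx : x ∈ (chartAt R2 c).source)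
    (v : TangentSpace (𝓡 2) x) : coordVec c x (components c (⟨x, v⟩ : TM M)) = v := by
  rw [components_eq hx, coordVec_eq_symmL hx]
  exact Trivialization.symmL_continuousLinearMapAt _ hx v

theorem components_coordVec {c x : M} (hx : x ∈ (chartAt R2 c).source) (v : R2) :
    components c (⟨x, coordVec c x v⟩ : TM M) = v := by
  rw [components_eq hx, coordVec_eq_symmL hx]
  exact Trivialization.continuousLinearMapAt_symmL _ hx v

theorem tangentPt_extChartAt_components {c : M} {σ : TM M} (hσ : σ.1 ∈ (chartAt R2 c).source) :
    tangentPt c (extChartAt (𝓡 2) c σ.1) (components c σ) = σ := by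
  obtain ⟨x, v⟩ := σ
  unfold tangentPt
  rw [coordPt_extChartAt hσ, coordVec_components hσ]

theorem components_tangentPt {c : M} {y : R2} (hy : y ∈ (extChartAt (𝓡 2) c).target) (v : R2) :
    components c (tangentPt c y v) = v :=
  components_coordVec (coordPt_mem_source hy) v

/-- At its own base point the chart does not change the components of a tangent vector. -/
theorem components_self (x : M) (v : TangentSpace (𝓡 2) x) : components x (⟨x, v⟩ : TM M) = v := by
  unfold components
  rw [TangentBundle.trivializationAt_apply]
  exact tangentCoordChange_self (I := 𝓡 2) (x := x) (z := x) (v := v) (mem_extChartAt_source x)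

theorem coordVec_self (x : M) (v : R2) : coordVec x x v = v := by
  have := components_self x (coordVec x x v)
  rw [components_coordVec (mem_chart_source R2 x)] at this
  exact this.symm

theorem extChartAt_tangent_apply (σ τ : TM M) : extChartAt (𝓡 2).tangent σ τ =
    (extChartAt (𝓡 2) σ.1 τ.1, components σ.1 τ) := by
  rw [FiberBundle.extChartAt]
  rfl

theorem extChartAt_tangent_symm_apply {σ : TM M} {p : R2 × R2}
    (hp : p.1 ∈ (extChartAt (𝓡 2) σ.1).target) :
    (extChartAt (𝓡 2).tangent σ).symm p = tangentPt σ.1 p.1 p.2 := by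
  have hs : (tangentPt σ.1 p.1 p.2).1 ∈ (chartAt R2 σ.1).source := coordPt_mem_source hp
  have hsrc : tangentPt σ.1 p.1 p.2 ∈ (extChartAt (𝓡 2).tangent σ).source := by
    rw [extChartAt_source]
    exact (TangentBundle.mem_chart_source_iff _ _).2 hs
  rw [← (extChartAt (𝓡 2).tangent σ).left_inv hsrc, extChartAt_tangent_apply,
    components_tangentPt hp]
  congr 2
  exact Prod.ext (extChartAt_coordPt hp).symm rfl

theorem contMDiffOn_tangentPt (c : M) :
    ContMDiffOn 𝓘(ℝ, R2 × R2) (𝓡 2).tangent ∞ (fun p : R2 × R2 => tangentPt c p.1 p.2)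
      ((extChartAt (𝓡 2) c).target ×ˢ univ) := by
  have h := contMDiffOn_extChartAt_symm (I := (𝓡 2).tangent) (n := ∞) (⟨c, 0⟩ : TM M)
  have ht : (extChartAt (𝓡 2).tangent (⟨c, 0⟩ : TM M)).target =
      (extChartAt (𝓡 2) c).target ×ˢ univ := by
    ext p
    rw [FiberBundle.extChartAt_target]
    simp only [mem_prod, mem_univ, and_true, mem_inter_iff, mem_preimage]
    exact ⟨fun h => h.1, fun h => ⟨h, coordPt_mem_source h⟩⟩
  rw [ht] at h
  exact h.congr fun p hp => (extChartAt_tangent_symm_apply (σ := (⟨c, 0⟩ : TM M)) hp.1).symm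

theorem contMDiffAt_coord {c : M} {σ : TM M} (hσ : σ.1 ∈ (chartAt R2 c).source) :
    ContMDiffAt (𝓡 2).tangent 𝓘(ℝ, R2 × R2) ∞
      (fun τ : TM M => (extChartAt (𝓡 2) c τ.1, components c τ)) σ := by
  have h := contMDiffAt_extChartAt' (I := (𝓡 2).tangent) (n := ∞) (x := (⟨c, 0⟩ : TM M))
    ((TangentBundle.mem_chart_source_iff σ (⟨c, 0⟩ : TM M)).2 hσ)
  exact h.congr_of_eventuallyEq (Eventually.of_forall fun τ =>
    (extChartAt_tangent_apply (⟨c, 0⟩ : TM M) τ).symm)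

/-- A smooth function on `TM` is smooth in coordinates. -/
theorem contDiffOn_comp_tangentPt {F : Type*} [NormedAddCommGroup F] [NormedSpace ℝ F]
    {f : TM M → F} (hf : ContMDiff (𝓡 2).tangent 𝓘(ℝ, F) ∞ f) (c : M) :
    ContDiffOn ℝ ∞ (fun p : R2 × R2 => f (tangentPt c p.1 p.2))
      ((extChartAt (𝓡 2) c).target ×ˢ univ) :=
  contMDiffOn_iff_contDiffOn.1 (hf.comp_contMDiffOn (contMDiffOn_tangentPt c))

theorem contMDiffOn_tangentPt_left (c : M) (v : R2) :
    ContMDiffOn 𝓘(ℝ, R2) (𝓡 2).tangent ∞ (fun y => tangentPt c y v)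
      (extChartAt (𝓡 2) c).target :=
  (contMDiffOn_tangentPt c).comp
    (contDiff_id.prodMk contDiff_const).contMDiff.contMDiffOn (fun _ hy => ⟨hy, trivial⟩)

end Geometry

section Geometry

variable {M : Type*} [TopologicalSpace M] [ChartedSpace R2 M] [IsManifold (𝓡 2) ∞ M]

/-! ### The geometry of a surface in a chart -/

/-- The metric in the chart at `c`, as a bilinear form depending on the point. -/
noncomputable def metricCLM (g : Metric M) (c : M) (y : R2) : R2 →L[ℝ] R2 →L[ℝ] ℝ :=
  bilinOfBasis (metricCoord g c y)

/-- The Christoffel symbols in the chart at `c`, as a bilinear map depending on the point. -/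
noncomputable def christoffelCLM (g : Metric M) (c : M) (y : R2) : R2 →L[ℝ] R2 →L[ℝ] R2 :=
  bilinOfBasis (christoffel g c y)

/-- The rotation `J` in the chart at `c`. -/
noncomputable def rotationCLM {g : Metric M} (o : Orientation g) (c : M) (y : R2) : R2 →L[ℝ] R2 :=
  linOfBasis fun v => components c ⟨coordPt c y, o.J (coordPt c y) (coordVec c (coordPt c y) v)⟩

theorem metricCLM_apply (g : Metric M) {c : M} {y : R2} (hy : y ∈ (extChartAt (𝓡 2) c).target)
    (v w : R2) : metricCLM g c y v w = metricCoord g c y v w := by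
  have hx := coordPt_mem_source hy
  refine bilinOfBasis_apply ?_ ?_ ?_ ?_ v w <;> intros <;>
    simp only [metricCoord, coordVec_add hx, coordVec_smul hx, map_add, map_smul, add_apply,
      smul_apply]

theorem rotationCLM_apply {g : Metric M} (o : Orientation g) {c : M} {y : R2}
    (hy : y ∈ (extChartAt (𝓡 2) c).target) (v : R2) : rotationCLM o c y v =
      components c ⟨coordPt c y, o.J (coordPt c y) (coordVec c (coordPt c y) v)⟩ := by
  have hx := coordPt_mem_source hy
  refine linOfBasis_apply ?_ ?_ v <;> intros <;>
    simp only [coordVec_add hx, coordVec_smul hx, components_add hx, components_smul hx, map_add,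
      map_smul]

theorem coordVec_rotationCLM {g : Metric M} (o : Orientation g) {c : M} {y : R2}
    (hy : y ∈ (extChartAt (𝓡 2) c).target) (v : R2) :
    coordVec c (coordPt c y) (rotationCLM o c y v) =
      o.J (coordPt c y) (coordVec c (coordPt c y) v) := by
  rw [rotationCLM_apply o hy, coordVec_components (coordPt_mem_source hy)]

theorem contDiffOn_metricCoord (g : Metric M) (c : M) (v w : R2) :
    ContDiffOn ℝ ∞ (fun y => metricCoord g c y v w) (extChartAt (𝓡 2) c).target := by
  have hpt : ContMDiffOn 𝓘(ℝ, R2) (𝓡 2) ∞ (coordPt c) (extChartAt (𝓡 2) c).target :=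
    contMDiffOn_extChartAt_symm c
  have hg := g.contMDiff.comp_contMDiffOn hpt
  have h := ContMDiffOn.clm_bundle_apply₂ (F₁ := R2) (F₂ := R2) (F₃ := ℝ)
    (E₃ := Bundle.Trivial M ℝ) hg (contMDiffOn_tangentPt_left c v)
    (contMDiffOn_tangentPt_left c w)
  exact contMDiffOn_iff_contDiffOn.1 fun y hy => (contMDiffWithinAt_totalSpace.1 (h y hy)).2

theorem contDiffOn_metricCLM (g : Metric M) (c : M) :
    ContDiffOn ℝ ∞ (metricCLM g c) (extChartAt (𝓡 2) c).target :=
  contDiffOn_bilinOfBasis fun _ _ => contDiffOn_metricCoord g c _ _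

theorem contDiffOn_rotationCLM {g : Metric M} (o : Orientation g) (c : M) :
    ContDiffOn ℝ ∞ (rotationCLM o c) (extChartAt (𝓡 2) c).target := by
  refine contDiffOn_linOfBasis fun i => ?_
  have h1 := o.smooth.comp_contMDiffOn (contMDiffOn_tangentPt_left c (basisVec i))
  intro y hy
  have h2 := (contMDiffAt_coord (c := c)
    (σ := ⟨coordPt c y, o.J _ (coordVec c (coordPt c y) (basisVec i))⟩)
    (coordPt_mem_source hy)).comp_contMDiffWithinAt y (h1 y hy)
  exact (contMDiffWithinAt_iff_contDiffWithinAt.1 h2).snd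

theorem metricCoord_symm (g : Metric M) (c : M) (y v w : R2) :
    metricCoord g c y v w = metricCoord g c y w v := g.symm _ _ _

theorem metricCLM_pos (g : Metric M) {c : M} {y : R2} (hy : y ∈ (extChartAt (𝓡 2) c).target)
    {v : R2} (hv : v ≠ 0) : 0 < metricCLM g c y v v := by
  rw [metricCLM_apply g hy]
  refine g.pos _ _ fun h0 => hv ?_
  have hx := coordPt_mem_source hy
  rw [← components_coordVec hx v, h0, components_eq hx, map_zero]

theorem basisVec_ne_zero (i : Fin 2) : basisVec i ≠ 0 := by
  simp [basisVec]

theorem gram_det_pos (g : Metric M) {c : M} {y : R2} (hy : y ∈ (extChartAt (𝓡 2) c).target) :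
    0 < (gram g c y).det := by
  have h1 := metricCLM_pos g hy (basisVec_ne_zero 1)
  have h2 := metricCLM_pos g hy (v := metricCLM g c y (basisVec 1) (basisVec 1) • basisVec 0
    - metricCLM g c y (basisVec 0) (basisVec 1) • basisVec 1) (fun h0 => by
      have := congrArg (fun x : R2 => x 0) h0
      simp [basisVec] at this
      exact h1.ne' (by simpa [basisVec] using this))
  simp only [map_sub, map_smul, sub_apply, smul_apply, smul_eq_mul, metricCLM_apply g hy] at h1 h2
  rw [metricCoord_symm g c y (basisVec 1) (basisVec 0)] at h2
  rw [Matrix.det_fin_two]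
  simp only [gram, Matrix.of_apply]
  rw [metricCoord_symm g c y (basisVec 1) (basisVec 0)]
  refine pos_of_mul_pos_right (a := metricCoord g c y (basisVec 1) (basisVec 1)) ?_ h1.le
  linarith

theorem contDiffOn_gram (g : Metric M) (c : M) (i j : Fin 2) :
    ContDiffOn ℝ ∞ (fun y => gram g c y i j) (extChartAt (𝓡 2) c).target :=
  contDiffOn_metricCoord g c _ _

theorem contDiffOn_gram_inv (g : Metric M) (c : M) (i j : Fin 2) :
    ContDiffOn ℝ ∞ (fun y => (gram g c y)⁻¹ i j) (extChartAt (𝓡 2) c).target := by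
  have hdet : ContDiffOn ℝ ∞ (fun y => (gram g c y).det⁻¹) (extChartAt (𝓡 2) c).target := by
    refine ContDiffOn.inv ?_ fun y hy => (gram_det_pos g hy).ne'
    simp only [Matrix.det_fin_two]
    exact ((contDiffOn_gram g c 0 0).mul (contDiffOn_gram g c 1 1)).sub
      ((contDiffOn_gram g c 0 1).mul (contDiffOn_gram g c 1 0))
  simp only [Matrix.inv_def, Ring.inverse_eq_inv', Matrix.smul_apply, smul_eq_mul]
  refine hdet.mul ?_
  simp only [Matrix.adjugate_fin_two]
  fin_cases i <;> fin_cases j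
  · exact contDiffOn_gram g c 1 1
  · exact (contDiffOn_gram g c 0 1).neg
  · exact (contDiffOn_gram g c 1 0).neg
  · exact contDiffOn_gram g c 0 0

theorem fderiv_metricCoord (g : Metric M) {c : M} {y : R2}
    (hy : y ∈ (extChartAt (𝓡 2) c).target) (u v w : R2) :
    fderiv ℝ (fun z => metricCoord g c z v w) y u = fderiv ℝ (metricCLM g c) y u v w := by
  have hU := (isOpen_extChartAt_target c).mem_nhds hy
  have hd : HasFDerivAt (metricCLM g c) (fderiv ℝ (metricCLM g c) y) y :=
    (((contDiffOn_metricCLM g c).contDiffAt hU).differentiableAt (by simp)).hasFDerivAt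
  have h1 := (hd.clm_apply (hasFDerivAt_const v y)).clm_apply (hasFDerivAt_const w y)
  have h2 : (fun z => metricCoord g c z v w) =ᶠ[𝓝 y] fun z => metricCLM g c z v w :=
    Filter.eventually_of_mem hU fun z hz => (metricCLM_apply g hz v w).symm
  rw [(h1.congr_of_eventuallyEq h2).fderiv]
  simp

theorem christoffelLower_eq (g : Metric M) {c : M} {y : R2}
    (hy : y ∈ (extChartAt (𝓡 2) c).target) (u v w : R2) :
    christoffelLower g c y u v w = (fderiv ℝ (metricCLM g c) y u v w
      + fderiv ℝ (metricCLM g c) y v u w - fderiv ℝ (metricCLM g c) y w u v) / 2 := by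
  simp only [christoffelLower, fderiv_metricCoord g hy]

theorem contDiffOn_christoffel (g : Metric M) (c : M) (u v : R2) :
    ContDiffOn ℝ ∞ (fun y => christoffel g c y u v) (extChartAt (𝓡 2) c).target := by
  have hD : ContDiffOn ℝ ∞ (fderiv ℝ (metricCLM g c)) (extChartAt (𝓡 2) c).target :=
    (contDiffOn_metricCLM g c).fderiv_of_isOpen (isOpen_extChartAt_target c) (by simp)
  have hl : ∀ l, ContDiffOn ℝ ∞ (fun y => christoffelLower g c y u v (basisVec l))
      (extChartAt (𝓡 2) c).target := by
    intro l
    have h3 : ∀ a b d : R2, ContDiffOn ℝ ∞ (fun y => fderiv ℝ (metricCLM g c) y a b d)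
        (extChartAt (𝓡 2) c).target := fun a b d =>
      ((hD.clm_apply contDiffOn_const).clm_apply contDiffOn_const).clm_apply contDiffOn_const
    exact ((((h3 _ _ _).add (h3 _ _ _)).sub (h3 _ _ _)).div_const 2).congr
      fun y hy => christoffelLower_eq g hy _ _ _
  rw [contDiffOn_euclidean]
  intro k
  simp only [christoffel, Matrix.mulVec, dotProduct]
  exact ContDiffOn.sum fun l _ => (contDiffOn_gram_inv g c k l).mul (hl l)

theorem christoffel_apply (g : Metric M) (c : M) (y u v : R2) (i : Fin 2) :
    christoffel g c y u v i = (gram g c y)⁻¹ i 0 * christoffelLower g c y u v (basisVec 0)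
      + (gram g c y)⁻¹ i 1 * christoffelLower g c y u v (basisVec 1) := by
  simp only [christoffel, Matrix.mulVec, dotProduct, Fin.sum_univ_two]

theorem christoffelCLM_apply (g : Metric M) {c : M} {y : R2}
    (hy : y ∈ (extChartAt (𝓡 2) c).target) (u v : R2) :
    christoffelCLM g c y u v = christoffel g c y u v := by
  refine bilinOfBasis_apply ?_ ?_ ?_ ?_ u v <;> intros <;> ext i <;>
    simp only [christoffel_apply, christoffelLower_eq g hy, map_add, map_smul, add_apply, smul_apply,
      smul_eq_mul, PiLp.add_apply, PiLp.smul_apply] <;>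
    ring

theorem metricCLM_christoffel (g : Metric M) {c : M} {y : R2}
    (hy : y ∈ (extChartAt (𝓡 2) c).target) (u v w : R2) :
    metricCLM g c y (christoffelCLM g c y u v) w = christoffelLower g c y u v w := by
  have hk : ∀ k, metricCLM g c y (christoffelCLM g c y u v) (basisVec k) =
      christoffelLower g c y u v (basisVec k) := by
    intro k
    set ℓ : Fin 2 → ℝ := fun l => christoffelLower g c y u v (basisVec l) with hℓ
    have h1 : gram g c y *ᵥ ((gram g c y)⁻¹ *ᵥ ℓ) = ℓ := by
      rw [Matrix.mulVec_mulVec, Matrix.mul_nonsing_inv _ (gram_det_pos g hy).ne'.isUnit,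
        Matrix.one_mulVec]
    have h2 := congrFun h1 k
    rw [christoffelCLM_apply g hy, eq_sum_basisVec (christoffel g c y u v)]
    simp only [map_add, map_smul, add_apply, smul_apply, smul_eq_mul, metricCLM_apply g hy]
    have hgram : ∀ i j, gram g c y i j = metricCoord g c y (basisVec i) (basisVec j) :=
      fun _ _ => rfl
    simp only [Matrix.mulVec, dotProduct, Fin.sum_univ_two, hgram, hℓ] at h2
    rw [metricCoord_symm g c y (basisVec 0) (basisVec k),
      metricCoord_symm g c y (basisVec 1) (basisVec k)]
    simp only [christoffel, Matrix.mulVec, dotProduct, Fin.sum_univ_two]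
    linear_combination h2
  rw [eq_sum_basisVec w]
  simp only [map_add, map_smul, hk, smul_eq_mul, christoffelLower_eq g hy, add_apply, smul_apply]
  ring

/-- In a chart, the metric, the Christoffel symbols and the rotation have the properties of the
Levi-Civita connection of an oriented surface. -/
theorem isSurfaceGeometry_coord {g : Metric M} (o : Orientation g) (c : M) :
    IsSurfaceGeometry (extChartAt (𝓡 2) c).target (metricCLM g c) (christoffelCLM g c)
      (rotationCLM o c) where
  finrank_eq := by simp
  isOpen := isOpen_extChartAt_target c
  contDiffOn_metric := contDiffOn_metricCLM g c
  contDiffOn_christoffel := contDiffOn_bilinOfBasis fun _ _ => contDiffOn_christoffel g c _ _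
  contDiffOn_rotation := contDiffOn_rotationCLM o c
  metric_symm y hy v w := by simp only [metricCLM_apply g hy, metricCoord_symm g c y v w]
  metric_pos y hy v hv := metricCLM_pos g hy hv
  christoffel_symm y hy v w := by
    rw [christoffelCLM_apply g hy, christoffelCLM_apply g hy]
    simp only [christoffel, christoffelLower]
    congr 2
    funext l
    simp only [metricCoord_symm g c _ v w]
    ring
  compat y hy u v w := by
    have hs : ∀ a b d, fderiv ℝ (metricCLM g c) y a b d = fderiv ℝ (metricCLM g c) y a d b := by
      intro a b d
      rw [← fderiv_metricCoord g hy, ← fderiv_metricCoord g hy]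
      simp only [metricCoord_symm g c _ b d]
    have h1 : metricCLM g c y v (christoffelCLM g c y u w) =
        metricCLM g c y (christoffelCLM g c y u w) v := by
      simp only [metricCLM_apply g hy]
      exact metricCoord_symm _ _ _ _ _
    rw [h1, metricCLM_christoffel g hy, metricCLM_christoffel g hy, christoffelLower_eq g hy,
      christoffelLower_eq g hy, hs u w v, hs w u v]
    ring
  rotation_sq y hy v := by
    rw [rotationCLM_apply o hy, coordVec_rotationCLM o hy, o.sq]
    have hx := coordPt_mem_source hy
    rw [components_eq hx, map_neg, ← components_eq hx, components_coordVec hx]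
  rotation_isometry y hy v w := by
    rw [metricCLM_apply g hy, metricCLM_apply g hy]
    simp only [metricCoord, coordVec_rotationCLM o hy, o.isometry]

end Geometry

/-- Polarization. -/
theorem eq_of_symm_of_diag {E F : Type*} [NormedAddCommGroup E] [NormedSpace ℝ E]
    [NormedAddCommGroup F] [NormedSpace ℝ F] {B C : E →L[ℝ] E →L[ℝ] F} {u v : E}
    (hB : B u v = B v u) (hC : C u v = C v u) (h : ∀ w, B w w = C w w) : B u v = C u v := by
  have h1 := h (u + v)
  simp only [map_add, add_apply, h u, h v, ← hB, ← hC] at h1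
  have h2 : (2 : ℝ) • B u v = (2 : ℝ) • C u v := by
    rw [two_smul, two_smul, ← sub_eq_zero]
    rw [← sub_eq_zero] at h1
    rw [← h1]
    abel
  exact smul_right_injective F (two_ne_zero (α := ℝ)) h2

section Geometry

variable {M : Type*} [TopologicalSpace M] [ChartedSpace R2 M] [IsManifold (𝓡 2) ∞ M]

/-! ### Changes of charts -/

/-- The components of a tangent vector transform by the derivative of the change of charts. -/
theorem components_coordVec_eq_fderiv {c c' x : M} (hx : x ∈ (chartAt R2 c).source)
    (hx' : x ∈ (chartAt R2 c').source) (v : R2) :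
    components c' (⟨x, coordVec c x v⟩ : TM M) =
      fderiv ℝ (fun y => extChartAt (𝓡 2) c' (coordPt c y)) (extChartAt (𝓡 2) c x) v := by
  rw [coordVec_eq_symmL hx, TangentBundle.symmL_trivializationAt_eq_core hx]
  have h := tangentCoordChange_comp (I := 𝓡 2) (w := c) (x := x) (y := c') (z := x) (v := v)
    ⟨⟨by rwa [extChartAt_source], mem_extChartAt_source x⟩, by rwa [extChartAt_source]⟩
  refine Eq.trans h ?_
  rw [tangentCoordChange_def, ModelWithCorners.Boundaryless.range_eq_univ, fderivWithin_univ]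
  rfl

theorem components_eq_fderiv {c c' : M} {σ : TM M} (hσ : σ.1 ∈ (chartAt R2 c).source)
    (hσ' : σ.1 ∈ (chartAt R2 c').source) : components c' σ =
      fderiv ℝ (fun y => extChartAt (𝓡 2) c' (coordPt c y)) (extChartAt (𝓡 2) c σ.1)
        (components c σ) := by
  rw [← components_coordVec_eq_fderiv hσ hσ', coordVec_components hσ]

theorem contDiffAt_transition {c c' x : M} (hx : x ∈ (chartAt R2 c).source)
    (hx' : x ∈ (chartAt R2 c').source) :
    ContDiffAt ℝ ∞ (fun y => extChartAt (𝓡 2) c' (coordPt c y)) (extChartAt (𝓡 2) c x) := by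
  have h1 : ContMDiffAt 𝓘(ℝ, R2) (𝓡 2) ∞ (coordPt c) (extChartAt (𝓡 2) c x) :=
    (contMDiffOn_extChartAt_symm c).contMDiffAt
      ((isOpen_extChartAt_target c).mem_nhds (extChartAt_mem_target hx))
  have h2 : ContMDiffAt (𝓡 2) 𝓘(ℝ, R2) ∞ (extChartAt (𝓡 2) c') (coordPt c (extChartAt (𝓡 2) c x)) :=
    contMDiffAt_extChartAt' (by rwa [coordPt_extChartAt hx])
  exact contMDiffAt_iff_contDiffAt.1 (h2.comp _ h1)

theorem metricCLM_components (g : Metric M) {c x : M} (hx : x ∈ (chartAt R2 c).source)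
    (v w : TangentSpace (𝓡 2) x) :
    metricCLM g c (extChartAt (𝓡 2) c x) (components c ⟨x, v⟩) (components c ⟨x, w⟩) =
      g.inner x v w := by
  rw [metricCLM_apply g (extChartAt_mem_target hx), metricCoord, coordPt_extChartAt hx,
    coordVec_components hx, coordVec_components hx]

theorem metricCLM_self (g : Metric M) (x : M) (v w : TangentSpace (𝓡 2) x) :
    metricCLM g x (extChartAt (𝓡 2) x x) v w = g.inner x v w :=
  (congrArg₂ (fun a b => metricCLM g x (extChartAt (𝓡 2) x x) a b) (components_self x v).symm
    (components_self x w).symm).trans (metricCLM_components g (mem_chart_source R2 x) v w)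

theorem rotationCLM_components {g : Metric M} (o : Orientation g) {c x : M}
    (hx : x ∈ (chartAt R2 c).source) (v : TangentSpace (𝓡 2) x) :
    rotationCLM o c (extChartAt (𝓡 2) c x) (components c ⟨x, v⟩) =
      components c ⟨x, o.J x v⟩ := by
  rw [rotationCLM_apply o (extChartAt_mem_target hx), coordPt_extChartAt hx,
    coordVec_components hx]

theorem metricCLM_fderiv (g : Metric M) {c c' x : M} (hx : x ∈ (chartAt R2 c).source)
    (hx' : x ∈ (chartAt R2 c').source) (v w : R2) :
    metricCLM g c' (extChartAt (𝓡 2) c' x)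
      (fderiv ℝ (fun y => extChartAt (𝓡 2) c' (coordPt c y)) (extChartAt (𝓡 2) c x) v)
      (fderiv ℝ (fun y => extChartAt (𝓡 2) c' (coordPt c y)) (extChartAt (𝓡 2) c x) w) =
    metricCLM g c (extChartAt (𝓡 2) c x) v w := by
  rw [← components_coordVec_eq_fderiv hx hx', ← components_coordVec_eq_fderiv hx hx',
    metricCLM_components g hx', ← metricCLM_components g hx, components_coordVec hx,
    components_coordVec hx]

/-- Change of charts for the derivative of a curve in `TM`: the second derivative of the transition
map enters the derivative of the components. -/
theorem hasDerivAt_transition {c c' : M} {γ : ℝ → TM M} {s : ℝ} (hγ : ContinuousAt γ s)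
    (hs : (γ s).1 ∈ (chartAt R2 c).source) (hs' : (γ s).1 ∈ (chartAt R2 c').source) {η ζ : R2}
    (h1 : HasDerivAt (fun r => extChartAt (𝓡 2) c (γ r).1) η s)
    (h2 : HasDerivAt (fun r => components c (γ r)) ζ s) :
    HasDerivAt (fun r => extChartAt (𝓡 2) c' (γ r).1)
      (fderiv ℝ (fun y => extChartAt (𝓡 2) c' (coordPt c y)) (extChartAt (𝓡 2) c (γ s).1) η) s ∧
    HasDerivAt (fun r => components c' (γ r))
      (fderiv ℝ (fderiv ℝ (fun y => extChartAt (𝓡 2) c' (coordPt c y)))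
          (extChartAt (𝓡 2) c (γ s).1) η (components c (γ s)) +
        fderiv ℝ (fun y => extChartAt (𝓡 2) c' (coordPt c y)) (extChartAt (𝓡 2) c (γ s).1) ζ)
      s := by
  set τ : R2 → R2 := fun y => extChartAt (𝓡 2) c' (coordPt c y) with hτ
  have hcont : ContinuousAt (fun r => (γ r).1) s :=
    (FiberBundle.continuous_proj R2 (fun x : M => TangentSpace (𝓡 2) x)).continuousAt.comp hγ
  have hev : ∀ᶠ r in 𝓝 s, (γ r).1 ∈ (chartAt R2 c).source :=
    hcont.eventually ((chartAt R2 c).open_source.mem_nhds hs)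
  have hev' : ∀ᶠ r in 𝓝 s, (γ r).1 ∈ (chartAt R2 c').source :=
    hcont.eventually ((chartAt R2 c').open_source.mem_nhds hs')
  have hτd := contDiffAt_transition hs hs'
  have hτ1 : HasFDerivAt τ (fderiv ℝ τ (extChartAt (𝓡 2) c (γ s).1)) (extChartAt (𝓡 2) c (γ s).1) :=
    (hτd.differentiableAt (by simp)).hasFDerivAt
  have hτ2 : HasFDerivAt (fderiv ℝ τ) (fderiv ℝ (fderiv ℝ τ) (extChartAt (𝓡 2) c (γ s).1))
      (extChartAt (𝓡 2) c (γ s).1) :=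
    ((hτd.fderiv_right (m := 1) (by norm_cast)).differentiableAt (by simp)).hasFDerivAt
  constructor
  · refine (hτ1.comp_hasDerivAt s h1).congr_of_eventuallyEq ?_
    filter_upwards [hev] with r hr
    simp only [Function.comp, hτ, coordPt_extChartAt hr]
  · refine ((HasFDerivAt.comp_hasDerivAt (f := fun r => extChartAt (𝓡 2) c (γ r).1)
      s hτ2 h1).clm_apply h2).congr_of_eventuallyEq ?_
    filter_upwards [hev, hev'] with r hr hr'
    exact components_eq_fderiv hr hr'

/-! ### Thermostat flows in charts -/

variable {g : Metric M} {o : Orientation g} {lam : TM M → ℝ} {φ : ℝ → TM M → TM M}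

theorem IsThermostatFlow.continuousAt (hφ : IsThermostatFlow o lam φ) {v : TM M}
    (hv : v ∈ unitTangent g) (t : ℝ) : ContinuousAt (fun s => φ s v) t :=
  ContinuousAt.comp (f := fun s : ℝ => (s, v)) (hφ.smooth t v hv).continuousAt
    (continuous_id.prodMk continuous_const).continuousAt

/-- The transformation law of the Christoffel symbols. It follows from the fact that the orbits of
the thermostat flow satisfy the same second order equation in all charts. -/
theorem IsThermostatFlow.christoffel_transition (hφ : IsThermostatFlow o lam φ) {c c' x : M}
    (hx : x ∈ (chartAt R2 c).source) (hx' : x ∈ (chartAt R2 c').source) (u v : R2) :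
    fderiv ℝ (fderiv ℝ (fun y => extChartAt (𝓡 2) c' (coordPt c y))) (extChartAt (𝓡 2) c x) u v =
      fderiv ℝ (fun y => extChartAt (𝓡 2) c' (coordPt c y)) (extChartAt (𝓡 2) c x)
        (christoffelCLM g c (extChartAt (𝓡 2) c x) u v)
      - christoffelCLM g c' (extChartAt (𝓡 2) c' x)
        (fderiv ℝ (fun y => extChartAt (𝓡 2) c' (coordPt c y)) (extChartAt (𝓡 2) c x) u)
        (fderiv ℝ (fun y => extChartAt (𝓡 2) c' (coordPt c y)) (extChartAt (𝓡 2) c x) v) := by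
  have hτd := contDiffAt_transition hx hx'
  set τ : R2 → R2 := fun y => extChartAt (𝓡 2) c' (coordPt c y) with hτ
  set y := extChartAt (𝓡 2) c x with hy
  have hyU : y ∈ (extChartAt (𝓡 2) c).target := extChartAt_mem_target hx
  have hyU' : extChartAt (𝓡 2) c' x ∈ (extChartAt (𝓡 2) c').target := extChartAt_mem_target hx'
  -- unit vectors: compare the equations of the orbit in the two charts
  have hunit : ∀ w : R2, metricCLM g c y w w = 1 →
      fderiv ℝ (fderiv ℝ τ) y w w = fderiv ℝ τ y (christoffelCLM g c y w w)
        - christoffelCLM g c' (extChartAt (𝓡 2) c' x) (fderiv ℝ τ y w) (fderiv ℝ τ y w) := by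
    intro w hw
    set σ : TM M := ⟨x, coordVec c x w⟩ with hσ
    have hσu : σ ∈ unitTangent g := by
      change g.inner x (coordVec c x w) (coordVec c x w) = 1
      rw [← metricCLM_components g hx, components_coordVec hx]
      exact hw
    have h0 : φ 0 σ = σ := hφ.map_zero σ hσu
    have hm : (φ 0 σ).1 ∈ (chartAt R2 c).source := by rw [h0]; exact hx
    have hm' : (φ 0 σ).1 ∈ (chartAt R2 c').source := by rw [h0]; exact hx'
    have hc := hφ.isThermostatCurve σ hσu c 0 hm
    have hc' := hφ.isThermostatCurve σ hσu c' 0 hm'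
    have heq := (hasDerivAt_transition (hφ.continuousAt hσu 0) hm hm' hc.1 hc.2).2.unique hc'.2
    beta_reduce at heq
    rw [h0] at heq
    have hxσ : σ.1 = x := rfl
    have hwc : components c σ = w := components_coordVec hx w
    have hJ : components c' (⟨σ.1, o.J σ.1 σ.2⟩ : TM M) =
        fderiv ℝ τ y (components c ⟨σ.1, o.J σ.1 σ.2⟩) := components_eq_fderiv hx hx'
    have hw' : components c' σ = fderiv ℝ τ y w := components_coordVec_eq_fderiv hx hx' w
    rw [hJ, hw', hwc, hxσ, ← christoffelCLM_apply g hyU, ← christoffelCLM_apply g hyU',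
      map_sub, map_smul] at heq
    rw [← sub_eq_zero] at heq ⊢
    rw [← heq]
    abel
  -- all vectors, by homogeneity
  have hquad : ∀ w : R2, fderiv ℝ (fderiv ℝ τ) y w w = fderiv ℝ τ y (christoffelCLM g c y w w)
        - christoffelCLM g c' (extChartAt (𝓡 2) c' x) (fderiv ℝ τ y w) (fderiv ℝ τ y w) := by
    intro w
    by_cases hw : w = 0
    · simp [hw]
    have hp := metricCLM_pos g hyU hw
    set s := Real.sqrt (metricCLM g c y w w)
    have hs : 0 < s := Real.sqrt_pos.2 hp
    have hs2 : s * s = metricCLM g c y w w := Real.mul_self_sqrt hp.le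
    have h1 := hunit (s⁻¹ • w) (by
      simp only [map_smul, smul_apply, smul_eq_mul, ← hs2]
      field_simp)
    have h2 := congrArg (fun z => (s * s) • z) h1
    simp only [map_smul, smul_apply, smul_sub, smul_smul] at h2
    have h3 : s * s * (s⁻¹ * s⁻¹) = 1 := by field_simp
    simpa only [h3, one_smul] using h2
  have hs1 : fderiv ℝ (fderiv ℝ τ) y u v = fderiv ℝ (fderiv ℝ τ) y v u :=
    hτd.isSymmSndFDerivAt (by
      simp only [minSmoothness_of_isRCLikeNormedField]; exact ENat.LEInfty.out) u v
  have hs2 := (isSurfaceGeometry_coord o c).christoffel_symm y hyU v u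
  have hs3 := (isSurfaceGeometry_coord o c').christoffel_symm _ hyU' (fderiv ℝ τ y v)
    (fderiv ℝ τ y u)
  exact eq_of_symm_of_diag (B := fderiv ℝ (fderiv ℝ τ) y)
    (C := (ContinuousLinearMap.compL ℝ R2 R2 R2 (fderiv ℝ τ y)).comp (christoffelCLM g c y)
      - (christoffelCLM g c' (extChartAt (𝓡 2) c' x)).bilinearComp (fderiv ℝ τ y) (fderiv ℝ τ y))
    hs1 (congrArg₂ (fun a b => fderiv ℝ τ y a - b) hs2.symm hs3.symm) hquad

/-- The quotient coordinates of the velocity of a curve in `TM`, in an arbitrary chart. -/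
theorem IsThermostatFlow.quotientCoord_eq (hφ : IsThermostatFlow o lam φ) {c : M} {γ : ℝ → TM M}
    {s : ℝ} (hγ : ContinuousAt γ s) (hs : (γ s).1 ∈ (chartAt R2 c).source) {η ζ : R2}
    (h1 : HasDerivAt (fun r => extChartAt (𝓡 2) c (γ r).1) η s)
    (h2 : HasDerivAt (fun r => components c (γ r)) ζ s) {ξ : R2 × R2}
    (hξ : HasDerivAt (fun r => extChartAt (𝓡 2).tangent (γ s) (γ r)) ξ s) :
    quotientCoord o lam (γ s) ξ =
      ![metricCLM g c (extChartAt (𝓡 2) c (γ s).1) η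
          (rotationCLM o c (extChartAt (𝓡 2) c (γ s).1) (components c (γ s))),
        metricCLM g c (extChartAt (𝓡 2) c (γ s).1)
          (ζ + christoffelCLM g c (extChartAt (𝓡 2) c (γ s).1) η (components c (γ s)))
          (rotationCLM o c (extChartAt (𝓡 2) c (γ s).1) (components c (γ s)))
        - lam (γ s) * metricCLM g c (extChartAt (𝓡 2) c (γ s).1) η (components c (γ s))] := by
  set σ := γ s with hσ
  have hs' : σ.1 ∈ (chartAt R2 σ.1).source := mem_chart_source R2 σ.1
  -- compare with the chart at the base point of `σ`, in which `quotientCoord` is defined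
  obtain ⟨d1, d2⟩ := hasDerivAt_transition hγ hs hs' h1 h2
  have hξ1 : HasDerivAt (fun r => (extChartAt (𝓡 2) σ.1 (γ r).1, components σ.1 (γ r))) ξ s := hξ
  have f1 : HasDerivAt (fun r => extChartAt (𝓡 2) σ.1 (γ r).1) ξ.1 s :=
    (ContinuousLinearMap.fst ℝ R2 R2).hasFDerivAt.comp_hasDerivAt s hξ1
  have f2 : HasDerivAt (fun r => components σ.1 (γ r)) ξ.2 s :=
    (ContinuousLinearMap.snd ℝ R2 R2).hasFDerivAt.comp_hasDerivAt s hξ1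
  have e1 := f1.unique d1
  have e2 := f2.unique d2
  rw [← hσ] at e1 e2
  have hJσ : (o.J σ.1 σ.2 : R2) = fderiv ℝ (fun y => extChartAt (𝓡 2) σ.1 (coordPt c y))
      (extChartAt (𝓡 2) c σ.1) (rotationCLM o c (extChartAt (𝓡 2) c σ.1) (components c σ)) := by
    have h3 := components_eq_fderiv (σ := ⟨σ.1, o.J σ.1 σ.2⟩) hs hs'
    rw [components_self, ← rotationCLM_components o hs] at h3
    exact h3
  have hσ2 : (σ.2 : R2) = fderiv ℝ (fun y => extChartAt (𝓡 2) σ.1 (coordPt c y))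
      (extChartAt (𝓡 2) c σ.1) (components c σ) := by
    have h3 := components_eq_fderiv (σ := σ) hs hs'
    have h4 : components σ.1 σ = σ.2 := components_self σ.1 σ.2
    rw [h4] at h3
    exact h3
  have hchr := hφ.christoffel_transition hs hs' η (components c σ)
  have q1 : omega2 o σ ξ = metricCLM g c (extChartAt (𝓡 2) c σ.1) η
          (rotationCLM o c (extChartAt (𝓡 2) c σ.1) (components c σ)) := by
    refine (metricCLM_self g σ.1 ξ.1 (o.J σ.1 σ.2)).symm.trans ?_
    exact (congrArg₂ (fun a b => metricCLM g σ.1 (extChartAt (𝓡 2) σ.1 σ.1) a b) e1 hJσ).trans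
      (metricCLM_fderiv g hs hs' _ _)
  have q2 : omega1 g σ ξ = metricCLM g c (extChartAt (𝓡 2) c σ.1) η (components c σ) := by
    refine (metricCLM_self g σ.1 ξ.1 σ.2).symm.trans ?_
    exact (congrArg₂ (fun a b => metricCLM g σ.1 (extChartAt (𝓡 2) σ.1 σ.1) a b) e1 hσ2).trans
      (metricCLM_fderiv g hs hs' _ _)
  have q3 : connectionForm o σ ξ = metricCLM g c (extChartAt (𝓡 2) c σ.1)
          (ζ + christoffelCLM g c (extChartAt (𝓡 2) c σ.1) η (components c σ))
          (rotationCLM o c (extChartAt (𝓡 2) c σ.1) (components c σ)) := by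
    have h3 : ξ.2 + christoffel g σ.1 (center σ.1) ξ.1 σ.2 =
        fderiv ℝ (fun y => extChartAt (𝓡 2) σ.1 (coordPt c y)) (extChartAt (𝓡 2) c σ.1)
          (ζ + christoffelCLM g c (extChartAt (𝓡 2) c σ.1) η (components c σ)) := by
      refine (congrArg (fun a => ξ.2 + a)
        (christoffelCLM_apply g (extChartAt_mem_target hs') ξ.1 σ.2).symm).trans ?_
      refine (congrArg₂ (fun a b => a + christoffelCLM g σ.1 (extChartAt (𝓡 2) σ.1 σ.1) ξ.1 b)
        e2 hσ2).trans ?_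
      rw [e1, hchr, _root_.map_add]
      abel
    refine (metricCLM_self g σ.1 (ξ.2 + christoffel g σ.1 (center σ.1) ξ.1 σ.2)
      (o.J σ.1 σ.2)).symm.trans ?_
    exact (congrArg₂ (fun a b => metricCLM g σ.1 (extChartAt (𝓡 2) σ.1 σ.1) a b) h3 hJσ).trans
      (metricCLM_fderiv g hs hs' _ _)
  unfold Thermostat.quotientCoord
  rw [q1, q2, q3]

end Geometry

section Geometry

variable {M : Type*} [TopologicalSpace M] [ChartedSpace R2 M] [IsManifold (𝓡 2) ∞ M]
  {g : Metric M} {o : Orientation g} {lam : TM M → ℝ} {φ : ℝ → TM M → TM M}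

/-! ### Curves in the unit tangent bundle -/

theorem metricCLM_components_self (g : Metric M) {c : M} {σ : TM M}
    (hσ : σ.1 ∈ (chartAt R2 c).source) :
    metricCLM g c (extChartAt (𝓡 2) c σ.1) (components c σ) (components c σ) =
      g.inner σ.1 σ.2 σ.2 :=
  metricCLM_components g hσ σ.2 σ.2

theorem tangentPt_mem_unitTangent (g : Metric M) {c : M} {y w : R2}
    (hy : y ∈ (extChartAt (𝓡 2) c).target) :
    tangentPt c y w ∈ unitTangent g ↔ metricCLM g c y w w = 1 := by
  rw [metricCLM_apply g hy]
  rfl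

/-- A vector at `v` that is tangent to the unit tangent bundle is the velocity of a smooth curve in
the unit tangent bundle. -/
theorem exists_curve_unitTangent (o : Orientation g) {v : TM M} (hv : v ∈ unitTangent g) {a b : R2}
    (hab : metricCLM g v.1 (extChartAt (𝓡 2) v.1 v.1)
      (b + christoffelCLM g v.1 (extChartAt (𝓡 2) v.1 v.1) a (components v.1 v))
      (components v.1 v) = 0) :
    ∃ β : ℝ → TM M, β 0 = v ∧ ContMDiffAt 𝓘(ℝ, ℝ) (𝓡 2).tangent ∞ β 0 ∧
      (∀ᶠ r in 𝓝 (0 : ℝ), β r ∈ unitTangent g) ∧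
      HasDerivAt (fun r => extChartAt (𝓡 2).tangent v (β r)) (a, b) 0 := by
  set c := v.1 with hc
  set y₀ := extChartAt (𝓡 2) c c with hy₀
  set w₀ := components c v with hw₀
  have hcs : c ∈ (chartAt R2 c).source := mem_chart_source R2 c
  have hU := extChartAt_mem_target hcs
  have hgeo := isSurfaceGeometry_coord o c
  have hG0 : metricCLM g c y₀ w₀ w₀ = 1 := (metricCLM_components_self g hcs).trans hv
  have hyz : y₀ + (0 : ℝ) • a = y₀ := by rw [zero_smul, add_zero]
  have hwz : w₀ + (0 : ℝ) • b = w₀ := by rw [zero_smul, add_zero]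
  have hy : HasDerivAt (fun r : ℝ => y₀ + r • a) a 0 := by
    simpa using ((hasDerivAt_id (0 : ℝ)).smul_const a).const_add y₀
  have hw : HasDerivAt (fun r : ℝ => w₀ + r • b) b 0 := by
    simpa using ((hasDerivAt_id (0 : ℝ)).smul_const b).const_add w₀
  have hyc : ContDiff ℝ ∞ (fun r : ℝ => y₀ + r • a) :=
    contDiff_const.add (contDiff_id.smul contDiff_const)
  have hwc : ContDiff ℝ ∞ (fun r : ℝ => w₀ + r • b) :=
    contDiff_const.add (contDiff_id.smul contDiff_const)
  have hyev : ∀ᶠ r in 𝓝 (0 : ℝ), y₀ + r • a ∈ (extChartAt (𝓡 2) c).target :=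
    hyc.continuous.continuousAt.eventually
      ((isOpen_extChartAt_target c).mem_nhds (by beta_reduce; rw [hyz]; exact hU))
  -- follow the straight line with velocity `(a, b)` in the chart, and normalize the vectors: the
  -- squared length `N` has derivative `0` at `0`, so that the velocity does not change
  set N : ℝ → ℝ := fun r => metricCLM g c (y₀ + r • a) (w₀ + r • b) (w₀ + r • b) with hN
  have hN0 : N 0 = 1 := by simp [hN, hG0]
  have hNc : ContDiffAt ℝ ∞ N 0 := by
    have h1 : ContDiffAt ℝ ∞ (fun r : ℝ => metricCLM g c (y₀ + r • a)) 0 := by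
      refine ContDiffAt.comp (0 : ℝ) (g := metricCLM g c) (f := fun r : ℝ => y₀ + r • a) ?_
        hyc.contDiffAt
      rw [hyz]
      exact (contDiffOn_metricCLM g c).contDiffAt ((isOpen_extChartAt_target c).mem_nhds hU)
    exact (h1.clm_apply hwc.contDiffAt).clm_apply hwc.contDiffAt
  have hN1 : HasDerivAt N 0 0 := by
    have h1 := hgeo.hasDerivAt_metric hy hw hw (by rw [hyz]; exact hU)
    refine h1.congr_deriv ?_
    rw [hyz, hwz]
    rw [hgeo.metric_symm _ hU w₀, hab, add_zero]
  have hNpos : ∀ᶠ r in 𝓝 (0 : ℝ), 0 < N r :=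
    hNc.continuousAt.eventually (lt_mem_nhds (by rw [hN0]; exact one_pos))
  set n : ℝ → ℝ := fun r => (Real.sqrt (N r))⁻¹ with hn
  have hn0 : n 0 = 1 := by simp [hn, hN0]
  have hnc : ContDiffAt ℝ ∞ n 0 :=
    (hNc.sqrt (by rw [hN0]; exact one_ne_zero)).inv (by rw [hN0]; simp)
  have hn1 : HasDerivAt n 0 0 := by
    have h1 := (hN1.sqrt (by rw [hN0]; exact one_ne_zero)).fun_inv (by rw [hN0]; simp)
    refine h1.congr_deriv ?_
    simp
  have hnw : HasDerivAt (fun r => n r • (w₀ + r • b)) b 0 := by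
    refine (hn1.fun_smul hw).congr_deriv ?_
    rw [hn0, one_smul, zero_smul, add_zero]
  refine ⟨fun r => tangentPt c (y₀ + r • a) (n r • (w₀ + r • b)), ?_, ?_, ?_, ?_⟩
  · simp only [zero_smul, add_zero, hn0, one_smul]
    exact tangentPt_extChartAt_components hcs
  · have h1 := (contMDiffOn_tangentPt c).contMDiffAt (x := (y₀, w₀))
      (((isOpen_extChartAt_target c).prod isOpen_univ).mem_nhds ⟨hU, trivial⟩)
    have h2 : ContMDiffAt 𝓘(ℝ, ℝ) 𝓘(ℝ, R2 × R2) ∞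
        (fun r : ℝ => (y₀ + r • a, n r • (w₀ + r • b))) 0 :=
      (hyc.contDiffAt.prodMk (hnc.smul hwc.contDiffAt)).contMDiffAt
    refine ContMDiffAt.comp (0 : ℝ) (g := fun p : R2 × R2 => tangentPt c p.1 p.2) ?_ h2
    simpa [hn0] using h1
  · filter_upwards [hyev, hNpos] with r hr hp
    rw [tangentPt_mem_unitTangent g hr]
    simp only [map_smul, smul_apply, smul_eq_mul]
    have h3 : Real.sqrt (N r) * Real.sqrt (N r) = N r := Real.mul_self_sqrt hp.le
    have h4 : Real.sqrt (N r) ≠ 0 := (Real.sqrt_pos.2 hp).ne'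
    change n r * (n r * N r) = 1
    rw [← h3, hn]
    field_simp
  · refine (hy.prodMk hnw).congr_of_eventuallyEq ?_
    filter_upwards [hyev] with r hr
    rw [extChartAt_tangent_apply]
    exact Prod.ext (extChartAt_coordPt hr) (components_tangentPt hr _)

/-- The differential of a map of `TM`, in charts, is given by its effect on curves. -/
theorem hasDerivAt_extChartAt_comp {f : TM M → TM M} {v : TM M}
    (hf : MDifferentiableAt (𝓡 2).tangent (𝓡 2).tangent f v) {β : ℝ → TM M} (hβ0 : β 0 = v)
    (hβ : ContinuousAt β 0) {ξ : R2 × R2}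
    (h : HasDerivAt (fun r => extChartAt (𝓡 2).tangent v (β r)) ξ 0) :
    HasDerivAt (fun r => extChartAt (𝓡 2).tangent (f v) (f (β r)))
      (mfderiv (𝓡 2).tangent (𝓡 2).tangent f v ξ : R2 × R2) 0 := by
  subst hβ0
  have h1 : HasFDerivAt (𝕜 := ℝ) (E := R2 × R2) (F := R2 × R2)
      (writtenInExtChartAt (𝓡 2).tangent (𝓡 2).tangent (β 0) f)
      (mfderiv (𝓡 2).tangent (𝓡 2).tangent f (β 0)) (extChartAt (𝓡 2).tangent (β 0) (β 0)) := by
    have h0 := hf.hasMFDerivAt.2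
    rw [ModelWithCorners.Boundaryless.range_eq_univ] at h0
    exact hasFDerivWithinAt_univ.1 h0
  have h2 := HasFDerivAt.comp_hasDerivAt (f := fun r => extChartAt (𝓡 2).tangent (β 0) (β r)) 0 h1 h
  refine h2.congr_of_eventuallyEq ?_
  have hs : ∀ᶠ r in 𝓝 (0 : ℝ), β r ∈ (extChartAt (𝓡 2).tangent (β 0)).source :=
    hβ.eventually ((isOpen_extChartAt_source (β 0)).mem_nhds (mem_extChartAt_source (β 0)))
  filter_upwards [hs] with r hr
  simp only [Function.comp, writtenInExtChartAt, (extChartAt (𝓡 2).tangent (β 0)).left_inv hr]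

end Geometry

section Geometry

variable {M : Type*} [TopologicalSpace M] [ChartedSpace R2 M] [IsManifold (𝓡 2) ∞ M]
  {g : Metric M} {o : Orientation g} {lam : TM M → ℝ} {φ : ℝ → TM M → TM M}
  {W : Type*} [NormedAddCommGroup W] [NormedSpace ℝ W]

/-! ### The Jacobi equation of a thermostat flow -/

/-- The Gauss curvature in terms of the Christoffel symbols as a bilinear map. -/
theorem gaussCurvature_eq (g : Metric M) (x : M) :
    gaussCurvature g x =
      metricCLM g x (center x) (localCurvature (christoffelCLM g x) (center x) (basisVec 0)
          (basisVec 1) (basisVec 1)) (basisVec 0)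
        / (metricCLM g x (center x) (basisVec 0) (basisVec 0)
            * metricCLM g x (center x) (basisVec 1) (basisVec 1)
          - metricCLM g x (center x) (basisVec 0) (basisVec 1)
            * metricCLM g x (center x) (basisVec 1) (basisVec 0)) := by
  have hU : center x ∈ (extChartAt (𝓡 2) x).target :=
    extChartAt_mem_target (mem_chart_source R2 x)
  have hn := (isOpen_extChartAt_target (I := 𝓡 2) x).mem_nhds hU
  have hd : HasFDerivAt (christoffelCLM g x) (fderiv ℝ (christoffelCLM g x) (center x))
      (center x) := by
    have h1 : ContDiffOn ℝ ∞ (christoffelCLM g x) (extChartAt (𝓡 2) x).target :=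
      contDiffOn_bilinOfBasis fun _ _ => contDiffOn_christoffel g x _ _
    exact ((h1.contDiffAt hn).differentiableAt (by simp)).hasFDerivAt
  have hf : ∀ u v w : R2, fderiv ℝ (fun z => christoffel g x z v w) (center x) u =
      fderiv ℝ (christoffelCLM g x) (center x) u v w := by
    intro u v w
    have h1 := (hd.clm_apply (hasFDerivAt_const v _)).clm_apply (hasFDerivAt_const w _)
    have h2 : (fun z => christoffel g x z v w) =ᶠ[𝓝 (center x)] fun z => christoffelCLM g x z v w :=
      Filter.eventually_of_mem hn fun z hz => (christoffelCLM_apply g hz v w).symm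
    rw [(h1.congr_of_eventuallyEq h2).fderiv]
    simp
  have hR : ∀ u v w : R2, riemann g x (center x) u v w =
      localCurvature (christoffelCLM g x) (center x) u v w := by
    intro u v w
    simp only [riemann, localCurvature, hf, christoffelCLM_apply g hU]
  rw [gaussCurvature, hR, Matrix.det_fin_two]
  simp only [metricCLM_apply g hU]
  rfl

/-- The differential of `F` at the unit vector `σ`, restricted to the unit tangent bundle, is
`FX ω₁ + FH ω₂ + FV ψ`: the derivatives of `F` along the frame `X, H, V` are `FX`, `FH` and `FV`. It
is expressed through curves whose velocity is tangent to the unit tangent bundle. -/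
def HasFrameDeriv (o : Orientation g) (F : TM M → W) (σ : TM M) (FX FH FV : W) : Prop :=
  ∀ (γ : ℝ → TM M) (s : ℝ) (η ζ : R2), γ s = σ → ContinuousAt γ s →
    HasDerivAt (fun r => extChartAt (𝓡 2) σ.1 (γ r).1) η s →
    HasDerivAt (fun r => components σ.1 (γ r)) ζ s →
    metricCLM g σ.1 (center σ.1) (ζ + christoffelCLM g σ.1 (center σ.1) η (components σ.1 σ))
      (components σ.1 σ) = 0 →
    HasDerivAt (fun r => F (γ r))
      (metricCLM g σ.1 (center σ.1) η (components σ.1 σ) • FX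
        + metricCLM g σ.1 (center σ.1) η
          (rotationCLM o σ.1 (center σ.1) (components σ.1 σ)) • FH
        + metricCLM g σ.1 (center σ.1)
          (ζ + christoffelCLM g σ.1 (center σ.1) η (components σ.1 σ))
          (rotationCLM o σ.1 (center σ.1) (components σ.1 σ)) • FV) s

/-- The derivative along the flow is the derivative along `F = X + λ V`. -/
theorem HasFrameDeriv.hasDerivAt_flow (hφ : IsThermostatFlow o lam φ) {v : TM M}
    (hv : v ∈ unitTangent g) {t : ℝ} {F : TM M → W} {FX FH FV : W}
    (hF : HasFrameDeriv o F (φ t v) FX FH FV) :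
    HasDerivAt (fun s => F (φ s v)) (FX + lam (φ t v) • FV) t := by
  have hs : (φ t v).1 ∈ (chartAt R2 (φ t v).1).source := mem_chart_source R2 _
  have hU : center (φ t v).1 ∈ (extChartAt (𝓡 2) (φ t v).1).target := extChartAt_mem_target hs
  have hgeo := isSurfaceGeometry_coord o (φ t v).1
  obtain ⟨h1, h2⟩ := hφ.isThermostatCurve v hv (φ t v).1 t hs
  have hG : metricCLM g (φ t v).1 (center (φ t v).1) (components (φ t v).1 (φ t v))
      (components (φ t v).1 (φ t v)) = 1 :=
    (metricCLM_components_self g hs).trans (hφ.mapsTo t hv)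
  have hJ : rotationCLM o (φ t v).1 (center (φ t v).1) (components (φ t v).1 (φ t v)) =
      components (φ t v).1 ⟨(φ t v).1, o.J (φ t v).1 (φ t v).2⟩ := rotationCLM_components o hs _
  have hcov : lam (φ t v) • components (φ t v).1 ⟨(φ t v).1, o.J (φ t v).1 (φ t v).2⟩
      - christoffel g (φ t v).1 (extChartAt (𝓡 2) (φ t v).1 (φ t v).1)
        (components (φ t v).1 (φ t v)) (components (φ t v).1 (φ t v))
      + christoffelCLM g (φ t v).1 (center (φ t v).1) (components (φ t v).1 (φ t v))
        (components (φ t v).1 (φ t v)) =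
      lam (φ t v) •
        rotationCLM o (φ t v).1 (center (φ t v).1) (components (φ t v).1 (φ t v)) := by
    rw [hJ, christoffelCLM_apply g hU]
    exact sub_add_cancel _ _
  have h3 := hF (fun s => φ s v) t _ _ rfl (hφ.continuousAt hv t) h1 h2 (by
    rw [hcov, map_smul, smul_apply, hgeo.metric_symm _ hU, hgeo.metric_self_rotation hU, smul_zero])
  refine h3.congr_deriv ?_
  rw [hcov, map_smul, smul_apply, hgeo.rotation_isometry _ hU, hG, hgeo.metric_self_rotation hU]
  simp

/-- The Jacobi equation: if `ξ` is tangent to the unit tangent bundle at `v`, then the quotient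
coordinates `(Y, U)` of `dφ_t(ξ)` satisfy `Y' = U` and `U' = -(K - Hλ + λ²) Y + (Vλ) U`. -/
theorem IsThermostatFlow.hasDerivAt_quotientCoord (hφ : IsThermostatFlow o lam φ) {v : TM M}
    (hv : v ∈ unitTangent g) {ξ : R2 × R2}
    (hξ : metricCLM g v.1 (center v.1)
      (ξ.2 + christoffelCLM g v.1 (center v.1) ξ.1 (components v.1 v)) (components v.1 v) = 0)
    {t₀ lX lH lV : ℝ} (hlam : HasFrameDeriv o lam (φ t₀ v) lX lH lV) {Y U : ℝ → ℝ}
    (hY : Y = fun t => quotientCoord o lam (φ t v)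
      (mfderiv (𝓡 2).tangent (𝓡 2).tangent (φ t) v ξ) 0)
    (hU : U = fun t => quotientCoord o lam (φ t v)
      (mfderiv (𝓡 2).tangent (𝓡 2).tangent (φ t) v ξ) 1) :
    HasDerivAt Y (U t₀) t₀ ∧
    HasDerivAt U (-(gaussCurvature g (φ t₀ v).1 - lH + lam (φ t₀ v) ^ 2) * Y t₀ + lV * U t₀) t₀ := by
  obtain ⟨β, hβ0, hβc, hβu, hβd⟩ := exists_curve_unitTangent o hv hξ
  set c := (φ t₀ v).1 with hc
  have hcs : (φ t₀ v).1 ∈ (chartAt R2 c).source := mem_chart_source R2 _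
  have hgeo := isSurfaceGeometry_coord o c
  -- the variation `φ_t(β(r))` of the orbit of `v`, in the chart at `φ_{t₀}(v)`
  set f : ℝ × ℝ → R2 := fun x => extChartAt (𝓡 2) c (φ x.1 (β x.2)).1 with hf
  set k : ℝ × ℝ → R2 := fun x => components c (φ x.1 (β x.2)) with hk
  set l : ℝ × ℝ → ℝ := fun x => lam (φ x.1 (β x.2)) with hl
  have hflow : ContMDiffAt 𝓘(ℝ, ℝ × ℝ) (𝓡 2).tangent ∞ (fun x : ℝ × ℝ => φ x.1 (β x.2)) (t₀, 0) := by
    have h1 : ContMDiffAt 𝓘(ℝ, ℝ × ℝ) (𝓘(ℝ, ℝ).prod (𝓡 2).tangent) ∞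
        (fun x : ℝ × ℝ => (x.1, β x.2)) (t₀, 0) :=
      contDiff_fst.contMDiff.contMDiffAt.prodMk
        (ContMDiffAt.comp (t₀, (0 : ℝ)) (g := β) hβc contDiff_snd.contMDiff.contMDiffAt)
    have h2 := hφ.smooth t₀ v hv
    refine ContMDiffAt.comp (t₀, (0 : ℝ)) (g := fun p : ℝ × TM M => φ p.1 p.2) ?_ h1
    simpa only [hβ0] using h2
  have hfk : ContDiffAt ℝ ∞ (fun x => (f x, k x)) (t₀, 0) := by
    refine contMDiffAt_iff_contDiffAt.1 (ContMDiffAt.comp (t₀, (0 : ℝ))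
      (g := fun τ : TM M => (extChartAt (𝓡 2) c τ.1, components c τ)) ?_ hflow)
    simp only [hβ0]
    exact contMDiffAt_coord hcs
  have hfc : ContDiffAt ℝ ∞ f (t₀, 0) := hfk.fst
  have hkc : ContDiffAt ℝ ∞ k (t₀, 0) := hfk.snd
  have hsrc : ∀ᶠ x in 𝓝 (t₀, (0 : ℝ)), (φ x.1 (β x.2)).1 ∈ (chartAt R2 c).source := by
    have h1 : ContinuousAt (fun x : ℝ × ℝ => (φ x.1 (β x.2)).1) (t₀, 0) :=
      (FiberBundle.continuous_proj R2 (fun x : M => TangentSpace (𝓡 2) x)).continuousAt.comp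
        hflow.continuousAt
    exact h1.eventually ((chartAt R2 c).open_source.mem_nhds (by simp only [hβ0]; exact hcs))
  have hbu : ∀ᶠ x in 𝓝 (t₀, (0 : ℝ)), β x.2 ∈ unitTangent g :=
    (continuous_snd.tendsto' (t₀, (0 : ℝ)) 0 rfl).eventually hβu
  have hft : ∀ᶠ x in 𝓝 (t₀, (0 : ℝ)), HasDerivAt (fun t => f (t, x.2)) (k x) x.1 := by
    filter_upwards [hsrc, hbu] with x hx hu
    exact (hφ.isThermostatCurve _ hu c x.1 hx).1
  have hkt : ∀ᶠ x in 𝓝 (t₀, (0 : ℝ)), HasDerivAt (fun t => k (t, x.2))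
      (l x • rotationCLM o c (f x) (k x) - christoffelCLM g c (f x) (k x) (k x)) x.1 := by
    filter_upwards [hsrc, hbu] with x hx hu
    refine (hφ.isThermostatCurve _ hu c x.1 hx).2.congr_deriv ?_
    have h1 := rotationCLM_components o hx (φ x.1 (β x.2)).2
    have h2 := christoffelCLM_apply g (extChartAt_mem_target hx) (k x) (k x)
    exact congrArg₂ (fun a b => l x • a - b) h1.symm h2.symm
  have hunit : ∀ᶠ x in 𝓝 (t₀, (0 : ℝ)), metricCLM g c (f x) (k x) (k x) = 1 := by
    filter_upwards [hsrc, hbu] with x hx hu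
    exact (metricCLM_components_self g hx).trans (hφ.mapsTo x.1 hu)
  have hf0 : f (t₀, 0) = center c := by simp only [hf, hβ0]; rfl
  have hk0 : k (t₀, 0) = components c (φ t₀ v) := by simp only [hk, hβ0]
  have hl0 : l (t₀, 0) = lam (φ t₀ v) := by simp only [hl, hβ0]
  have hfU : f (t₀, 0) ∈ (extChartAt (𝓡 2) c).target := by
    rw [hf0]; exact extChartAt_mem_target hcs
  have hG : metricCLM g c (center c) (components c (φ t₀ v)) (components c (φ t₀ v)) = 1 := by
    have h1 := hunit.self_of_nhds
    rwa [hf0, hk0] at h1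
  set η : ℝ → R2 := fun t => deriv (fun r => f (t, r)) 0 with hη
  set ζ : ℝ → R2 := fun t => deriv (fun r => k (t, r)) 0 with hζ
  have hct : Tendsto (fun t : ℝ => (t, (0 : ℝ))) (𝓝 t₀) (𝓝 (t₀, 0)) :=
    (continuous_id.prodMk continuous_const).tendsto' _ _ rfl
  have hηd : ∀ᶠ t in 𝓝 t₀, HasDerivAt (fun r => f (t, r)) (η t) 0 ∧
      HasDerivAt (fun r => k (t, r)) (ζ t) 0 := by
    have h1 : ∀ᶠ x in 𝓝 (t₀, (0 : ℝ)), ContDiffAt ℝ 1 (fun x => (f x, k x)) x :=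
      (hfk.of_le (m := 1) ENat.LEInfty.out).eventually (by simp)
    filter_upwards [hct.eventually h1] with t ht
    have h2 : ∀ {h : ℝ × ℝ → R2}, ContDiffAt ℝ 1 h (t, 0) →
        HasDerivAt (fun r => h (t, r)) (deriv (fun r => h (t, r)) 0) 0 := fun hh =>
      ((hh.differentiableAt (by simp)).comp (0 : ℝ)
        ((differentiableAt_const t).prodMk differentiableAt_id)).hasDerivAt
    exact ⟨h2 ht.fst, h2 ht.snd⟩
  -- the quotient coordinates, for times close to `t₀`, in the chart at `c`
  have hq : ∀ᶠ t in 𝓝 t₀, quotientCoord o lam (φ t v)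
      (mfderiv (𝓡 2).tangent (𝓡 2).tangent (φ t) v ξ) =
      ![metricCLM g c (f (t, 0)) (η t) (rotationCLM o c (f (t, 0)) (k (t, 0))),
        metricCLM g c (f (t, 0)) (ζ t + christoffelCLM g c (f (t, 0)) (η t) (k (t, 0)))
          (rotationCLM o c (f (t, 0)) (k (t, 0)))
        - l (t, 0) * metricCLM g c (f (t, 0)) (η t) (k (t, 0))] := by
    filter_upwards [hηd, hct.eventually hsrc] with t ht hst
    have hsm : ContMDiffAt (𝓡 2).tangent (𝓡 2).tangent ∞ (φ t) v :=
      ContMDiffAt.comp v (g := fun p : ℝ × TM M => φ p.1 p.2) (f := fun w => (t, w))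
        (hφ.smooth t v hv) (contMDiffAt_const.prodMk contMDiffAt_id)
    have hmd : MDifferentiableAt (𝓡 2).tangent (𝓡 2).tangent (φ t) v :=
      hsm.mdifferentiableAt (by simp)
    have h1 := hasDerivAt_extChartAt_comp hmd hβ0 hβc.continuousAt hβd
    have h2 : ContinuousAt (fun r => φ t (β r)) 0 :=
      ContinuousAt.comp (g := φ t) (by rw [hβ0]; exact hsm.continuousAt) hβc.continuousAt
    have h3 := hφ.quotientCoord_eq (γ := fun r => φ t (β r)) h2 hst ht.1 ht.2
      (by simp only [hβ0]; exact h1)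
    simp only [hβ0] at h3
    simp only [hf, hk, hl, hβ0]
    exact (congrArg (fun τ => quotientCoord o lam τ
      (mfderiv (𝓡 2).tangent (𝓡 2).tangent (φ t) v ξ : R2 × R2)) (congrArg (φ t) hβ0)).symm.trans h3
  have hY' : Y =ᶠ[𝓝 t₀] fun t =>
      metricCLM g c (f (t, 0)) (η t) (rotationCLM o c (f (t, 0)) (k (t, 0))) := by
    filter_upwards [hq] with t ht
    rw [hY]; beta_reduce; rw [ht]; rfl
  have hU' : U =ᶠ[𝓝 t₀] fun t =>
      metricCLM g c (f (t, 0)) (ζ t + christoffelCLM g c (f (t, 0)) (η t) (k (t, 0)))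
          (rotationCLM o c (f (t, 0)) (k (t, 0)))
        - l (t, 0) * metricCLM g c (f (t, 0)) (η t) (k (t, 0)) := by
    filter_upwards [hq] with t ht
    rw [hU]; beta_reduce; rw [ht]; rfl
  have hlt : HasDerivAt (fun t => l (t, 0)) (lX + lam (φ t₀ v) * lV) t₀ := by
    simp only [hl, hβ0]
    exact hlam.hasDerivAt_flow hφ hv
  obtain ⟨hfr, hkr⟩ := hηd.self_of_nhds
  -- the covariant derivative of a family of unit vectors is orthogonal to it
  have hZw : metricCLM g c (center c) (ζ t₀ + christoffelCLM g c (center c) (η t₀)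
      (components c (φ t₀ v))) (components c (φ t₀ v)) = 0 := by
    have h1 := hgeo.hasDerivAt_metric hfr hkr hkr hfU
    have hcr : Tendsto (fun r : ℝ => (t₀, r)) (𝓝 0) (𝓝 (t₀, 0)) :=
      (continuous_const.prodMk continuous_id).tendsto' _ _ rfl
    have h2 : (fun r => metricCLM g c (f (t₀, r)) (k (t₀, r)) (k (t₀, r))) =ᶠ[𝓝 0] fun _ => 1 :=
      hcr.eventually hunit
    have h3 := h1.unique ((hasDerivAt_const (0 : ℝ) (1 : ℝ)).congr_of_eventuallyEq h2)
    rw [hgeo.metric_symm _ hfU (k (t₀, 0)), hf0, hk0] at h3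
    linarith
  have hcont : ContinuousAt (fun r => φ t₀ (β r)) 0 :=
    hflow.continuousAt.comp (f := fun r : ℝ => (t₀, r))
      (continuous_const.prodMk continuous_id).continuousAt
  have hlr := hlam (fun r => φ t₀ (β r)) 0 (η t₀) (ζ t₀) (by simp only [hβ0]) hcont hfr hkr hZw
  obtain ⟨-, hYd, hUd⟩ := hgeo.hasDerivAt_jacobi hfc hkc hfU hft hkt hunit (l := l) hlr hlt hη hζ
  have hYt := hY'.self_of_nhds
  have hUt := hU'.self_of_nhds
  beta_reduce at hYt hUt
  have hbasis : LinearIndependent ℝ ![basisVec 0, basisVec 1] := by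
    refine LinearIndependent.pair_iff.2 fun a b hab => ?_
    have h0 := congrArg (fun x : R2 => x 0) hab
    have h1 := congrArg (fun x : R2 => x 1) hab
    simp [basisVec] at h0 h1
    exact ⟨h0, h1⟩
  have hcurv := hgeo.metric_localCurvature_rotation (y := center c) (by rwa [← hf0]) hG (η t₀)
    (basisVec 0) (basisVec 1) hbasis
  rw [← gaussCurvature_eq] at hcurv
  refine ⟨(hYd.congr_of_eventuallyEq hY').congr_deriv hUt.symm,
    (hUd.congr_of_eventuallyEq hU').congr_deriv ?_⟩
  rw [hYt, hUt, hf0, hk0, hl0, hcurv]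
  simp only [smul_eq_mul]
  ring

end Geometry

section Geometry

variable {M : Type*} [TopologicalSpace M] [ChartedSpace R2 M] [IsManifold (𝓡 2) ∞ M]
  {g : Metric M} {o : Orientation g} {lam : TM M → ℝ} {φ : ℝ → TM M → TM M}

/-! ### The cocycle as a planar system -/

theorem christoffel_center (g : Metric M) (x : M) (u v : R2) :
    christoffelCLM g x (center x) u v = christoffel g x (center x) u v :=
  christoffelCLM_apply g (extChartAt_mem_target (mem_chart_source R2 x)) u v

theorem metric_self_J (o : Orientation g) (x : M) (v : TangentSpace (𝓡 2) x) :
    g.inner x (o.J x v) v = 0 := by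
  have h1 := o.isometry x v (o.J x v)
  rw [o.sq, map_neg, g.symm x v] at h1
  linarith

/-- The frame vectors `H` and `V` are tangent to the unit tangent bundle. -/
theorem frame_tangent_unitTangent (o : Orientation g) (v : TM M) (j : Fin 2) {ξ : R2 × R2}
    (hξ : ξ = ![frameH o v, frameV o v] j) :
    metricCLM g v.1 (center v.1)
      (ξ.2 + christoffelCLM g v.1 (center v.1) ξ.1 (components v.1 v)) (components v.1 v) = 0 := by
  let w : R2 := v.2
  let Jw : R2 := o.J v.1 v.2
  have hc : components v.1 v = w := components_self v.1 v.2
  rw [hc]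
  fin_cases j
  · have h1 : ξ = (Jw, -christoffel g v.1 (center v.1) Jw w) := hξ
    have h2 : -christoffel g v.1 (center v.1) Jw w + christoffelCLM g v.1 (center v.1) Jw w = 0 := by
      rw [christoffel_center, neg_add_cancel]
    rw [h1]
    change metricCLM g v.1 (center v.1) (-christoffel g v.1 (center v.1) Jw w
      + christoffelCLM g v.1 (center v.1) Jw w) w = 0
    rw [h2, map_zero, zero_apply]
  · have h1 : ξ = (0, Jw) := hξ
    have h2 : Jw + christoffelCLM g v.1 (center v.1) 0 w = Jw := by
      rw [map_zero, zero_apply, add_zero]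
    rw [h1]
    change metricCLM g v.1 (center v.1) (Jw + christoffelCLM g v.1 (center v.1) 0 w) w = 0
    rw [h2]
    exact (metricCLM_self g v.1 (o.J v.1 v.2) v.2).trans (metric_self_J o v.1 v.2)

theorem quotientCoord_frame (o : Orientation g) (lam : TM M → ℝ) {v : TM M}
    (hv : v ∈ unitTangent g) (i j : Fin 2) :
    quotientCoord o lam v (![frameH o v, frameV o v] j) i = (1 : Matrix (Fin 2) (Fin 2) ℝ) i j := by
  have h1 : g.inner v.1 (o.J v.1 v.2) (o.J v.1 v.2) = 1 := (o.isometry v.1 v.2 v.2).trans hv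
  have h2 := metric_self_J o v.1 v.2
  have hH1 : omega1 g v (frameH o v) = 0 := h2
  have hH2 : omega2 o v (frameH o v) = 1 := h1
  have hH3 : connectionForm o v (frameH o v) = 0 := by
    have h3 : (-christoffel g v.1 (center v.1) (o.J v.1 v.2) v.2
        + christoffel g v.1 (center v.1) (o.J v.1 v.2) v.2 : R2) = 0 := neg_add_cancel _
    refine (congrArg (fun z : TangentSpace (𝓡 2) v.1 => g.inner v.1 z (o.J v.1 v.2)) h3).trans ?_
    exact (congrArg (fun L : TangentSpace (𝓡 2) v.1 →L[ℝ] ℝ => L (o.J v.1 v.2))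
      (map_zero (g.inner v.1)))
  have hV1 : omega1 g v (frameV o v) = 0 :=
    congrArg (fun L : TangentSpace (𝓡 2) v.1 →L[ℝ] ℝ => L v.2) (map_zero (g.inner v.1))
  have hV2 : omega2 o v (frameV o v) = 0 :=
    congrArg (fun L : TangentSpace (𝓡 2) v.1 →L[ℝ] ℝ => L (o.J v.1 v.2)) (map_zero (g.inner v.1))
  have hV3 : connectionForm o v (frameV o v) = 1 := by
    let w : R2 := v.2
    let Jw : R2 := o.J v.1 v.2
    have h3 : Jw + christoffel g v.1 (center v.1) 0 w = Jw := by
      rw [← christoffel_center, map_zero, zero_apply, add_zero]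
    exact (congrArg (fun z : TangentSpace (𝓡 2) v.1 => g.inner v.1 z (o.J v.1 v.2)) h3).trans h1
  fin_cases j <;> fin_cases i
  · exact hH2
  · change connectionForm o v (frameH o v) - lam v * omega1 g v (frameH o v) = 0
    rw [hH3, hH1]; ring
  · exact hV2
  · change connectionForm o v (frameV o v) - lam v * omega1 g v (frameV o v) = 1
    rw [hV3, hV1]; ring

theorem IsThermostatFlow.mdifferentiableAt (hφ : IsThermostatFlow o lam φ) {v : TM M}
    (hv : v ∈ unitTangent g) (t : ℝ) :
    MDifferentiableAt (𝓡 2).tangent (𝓡 2).tangent (φ t) v :=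
  ContMDiffAt.mdifferentiableAt (n := ∞)
    (ContMDiffAt.comp v (g := fun p : ℝ × TM M => φ p.1 p.2) (f := fun w => (t, w))
      (hφ.smooth t v hv) (contMDiffAt_const.prodMk contMDiffAt_id)) (by simp)

theorem IsThermostatFlow.cocycle_zero (hφ : IsThermostatFlow o lam φ) {v : TM M}
    (hv : v ∈ unitTangent g) : cocycle o lam φ 0 v = 1 := by
  ext i j
  rw [← quotientCoord_frame o lam hv i j]
  set ξ : R2 × R2 := ![frameH o v, frameV o v] j with hξ
  obtain ⟨β, hβ0, hβc, hβu, hβd⟩ :=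
    exists_curve_unitTangent o hv (frame_tangent_unitTangent o v j hξ)
  -- `φ 0` is the identity on the unit tangent bundle only, so its differential is computed on a
  -- curve in the unit tangent bundle
  have h1 := hasDerivAt_extChartAt_comp (hφ.mdifferentiableAt hv 0) hβ0 hβc.continuousAt hβd
  have h2 : (fun r => extChartAt (𝓡 2).tangent v (β r)) =ᶠ[𝓝 0]
      fun r => extChartAt (𝓡 2).tangent (φ 0 v) (φ 0 (β r)) := by
    filter_upwards [hβu] with r hr
    rw [hφ.map_zero v hv, hφ.map_zero _ hr]
  have h3 := (h1.congr_of_eventuallyEq h2).unique hβd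
  have h4 := congrArg (fun z : R2 × R2 => quotientCoord o lam (φ 0 v) z i) h3
  refine h4.trans ?_
  exact congrArg (fun τ => quotientCoord o lam τ ξ i) (hφ.map_zero v hv)

/-- If `p` and `q` satisfy the two pointwise identities below, then the columns `(Y, U)` of the
cocycle solve the planar system for `(Y, U - p Y)` along orbits, and the flow has a dominated
splitting. -/
theorem IsThermostatFlow.admitsDominatedSplitting_of_hasFrameDeriv
    (hφ : IsThermostatFlow o lam φ) {p q : TM M → ℝ} (hp : ContinuousOn p (unitTangent g))
    (hq : ContinuousOn q (unitTangent g)) {B : ℝ} (hpB : ∀ σ ∈ unitTangent g, |p σ| ≤ B)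
    (hqB : ∀ σ ∈ unitTangent g, |q σ| ≤ B)
    (h : ∀ σ ∈ unitTangent g, ∃ lX lH lV pX pH pV : ℝ, HasFrameDeriv o lam σ lX lH lV ∧
      HasFrameDeriv o p σ pX pH pV ∧ lV = p σ + q σ ∧
      gaussCurvature g σ.1 = -1 + lH - lam σ ^ 2 - (pX + lam σ * pV) + p σ * q σ) :
    hφ.AdmitsDominatedSplitting := by
  have hcont : Continuous fun x : ℝ × unitTangent g =>
      (⟨φ x.1 x.2.1, hφ.mapsTo x.1 x.2.2⟩ : unitTangent g) := by
    refine Continuous.subtype_mk (continuous_iff_continuousAt.2 fun x => ?_) _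
    exact ContinuousAt.comp (f := fun x : ℝ × unitTangent g => (x.1, (x.2 : TM M)))
      (hφ.smooth x.1 x.2.1 x.2.2).continuousAt
      (continuous_fst.prodMk (continuous_subtype_val.comp continuous_snd)).continuousAt
  refine hasDominatedSplitting_of_isPlanarSolution _ hcont
    (fun v => Subtype.ext (hφ.map_zero v.1 v.2))
    (fun s t v => Subtype.ext (hφ.map_add s t v.1 v.2)) (fun σ => p σ.1) (fun σ => q σ.1)
    hp.domRestrict hq.domRestrict (B := B) (fun σ => hpB σ.1 σ.2) (fun σ => hqB σ.1 σ.2) _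
    (fun σ => hφ.cocycle_zero σ.2) fun v j t => ?_
  obtain ⟨lX, lH, lV, pX, pH, pV, hl, hpd, hlV, hK⟩ := h (φ t v.1) (hφ.mapsTo t v.2)
  obtain ⟨hY, hU⟩ := hφ.hasDerivAt_quotientCoord v.2
    (frame_tangent_unitTangent o v.1 j (ξ := ![frameH o v.1, frameV o v.1] j) rfl) hl rfl rfl
  have hp1 := hpd.hasDerivAt_flow hφ v.2
  refine ⟨hY.congr_deriv ?_, (hU.sub (hp1.mul hY)).congr_deriv ?_⟩
  · change cocycle o lam φ t v.1 1 j = cocycle o lam φ t v.1 1 j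
        - p (φ t v.1) * cocycle o lam φ t v.1 0 j + p (φ t v.1) * cocycle o lam φ t v.1 0 j
    ring
  · rw [hK, hlV]
    change -(_ - _ + _) * cocycle o lam φ t v.1 0 j + _ * cocycle o lam φ t v.1 1 j
        - (_ * cocycle o lam φ t v.1 0 j + _ * cocycle o lam φ t v.1 1 j) =
      cocycle o lam φ t v.1 0 j
        + q (φ t v.1) * (cocycle o lam φ t v.1 1 j - p (φ t v.1) * cocycle o lam φ t v.1 0 j)
    rw [smul_eq_mul]
    ring

end Geometry

section Geometry

variable {M : Type*} [TopologicalSpace M] [ChartedSpace R2 M] [IsManifold (𝓡 2) ∞ M]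
  {g : Metric M} {o : Orientation g} {m : ℕ}

/-! ### Boundedness on the unit tangent bundle -/

/-- The unit tangent bundle of a closed surface is compact; here in the form that a continuous
function is bounded on it. -/
theorem exists_bound_unitTangent [CompactSpace M] (o : Orientation g) {F : TM M → ℝ}
    (hF : Continuous F) : ∃ B, ∀ σ ∈ unitTangent g, |F σ| ≤ B := by
  suffices h : ∃ B, ∀ σ ∈ unitTangent g, σ.1 ∈ (univ : Set M) → |F σ| ≤ B by
    obtain ⟨B, hB⟩ := h
    exact ⟨B, fun σ hσ => hB σ hσ trivial⟩
  refine isCompact_univ.induction_on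
    (p := fun U : Set M => ∃ B, ∀ σ ∈ unitTangent g, σ.1 ∈ U → |F σ| ≤ B)
    ⟨0, fun _ _ h => h.elim⟩ (fun s t hst ⟨B, hB⟩ => ⟨B, fun σ hσ h => hB σ hσ (hst h)⟩)
    (fun s t ⟨B, hB⟩ ⟨B', hB'⟩ => ⟨max B B', fun σ hσ h => ?_⟩) fun c _ => ?_
  · rcases h with h | h
    · exact (hB σ hσ h).trans (le_max_left _ _)
    · exact (hB' σ hσ h).trans (le_max_right _ _)
  have hcs : c ∈ (chartAt R2 c).source := mem_chart_source R2 c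
  have hU : center c ∈ (extChartAt (𝓡 2) c).target := extChartAt_mem_target hcs
  have hgeo := isSurfaceGeometry_coord o c
  -- near `c`, the unit vectors are contained in the image of a compact set under the map
  -- `(y, a, b) ↦ a e + b J e`
  set e : R2 := basisVec 0
  have he : e ≠ 0 := basisVec_ne_zero 0
  set N : R2 → ℝ := fun y => metricCLM g c y e e with hN
  have hN0 : 0 < N (center c) := metricCLM_pos g hU he
  have hNc : ContinuousOn N (extChartAt (𝓡 2) c).target :=
    ((hgeo.contDiffOn_metric.clm_apply contDiffOn_const).clm_apply contDiffOn_const).continuousOn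
  set δ := N (center c) / 2 with hδ
  have hδ0 : 0 < δ := half_pos hN0
  have hnb : {y | y ∈ (extChartAt (𝓡 2) c).target ∧ δ < N y} ∈ 𝓝 (center c) := by
    have h1 := (isOpen_extChartAt_target (I := 𝓡 2) c).mem_nhds hU
    filter_upwards [h1, (hNc.continuousAt h1).eventually (lt_mem_nhds (half_lt_self hN0))]
      with y h2 h3
    exact ⟨h2, h3⟩
  obtain ⟨r, hr, hball⟩ := Metric.nhds_basis_closedBall.mem_iff.1 hnb
  set R := 1 / δ + 1 with hR
  have hK : IsCompact (Metric.closedBall (center c) r ×ˢ (Icc (-R) R ×ˢ Icc (-R) R)) :=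
    (isCompact_closedBall _ _).prod (isCompact_Icc.prod isCompact_Icc)
  have hcont : ContinuousOn
      (fun p : R2 × ℝ × ℝ => F (tangentPt c p.1 (p.2.1 • e + p.2.2 • rotationCLM o c p.1 e)))
      (Metric.closedBall (center c) r ×ˢ (Icc (-R) R ×ˢ Icc (-R) R)) := by
    refine hF.comp_continuousOn ((contMDiffOn_tangentPt c).continuousOn.comp
      (f := fun p : R2 × ℝ × ℝ => (p.1, p.2.1 • e + p.2.2 • rotationCLM o c p.1 e)) ?_
      fun p hp => ⟨(hball hp.1).1, trivial⟩)
    have h1 : ContinuousOn (fun p : R2 × ℝ × ℝ => rotationCLM o c p.1 e)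
        (Metric.closedBall (center c) r ×ˢ (Icc (-R) R ×ˢ Icc (-R) R)) :=
      (hgeo.contDiffOn_rotation.clm_apply contDiffOn_const).continuousOn.comp
        continuousOn_fst fun p hp => (hball hp.1).1
    exact continuousOn_fst.prodMk (((continuous_fst.comp continuous_snd).continuousOn.smul
      continuousOn_const).add ((continuous_snd.comp continuous_snd).continuousOn.smul h1))
  obtain ⟨B, hB⟩ := hK.exists_bound_of_continuousOn hcont
  refine ⟨{x | x ∈ (chartAt R2 c).source ∧ extChartAt (𝓡 2) c x ∈ Metric.closedBall (center c) r},
    mem_nhdsWithin_of_mem_nhds ?_, B, fun σ hσ h => ?_⟩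
  · filter_upwards [(chartAt R2 c).open_source.mem_nhds hcs,
      (continuousAt_extChartAt (I := 𝓡 2) c).eventually (Metric.closedBall_mem_nhds _ hr)] with x h1 h2
    exact ⟨h1, h2⟩
  obtain ⟨hs, hb⟩ := h
  obtain ⟨hyU, hyδ⟩ := hball hb
  set y := extChartAt (𝓡 2) c σ.1 with hy
  obtain ⟨a, b, hab⟩ := hgeo.exists_eq_smul_add_smul hyU he (components c σ)
  have h1 : metricCLM g c y (components c σ) (components c σ) = 1 :=
    (metricCLM_components_self g hs).trans hσ
  have h2 : (a ^ 2 + b ^ 2) * N y = 1 := by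
    rw [hab] at h1
    simp only [map_add, map_smul, add_apply, smul_apply, smul_eq_mul, hgeo.rotation_isometry y hyU,
      hgeo.metric_self_rotation hyU, hgeo.metric_rotation_left hyU] at h1
    rw [← h1]; ring
  have h3 : a ^ 2 + b ^ 2 ≤ 1 / δ := by
    rw [le_div_iff₀ hδ0, ← h2]
    exact mul_le_mul_of_nonneg_left hyδ.le (by positivity)
  have h4 : 0 < 1 / δ := by positivity
  have ha : |a| ≤ R := abs_le_of_sq_le_sq (by nlinarith [sq_nonneg b]) (by positivity)
  have hb' : |b| ≤ R := abs_le_of_sq_le_sq (by nlinarith [sq_nonneg a]) (by positivity)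
  have h5 := hB (y, a, b) ⟨hb, abs_le.1 ha, abs_le.1 hb'⟩
  beta_reduce at h5
  rw [← hab, hy, tangentPt_extChartAt_components hs] at h5
  exact h5

/-! ### Derivatives along the frame -/

theorem HasFrameDeriv.add {W : Type*} [NormedAddCommGroup W] [NormedSpace ℝ W] {F F' : TM M → W}
    {σ : TM M} {FX FH FV FX' FH' FV' : W} (h : HasFrameDeriv o F σ FX FH FV)
    (h' : HasFrameDeriv o F' σ FX' FH' FV') :
    HasFrameDeriv o (fun τ => F τ + F' τ) σ (FX + FX') (FH + FH') (FV + FV') :=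
  fun γ s η ζ h1 h2 h3 h4 h5 =>
    ((h γ s η ζ h1 h2 h3 h4 h5).add (h' γ s η ζ h1 h2 h3 h4 h5)).congr_deriv (by
      simp only [smul_add]; abel)

theorem HasFrameDeriv.clm_comp {W W' : Type*} [NormedAddCommGroup W] [NormedSpace ℝ W]
    [NormedAddCommGroup W'] [NormedSpace ℝ W'] (L : W →L[ℝ] W') {F : TM M → W}
    {σ : TM M} {FX FH FV : W} (h : HasFrameDeriv o F σ FX FH FV) :
    HasFrameDeriv o (fun τ => L (F τ)) σ (L FX) (L FH) (L FV) :=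
  fun γ s η ζ h1 h2 h3 h4 h5 =>
    (L.hasFDerivAt.comp_hasDerivAt s (h γ s η ζ h1 h2 h3 h4 h5)).congr_deriv (by
      simp only [map_add, map_smul])

theorem rotationCLM_center (o : Orientation g) (σ : TM M) :
    rotationCLM o σ.1 (center σ.1) (components σ.1 σ) = o.J σ.1 σ.2 :=
  (rotationCLM_components o (mem_chart_source R2 σ.1) σ.2).trans (components_self σ.1 _)

/-- The derivatives of a function on `TM` along the frame `X, H, V`, from its differential in a
chart. -/
theorem hasFrameDeriv_of_hasFDerivAt {W : Type*} [NormedAddCommGroup W] [NormedSpace ℝ W]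
    (o : Orientation g) {F : TM M → W} {σ : TM M}
    (hσ : σ ∈ unitTangent g) {w Jw : R2} (hw : w = σ.2) (hJw : Jw = o.J σ.1 σ.2)
    {L : R2 × R2 →L[ℝ] W}
    (hL : HasFDerivAt (fun x : R2 × R2 => F (tangentPt σ.1 x.1 x.2)) L (center σ.1, w)) :
    HasFrameDeriv o F σ (L (w, -christoffelCLM g σ.1 (center σ.1) w w))
      (L (Jw, -christoffelCLM g σ.1 (center σ.1) Jw w)) (L (0, Jw)) := by
  intro γ s η ζ h0 hc h1 h2 h3
  have hs : σ.1 ∈ (chartAt R2 σ.1).source := mem_chart_source R2 _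
  have hU : center σ.1 ∈ (extChartAt (𝓡 2) σ.1).target := extChartAt_mem_target hs
  have hgeo := isSurfaceGeometry_coord o σ.1
  have hwc : components σ.1 σ = w := (components_self σ.1 σ.2).trans hw.symm
  have hJ := (rotationCLM_center o σ).trans hJw.symm
  have hG : metricCLM g σ.1 (center σ.1) w w = 1 := by
    rw [← hwc]; exact (metricCLM_components_self g hs).trans hσ
  rw [hJ, hwc]
  rw [hwc] at hJ h3
  have hev : ∀ᶠ r in 𝓝 s, (γ r).1 ∈ (chartAt R2 σ.1).source := by
    have h4 : ContinuousAt (fun r => (γ r).1) s :=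
      (FiberBundle.continuous_proj R2 (fun x : M => TangentSpace (𝓡 2) x)).continuousAt.comp hc
    exact h4.eventually ((chartAt R2 σ.1).open_source.mem_nhds (by beta_reduce; rw [h0]; exact hs))
  have hd : HasDerivAt (fun r => F (γ r)) (L (η, ζ)) s := by
    have h5 := HasFDerivAt.comp_hasDerivAt
      (f := fun r => (extChartAt (𝓡 2) σ.1 (γ r).1, components σ.1 (γ r))) s
      (by rw [h0, hwc]; exact hL) (h1.prodMk h2)
    refine h5.congr_of_eventuallyEq ?_
    filter_upwards [hev] with r hr
    simp only [Function.comp, tangentPt_extChartAt_components hr]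
  refine hd.congr_deriv ?_
  have hη := hgeo.eq_metric_smul_add hU hG η
  have hZ := hgeo.eq_metric_smul_add hU hG (ζ + christoffelCLM g σ.1 (center σ.1) η w)
  rw [h3, zero_smul, zero_add, hJ] at hZ
  rw [hJ] at hη
  generalize metricCLM g σ.1 (center σ.1) η w = a at *
  generalize metricCLM g σ.1 (center σ.1) η Jw = b at *
  generalize metricCLM g σ.1 (center σ.1) (ζ + christoffelCLM g σ.1 (center σ.1) η w) Jw = k at *
  -- in the basis `w, J w`, the velocity is `a X + b H + k V`
  have hζ : ζ = k • Jw - christoffelCLM g σ.1 (center σ.1) η w := eq_sub_of_add_eq hZ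
  rw [← map_smul, ← map_smul, ← map_smul, ← map_add, ← map_add, hζ, hη]
  congr 1
  refine Prod.ext ?_ ?_
  · simp
  · simp only [Prod.snd_add, Prod.smul_snd, map_add, map_smul, add_apply, smul_apply]
    module

end Geometry

section Geometry

variable {M : Type*} [TopologicalSpace M] [ChartedSpace R2 M] [IsManifold (𝓡 2) ∞ M]
  {g : Metric M} {o : Orientation g} {m : ℕ}

/-! ### One-forms -/

/-- A `1`-form in the chart at `c`, as a linear form depending on the point. -/
noncomputable def OneForm.coordCLM (θ : OneForm M) (c : M) (y : R2) : R2 →L[ℝ] ℝ :=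
  linOfBasis (θ.coord c y)

theorem OneForm.coordCLM_apply (θ : OneForm M) {c : M} {y : R2}
    (hy : y ∈ (extChartAt (𝓡 2) c).target) (v : R2) : θ.coordCLM c y v = θ.coord c y v := by
  have hx := coordPt_mem_source hy
  refine linOfBasis_apply ?_ ?_ v <;> intros <;>
    simp only [OneForm.coord, coordVec_add hx, coordVec_smul hx, map_add, map_smul]

theorem OneForm.contDiffOn_coordCLM (θ : OneForm M) (c : M) :
    ContDiffOn ℝ ∞ (θ.coordCLM c) (extChartAt (𝓡 2) c).target :=
  contDiffOn_linOfBasis fun i =>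
    (contDiffOn_comp_tangentPt θ.smooth c).comp
      (contDiff_id.prodMk (contDiff_const (c := basisVec i))).contDiffOn (fun _ hy => ⟨hy, trivial⟩)

theorem OneForm.coordCLM_self (θ : OneForm M) (x : M) (v : TangentSpace (𝓡 2) x) :
    θ.coordCLM x (center x) v = θ.form x v := by
  have hx := mem_chart_source R2 x
  refine (θ.coordCLM_apply (extChartAt_mem_target hx) v).trans ?_
  have h : ∀ p, p = x → θ.form p (coordVec x p v) = θ.form x v := by
    rintro p rfl
    exact congrArg (θ.form p) (coordVec_self p v)
  exact h _ (coordPt_extChartAt hx)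

theorem OneForm.covDeriv_eq (g : Metric M) (θ : OneForm M) {c : M} {y : R2}
    (hy : y ∈ (extChartAt (𝓡 2) c).target) (u v : R2) :
    θ.covDeriv g c y u v =
      fderiv ℝ (θ.coordCLM c) y u v - θ.coordCLM c y (christoffelCLM g c y u v) := by
  have hn := (isOpen_extChartAt_target (I := 𝓡 2) c).mem_nhds hy
  have hd : HasFDerivAt (θ.coordCLM c) (fderiv ℝ (θ.coordCLM c) y) y :=
    (((θ.contDiffOn_coordCLM c).contDiffAt hn).differentiableAt (by simp)).hasFDerivAt
  have h1 := hd.clm_apply (hasFDerivAt_const v y)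
  have h2 : (fun z => θ.coord c z v) =ᶠ[𝓝 y] fun z => θ.coordCLM c z v :=
    Filter.eventually_of_mem hn fun z hz => (θ.coordCLM_apply hz v).symm
  rw [OneForm.covDeriv, (h1.congr_of_eventuallyEq h2).fderiv, ← christoffelCLM_apply g hy,
    θ.coordCLM_apply hy]
  simp

/-- The trace of a bilinear form is computed in the orthonormal basis `w, J w`. -/
theorem sum_gram_inv_mul (o : Orientation g) {c : M} {y : R2}
    (hy : y ∈ (extChartAt (𝓡 2) c).target) {w : R2} (hw : metricCLM g c y w w = 1)
    (D : R2 → R2 → ℝ) (hD1 : ∀ (a b : ℝ) u u' v, D (a • u + b • u') v = a * D u v + b * D u' v)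
    (hD2 : ∀ (a b : ℝ) u v v', D u (a • v + b • v') = a * D u v + b * D u v') :
    ∑ i, ∑ j, (gram g c y)⁻¹ i j * D (basisVec i) (basisVec j) =
      D w w + D (rotationCLM o c y w) (rotationCLM o c y w) := by
  have hgeo := isSurfaceGeometry_coord o c
  set n := rotationCLM o c y w with hn
  have hcoord : ∀ i j : Fin 2, (basisVec i : R2) j = (1 : Matrix (Fin 2) (Fin 2) ℝ) i j := by
    intro i j
    fin_cases i <;> fin_cases j <;> simp [basisVec]
  -- the inverse Gram matrix is `w wᵀ + n nᵀ`, because `w, n` is orthonormal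
  have hinv : (gram g c y)⁻¹ = Matrix.of fun i j => w i * w j + n i * n j := by
    refine Matrix.inv_eq_right_inv ?_
    ext i k
    have h1 := congrArg (fun x : R2 => x k) (hgeo.eq_metric_smul_add hy hw (basisVec i))
    have h2 : ∀ v : R2, metricCLM g c y (basisVec i) v =
        v 0 * metricCLM g c y (basisVec i) (basisVec 0)
          + v 1 * metricCLM g c y (basisVec i) (basisVec 1) := by
      intro v
      conv_lhs => rw [eq_sum_basisVec v]
      simp only [map_add, map_smul, smul_eq_mul]
    simp only [PiLp.add_apply, PiLp.smul_apply, smul_eq_mul, hcoord] at h1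
    rw [← hn, h2 w, h2 n] at h1
    rw [h1, Matrix.mul_apply, Fin.sum_univ_two]
    simp only [gram, Matrix.of_apply, ← metricCLM_apply g hy]
    ring
  have hexp : ∀ v : R2, D v v = ∑ i, ∑ j, v i * v j * D (basisVec i) (basisVec j) := by
    intro v
    conv_lhs => rw [eq_sum_basisVec v]
    simp only [hD1, hD2, Fin.sum_univ_two]
    ring
  rw [hexp w, hexp n, hinv, ← Finset.sum_add_distrib]
  refine Finset.sum_congr rfl fun i _ => ?_
  rw [← Finset.sum_add_distrib]
  exact Finset.sum_congr rfl fun j _ => by simp only [Matrix.of_apply]; ring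

theorem codifferential_eq (o : Orientation g) (θ : OneForm M) {σ : TM M} (hσ : σ ∈ unitTangent g)
    {w Jw : R2} (hw : w = σ.2) (hJw : Jw = o.J σ.1 σ.2) :
    codifferential g θ σ.1 = -(θ.covDeriv g σ.1 (center σ.1) w w
      + θ.covDeriv g σ.1 (center σ.1) Jw Jw) := by
  have hs : σ.1 ∈ (chartAt R2 σ.1).source := mem_chart_source R2 _
  have hU : center σ.1 ∈ (extChartAt (𝓡 2) σ.1).target := extChartAt_mem_target hs
  have hwc : components σ.1 σ = w := (components_self σ.1 σ.2).trans hw.symm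
  have hJ := (rotationCLM_center o σ).trans hJw.symm
  have hG : metricCLM g σ.1 (center σ.1) w w = 1 := by
    rw [← hwc]; exact (metricCLM_components_self g hs).trans hσ
  rw [hwc] at hJ
  rw [codifferential, sum_gram_inv_mul o hU hG, hJ]
  all_goals
    intros
    simp only [θ.covDeriv_eq g hU, map_add, map_smul, add_apply, smul_apply, smul_eq_mul]
    ring

/-- The derivatives of `θ(v)` along the frame: `(∇_v θ)(v)`, `(∇_{J v} θ)(v)` and `θ(J v)`. -/
theorem OneForm.hasFrameDeriv (o : Orientation g) (θ : OneForm M) {σ : TM M}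
    (hσ : σ ∈ unitTangent g) {w Jw : R2} (hw : w = σ.2) (hJw : Jw = o.J σ.1 σ.2) :
    HasFrameDeriv o θ.toFunction σ (θ.covDeriv g σ.1 (center σ.1) w w)
      (θ.covDeriv g σ.1 (center σ.1) Jw w) (θ.form σ.1 (o.J σ.1 σ.2)) := by
  have hs : σ.1 ∈ (chartAt R2 σ.1).source := mem_chart_source R2 _
  have hU : center σ.1 ∈ (extChartAt (𝓡 2) σ.1).target := extChartAt_mem_target hs
  have hn := (isOpen_extChartAt_target (I := 𝓡 2) σ.1).mem_nhds hU
  have hd : HasFDerivAt (θ.coordCLM σ.1) (fderiv ℝ (θ.coordCLM σ.1) (center σ.1)) (center σ.1) :=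
    (((θ.contDiffOn_coordCLM σ.1).contDiffAt hn).differentiableAt (by simp)).hasFDerivAt
  have h1 : HasFDerivAt (fun x : R2 × R2 => θ.coordCLM σ.1 x.1 x.2) _ (center σ.1, w) :=
    (HasFDerivAt.comp (f := fun x : R2 × R2 => x.1) (center σ.1, w) hd hasFDerivAt_fst).clm_apply
      hasFDerivAt_snd
  have h2 : (fun x : R2 × R2 => θ.toFunction (tangentPt σ.1 x.1 x.2)) =ᶠ[𝓝 (center σ.1, w)]
      fun x => θ.coordCLM σ.1 x.1 x.2 := by
    filter_upwards [continuous_fst.continuousAt.eventually hn] with x hx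
    exact (θ.coordCLM_apply hx x.2).symm
  have h3 := hasFrameDeriv_of_hasFDerivAt o hσ hw hJw (h1.congr_of_eventuallyEq h2)
  have h4 : θ.coordCLM σ.1 (center σ.1) Jw = θ.form σ.1 (o.J σ.1 σ.2) :=
    hJw ▸ θ.coordCLM_self σ.1 (o.J σ.1 σ.2)
  convert h3 using 1
  · rw [θ.covDeriv_eq g hU]; simp; ring
  · rw [θ.covDeriv_eq g hU]; simp; ring
  · rw [← h4]; simp

/-- The derivatives of `θ(J v)` along the frame: `(∇_v θ)(J v)`, `(∇_{J v} θ)(J v)` and `-θ(v)`,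
because `J` is parallel. -/
theorem OneForm.hasFrameDeriv_rotation (o : Orientation g) (θ : OneForm M) {σ : TM M}
    (hσ : σ ∈ unitTangent g) {w Jw : R2} (hw : w = σ.2) (hJw : Jw = o.J σ.1 σ.2) :
    HasFrameDeriv o (fun τ => θ.form τ.1 (o.J τ.1 τ.2)) σ (θ.covDeriv g σ.1 (center σ.1) w Jw)
      (θ.covDeriv g σ.1 (center σ.1) Jw Jw) (-θ.form σ.1 σ.2) := by
  have hs : σ.1 ∈ (chartAt R2 σ.1).source := mem_chart_source R2 _
  have hU : center σ.1 ∈ (extChartAt (𝓡 2) σ.1).target := extChartAt_mem_target hs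
  have hn := (isOpen_extChartAt_target (I := 𝓡 2) σ.1).mem_nhds hU
  have hgeo := isSurfaceGeometry_coord o σ.1
  have hwc : components σ.1 σ = w := (components_self σ.1 σ.2).trans hw.symm
  have hJ := (rotationCLM_center o σ).trans hJw.symm
  rw [hwc] at hJ
  have hd : HasFDerivAt (θ.coordCLM σ.1) (fderiv ℝ (θ.coordCLM σ.1) (center σ.1)) (center σ.1) :=
    (((θ.contDiffOn_coordCLM σ.1).contDiffAt hn).differentiableAt (by simp)).hasFDerivAt
  have hdJ := (hgeo.differentiableAt_rotation hU).hasFDerivAt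
  have h1 : HasFDerivAt (fun x : R2 × R2 => θ.coordCLM σ.1 x.1 (rotationCLM o σ.1 x.1 x.2)) _
      (center σ.1, w) :=
    (HasFDerivAt.comp (f := fun x : R2 × R2 => x.1) (center σ.1, w) hd hasFDerivAt_fst).clm_apply
      ((HasFDerivAt.comp (f := fun x : R2 × R2 => x.1) (center σ.1, w) hdJ
        hasFDerivAt_fst).clm_apply hasFDerivAt_snd)
  have h2 : (fun x : R2 × R2 => θ.form (tangentPt σ.1 x.1 x.2).1
      (o.J (tangentPt σ.1 x.1 x.2).1 (tangentPt σ.1 x.1 x.2).2)) =ᶠ[𝓝 (center σ.1, w)]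
      fun x => θ.coordCLM σ.1 x.1 (rotationCLM o σ.1 x.1 x.2) := by
    filter_upwards [continuous_fst.continuousAt.eventually hn] with x hx
    rw [θ.coordCLM_apply hx, OneForm.coord, coordVec_rotationCLM o hx]
    rfl
  have h3 := hasFrameDeriv_of_hasFDerivAt o hσ hw hJw
    (F := fun τ => θ.form τ.1 (o.J τ.1 τ.2)) (h1.congr_of_eventuallyEq h2)
  have h4 : θ.coordCLM σ.1 (center σ.1) w = θ.form σ.1 σ.2 := hw ▸ θ.coordCLM_self σ.1 σ.2
  have h5 : rotationCLM o σ.1 (center σ.1) Jw = -w := by rw [← hJ, hgeo.rotation_sq _ hU]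
  have h6 : ∀ u, fderiv ℝ (rotationCLM o σ.1) (center σ.1) u w = _ :=
    fun u => hgeo.fderiv_rotation hU u w
  convert h3 using 1
  · rw [θ.covDeriv_eq g hU]; simp [h6, hJ]; ring
  · rw [θ.covDeriv_eq g hU]; simp [h6, hJ]; ring
  · rw [← h4]; simp [h5]

end Geometry

section Geometry

variable {M : Type*} [TopologicalSpace M] [ChartedSpace R2 M] [IsManifold (𝓡 2) ∞ M]
  {g : Metric M} {o : Orientation g} {m : ℕ}

/-! ### Differentials of degree `m` -/

/-- A differential of degree `m` in the chart at `c`, as a multilinear form. -/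
noncomputable def Differential.coordMultilinear (A : Differential o m) (c : M) (y : R2) :
    MultilinearMap ℝ (fun _ : Fin m => R2) ℂ :=
  (A.form (coordPt c y)).compLinearMap fun _ =>
    ((trivializationAt R2 (fun x : M => TangentSpace (𝓡 2) x) c).symmL ℝ (coordPt c y)).toLinearMap

theorem Differential.coordMultilinear_apply (A : Differential o m) {c : M} {y : R2}
    (hy : y ∈ (extChartAt (𝓡 2) c).target) (v : Fin m → R2) :
    A.coordMultilinear c y v = A.coord c y v := by
  have hx := coordPt_mem_source hy
  simp only [Differential.coord, coordVec_eq_symmL hx]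
  rfl

theorem Differential.coord_rotation (A : Differential o m) {c : M} {y : R2}
    (hy : y ∈ (extChartAt (𝓡 2) c).target) (v : Fin m → R2) (i : Fin m) :
    A.coord c y (Function.update v i (rotationCLM o c y (v i))) = Complex.I * A.coord c y v := by
  rw [Differential.coord, Differential.coord, ← A.complexLinear _ _ i]
  congr 1
  funext j
  by_cases h : j = i
  · subst h; simp [coordVec_rotationCLM o hy]
  · simp [h]

theorem Differential.coord_self (A : Differential o m) (x : M)
    (v : Fin m → TangentSpace (𝓡 2) x) : A.coord x (center x) v = A.form x v := by
  have h : ∀ p, p = x → A.form p (fun i => coordVec x p (v i)) = A.form x v := by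
    rintro p rfl
    exact congrArg (A.form p) (funext fun i => coordVec_self p (v i))
  exact h _ (coordPt_extChartAt (mem_chart_source R2 x))

/-- A differential of degree `m` is homogeneous of degree `m` for the complex structure `J` of the
tangent plane. -/
theorem Differential.form_smul_add_smul (A : Differential o m) (x : M)
    (w : TangentSpace (𝓡 2) x) (a b : ℝ) :
    A.form x (fun _ => a • w + b • o.J x w) = (a + b * Complex.I) ^ m * A.form x (fun _ => w) := by
  have h : ∀ s : Finset (Fin m), A.form x (s.piecewise (fun _ => a • w + b • o.J x w) fun _ => w) =
      (a + b * Complex.I) ^ s.card * A.form x (fun _ => w) := by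
    intro s
    induction s using Finset.induction_on with
    | empty => simp
    | insert i s hi ih =>
      set f := s.piecewise (fun _ => a • w + b • o.J x w) fun _ => w with hf
      have hfi : f i = w := by simp [hf, hi]
      have h1 := A.complexLinear x f i
      rw [hfi] at h1
      have h2 : Function.update f i w = f := by rw [← hfi, Function.update_eq_self]
      rw [Finset.piecewise_insert, MultilinearMap.map_update_add, MultilinearMap.map_update_smul,
        MultilinearMap.map_update_smul, ← hf, h1, h2, ih, Finset.card_insert_of_notMem hi, pow_succ]
      simp only [Complex.real_smul]
      ring
  simpa using h Finset.univ

/-- The norm of `A` is attained at every unit vector. -/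
theorem normSq_eq (A : Differential o m) {σ : TM M} (hσ : σ ∈ unitTangent g) :
    normSq A σ.1 = ‖A.form σ.1 (fun _ => σ.2)‖ ^ 2 := by
  have hs : σ.1 ∈ (chartAt R2 σ.1).source := mem_chart_source R2 _
  have h : {r : ℝ | ∃ v : TangentSpace (𝓡 2) σ.1, g.inner σ.1 v v = 1 ∧
      r = ‖A.form σ.1 (fun _ => v)‖ ^ 2} = {‖A.form σ.1 (fun _ => σ.2)‖ ^ 2} := by
    ext r
    simp only [mem_ofPred_eq, mem_singleton_iff]
    refine ⟨?_, fun hr => ⟨σ.2, hσ, hr⟩⟩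
    rintro ⟨v, hv, rfl⟩
    obtain ⟨a, b, hab, hv'⟩ : ∃ a b : ℝ, a ^ 2 + b ^ 2 = 1 ∧ v = a • σ.2 + b • o.J σ.1 σ.2 := by
      have hU : center σ.1 ∈ (extChartAt (𝓡 2) σ.1).target := extChartAt_mem_target hs
      have hJ := rotationCLM_center o σ
      have hwc : components σ.1 σ = σ.2 := components_self σ.1 σ.2
      have hw0 : components σ.1 σ ≠ 0 := by
        intro h0
        have h1 := (metricCLM_components_self g hs).trans hσ
        rw [h0, map_zero] at h1
        exact zero_ne_one h1
      obtain ⟨a, b, h1⟩ := (isSurfaceGeometry_coord o σ.1).exists_eq_smul_add_smul hU hw0 (v : R2)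
      rw [hJ, hwc] at h1
      have h2 : v = a • σ.2 + b • o.J σ.1 σ.2 := h1
      refine ⟨a, b, ?_, h2⟩
      have h3 := o.isometry σ.1 σ.2 σ.2
      have h4 := metric_self_J o σ.1 σ.2
      have h5 := g.symm σ.1 σ.2 (o.J σ.1 σ.2)
      have h6 : g.inner σ.1 σ.2 σ.2 = 1 := hσ
      rw [h2] at hv
      simp only [map_add, map_smul, add_apply, smul_apply, smul_eq_mul, h3, h5, h4, h6] at hv
      linarith
    rw [hv', A.form_smul_add_smul, norm_mul, norm_pow]
    have h1 : ‖(a + b * Complex.I : ℂ)‖ = 1 := by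
      rw [Complex.norm_add_mul_I, hab, Real.sqrt_one]
    rw [h1, one_pow, one_mul]
  rw [normSq, h, csSup_singleton]

theorem Differential.coord_smul_add_smul (A : Differential o m) {c : M} {y : R2}
    (hy : y ∈ (extChartAt (𝓡 2) c).target) (w : R2) (a b : ℝ) :
    A.coord c y (fun _ => a • w + b • rotationCLM o c y w) =
      (a + b * Complex.I) ^ m * A.coord c y fun _ => w := by
  have hx := coordPt_mem_source hy
  simp only [Differential.coord, coordVec_add hx, coordVec_smul hx, coordVec_rotationCLM o hy]
  exact A.form_smul_add_smul _ _ a b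

/-- The differential, in a chart, of the function `A(v, …, v)` on `TM`: covariant derivatives in the
horizontal directions, and `m i A(v, …, v)` for the rotation of the fibres. -/
theorem Differential.exists_hasFDerivAt_coord (A : Differential o m) {c : M} {y : R2}
    (hy : y ∈ (extChartAt (𝓡 2) c).target) {w : R2} (hw : w ≠ 0) :
    ∃ L : R2 × R2 →L[ℝ] ℂ,
      HasFDerivAt (fun x : R2 × R2 => A.form (tangentPt c x.1 x.2).1
        (fun _ => (tangentPt c x.1 x.2).2)) L (y, w) ∧
      (∀ η, L (η, -christoffelCLM g c y η w) = A.covDeriv c y η fun _ => w) ∧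
      L (0, rotationCLM o c y w) = m * Complex.I * A.coord c y fun _ => w := by
  have hn : (extChartAt (𝓡 2) c).target ×ˢ (univ : Set R2) ∈ 𝓝 (y, w) :=
    ((isOpen_extChartAt_target c).prod isOpen_univ).mem_nhds ⟨hy, trivial⟩
  have hd := (((contDiffOn_comp_tangentPt A.smooth c).contDiffAt hn).differentiableAt
    (by simp)).hasFDerivAt
  set L := fderiv ℝ (fun p : R2 × R2 => A.form (tangentPt c p.1 p.2).1
        (fun _ => (tangentPt c p.1 p.2).2)) (y, w) with hL
  have h1 : ∀ η, L (η, 0) = fderiv ℝ (fun z => A.coord c z fun _ => w) y η := by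
    intro η
    have h2 := HasFDerivAt.comp (f := fun z : R2 => (z, w)) y hd
      ((hasFDerivAt_id y).prodMk (hasFDerivAt_const w y))
    have h3 : HasFDerivAt (fun z => A.coord c z fun _ => w) _ y := h2
    rw [h3.fderiv]
    simp
  have h2 : ∀ ζ, L (0, ζ) = ∑ i, A.coord c y (Function.update (fun _ => w) i ζ) := by
    intro ζ
    obtain ⟨a, b, rfl⟩ := (isSurfaceGeometry_coord o c).exists_eq_smul_add_smul hy hw ζ
    -- on the complex line spanned by `w`, `A` is the monomial of degree `m`
    set n := rotationCLM o c y w with hnw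
    have h3 : HasDerivAt (fun r : ℝ => A.coord c y fun _ => w + r • (a • w + b • n))
        (L (0, a • w + b • n)) 0 := by
      have h4 : HasDerivAt (fun r : ℝ => w + r • (a • w + b • n)) (a • w + b • n) 0 := by
        simpa only [one_smul, id] using
          ((hasDerivAt_id (0 : ℝ)).smul_const (a • w + b • n)).const_add w
      exact HasFDerivAt.comp_hasDerivAt (f := fun r : ℝ => (y, w + r • (a • w + b • n))) 0
        (by rw [zero_smul, add_zero]; exact hd) ((hasDerivAt_const 0 y).prodMk h4)
    have h5 : (fun r : ℝ => A.coord c y fun _ => w + r • (a • w + b • n)) = fun r : ℝ =>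
        (1 + (r : ℂ) * (a + b * Complex.I)) ^ m * A.coord c y fun _ => w := by
      funext r
      have h6 : w + r • (a • w + b • n) = (1 + r * a) • w + (r * b) • n := by module
      rw [h6, A.coord_smul_add_smul hy]
      push_cast
      ring
    have h7 : HasDerivAt (fun r : ℝ => (1 + (r : ℂ) * (a + b * Complex.I)) ^ m *
        A.coord c y fun _ => w) (m * (a + b * Complex.I) * A.coord c y fun _ => w) 0 := by
      have h8 := (((Complex.ofRealCLM.hasDerivAt (x := (0 : ℝ))).mul_const
        ((a : ℂ) + b * Complex.I)).const_add 1).pow m |>.mul_const (A.coord c y fun _ => w)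
      refine h8.congr_deriv ?_
      simp
    have h9 : ∀ i, A.coord c y (Function.update (fun _ => w) i (a • w + b • n)) =
        (a + b * Complex.I) * A.coord c y fun _ => w := by
      intro i
      have h10 := A.coord_rotation hy (fun _ => w) i
      rw [← A.coordMultilinear_apply hy] at h10
      rw [← A.coordMultilinear_apply hy, MultilinearMap.map_update_add,
        MultilinearMap.map_update_smul, MultilinearMap.map_update_smul, h10,
        Function.update_eq_self, A.coordMultilinear_apply hy]
      simp only [Complex.real_smul]
      ring
    rw [h5] at h3
    rw [h3.unique h7, Finset.sum_congr rfl fun i _ => h9 i]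
    simp [mul_assoc]
  refine ⟨L, hd, fun η => ?_, ?_⟩
  · have h3 : ((η, -christoffelCLM g c y η w) : R2 × R2) = (η, 0) - (0, christoffelCLM g c y η w) := by
      simp
    rw [h3, map_sub, h1, h2, Differential.covDeriv, christoffelCLM_apply g hy]
  · rw [h2]
    simp only [A.coord_rotation hy (fun _ => w)]
    simp; ring

/-- The derivatives of `A(v, …, v)` along the frame: `∇_v A`, `∇_{J v} A` and `m i A`. -/
theorem Differential.hasFrameDeriv (A : Differential o m) {σ : TM M} (hσ : σ ∈ unitTangent g)
    {w Jw : R2} (hw : w = σ.2) (hJw : Jw = o.J σ.1 σ.2) :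
    HasFrameDeriv o (fun τ => A.form τ.1 (fun _ => τ.2)) σ
      (A.covDeriv σ.1 (center σ.1) w fun _ => w) (A.covDeriv σ.1 (center σ.1) Jw fun _ => w)
      (m * Complex.I * A.form σ.1 fun _ => σ.2) := by
  have hs : σ.1 ∈ (chartAt R2 σ.1).source := mem_chart_source R2 _
  have hU : center σ.1 ∈ (extChartAt (𝓡 2) σ.1).target := extChartAt_mem_target hs
  have hwc : components σ.1 σ = w := (components_self σ.1 σ.2).trans hw.symm
  have hJ := (rotationCLM_center o σ).trans hJw.symm
  have hG : metricCLM g σ.1 (center σ.1) w w = 1 := by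
    rw [← hwc]; exact (metricCLM_components_self g hs).trans hσ
  rw [hwc] at hJ
  have hw0 : w ≠ 0 := fun h0 => by simp [h0] at hG
  obtain ⟨L, hL, h1, h2⟩ := A.exists_hasFDerivAt_coord hU hw0
  have h3 := hasFrameDeriv_of_hasFDerivAt o hσ hw hJw
    (F := fun τ => A.form τ.1 fun _ => τ.2) hL
  have h4 : A.coord σ.1 (center σ.1) (fun _ => w) = A.form σ.1 fun _ => σ.2 := by
    rw [hw]; exact A.coord_self σ.1 fun _ => σ.2
  rwa [h1, h1, ← hJ, h2, h4, hJ] at h3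

end Geometry

section Geometry

variable {M : Type*} [TopologicalSpace M] [ChartedSpace R2 M] [IsManifold (𝓡 2) ∞ M]
  {g : Metric M} {o : Orientation g} {m : ℕ}

/-! ### The thermostat of a differential and a one-form -/

theorem vertDeriv_toFunction (o : Orientation g) (θ : OneForm M) (v : TM M) :
    vertDeriv o θ.toFunction v = θ.form v.1 (o.J v.1 v.2) := by
  have h1 : (fun t : ℝ => θ.toFunction ⟨v.1, Real.cos t • v.2 + Real.sin t • o.J v.1 v.2⟩) =
      fun t => Real.cos t * θ.form v.1 v.2 + Real.sin t * θ.form v.1 (o.J v.1 v.2) := by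
    funext t
    simp only [OneForm.toFunction, map_add, map_smul, smul_eq_mul]
  have h2 := ((Real.hasDerivAt_cos 0).mul_const (θ.form v.1 v.2)).add
    ((Real.hasDerivAt_sin 0).mul_const (θ.form v.1 (o.J v.1 v.2)))
  rw [vertDeriv, h1]
  exact h2.deriv.trans (by simp)

/-- `λ(v) = Im A(v, …, v) - θ(J v)`, written with linear maps so that derivatives along the frame can
be read off. -/
theorem thermostatFunction_eq (A : Differential o m) (θ : OneForm M) :
    thermostatFunction A θ = fun τ => Complex.imCLM (A.form τ.1 fun _ => τ.2)
      + (-ContinuousLinearMap.id ℝ ℝ) (θ.form τ.1 (o.J τ.1 τ.2)) := by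
  funext τ
  simp only [thermostatFunction, vertDeriv_toFunction, Differential.toFunction]
  simp
  ring

/-- The real part of `∂̄A = ((m - 1) / 2) (θ - i ⋆θ) ⊗ A`, evaluated on `σ`. -/
theorem WeaklyHolomorphic.re_covDeriv_sub {A : Differential o m} {θ : OneForm M}
    (hA : WeaklyHolomorphic A θ) {σ : TM M} {w Jw : R2} (hw : w = σ.2) (hJw : Jw = o.J σ.1 σ.2) :
    (A.covDeriv σ.1 (center σ.1) w fun _ => w).re - (A.covDeriv σ.1 (center σ.1) Jw fun _ => w).im =
      ((m : ℝ) - 1) * (θ.form σ.1 σ.2 * (A.form σ.1 fun _ => σ.2).re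
        - θ.form σ.1 (o.J σ.1 σ.2) * (A.form σ.1 fun _ => σ.2).im) := by
  have h := hA σ.1 σ.2 fun _ => σ.2
  have h1 : dbar A σ.1 σ.2 (fun _ => σ.2) = (A.covDeriv σ.1 (center σ.1) w (fun _ => w)
      + Complex.I * A.covDeriv σ.1 (center σ.1) Jw fun _ => w) / 2 := by
    rw [hw, hJw]; rfl
  rw [h1, hodgeStar] at h
  have h2 : (A.covDeriv σ.1 (center σ.1) w (fun _ => w)
      + Complex.I * A.covDeriv σ.1 (center σ.1) Jw fun _ => w) =
      (((m : ℝ) - 1 : ℝ) : ℂ) * ((θ.form σ.1 σ.2 : ℝ) + Complex.I * (θ.form σ.1 (o.J σ.1 σ.2) : ℝ))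
        * A.form σ.1 fun _ => σ.2 := by
    push_cast at h ⊢
    linear_combination 2 * h
  have h3 := congrArg Complex.re h2
  simp only [Complex.add_re, Complex.mul_re, Complex.mul_im, Complex.add_im, Complex.I_re,
    Complex.I_im, Complex.ofReal_re, Complex.ofReal_im] at h3
  linear_combination h3

end Geometry
end Thermostat

theorem mainTheorem6 {M : Type*} [TopologicalSpace M] [T2Space M] [CompactSpace M]
    [ChartedSpace Thermostat.R2 M] [IsManifold (𝓡 2) ∞ M]
    (g : Thermostat.Metric M) (o : Thermostat.Orientation g)
    (m : ℕ) (hm : 2 ≤ m) (A : Thermostat.Differential o m) (θ : Thermostat.OneForm M)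
    (hK : Thermostat.GeneralizedWang A θ) (hA : Thermostat.WeaklyHolomorphic A θ)
    (φ : ℝ → Thermostat.TM M → Thermostat.TM M)
    (hφ : Thermostat.IsThermostatFlow o (Thermostat.thermostatFunction A θ) φ) :
    hφ.AdmitsDominatedSplitting := by
  open Thermostat in
  -- with this shear, the off-diagonal coefficients of the planar system are `1`
  set p : TM M → ℝ := fun τ => Complex.reCLM (A.form τ.1 fun _ => τ.2) + θ.toFunction τ with hp
  set q : TM M → ℝ := fun τ => ((m : ℝ) - 1) * Complex.reCLM (A.form τ.1 fun _ => τ.2) with hq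
  have hre : Continuous fun τ : TM M => Complex.reCLM (A.form τ.1 fun _ => τ.2) :=
    Complex.reCLM.continuous.comp A.smooth.continuous
  have hpc : Continuous p := hre.add θ.smooth.continuous
  have hqc : Continuous q := continuous_const.mul hre
  obtain ⟨B, hB⟩ := exists_bound_unitTangent o hpc
  obtain ⟨B', hB'⟩ := exists_bound_unitTangent o hqc
  refine hφ.admitsDominatedSplitting_of_hasFrameDeriv hpc.continuousOn hqc.continuousOn
    (B := max B B') (fun σ hσ => (hB σ hσ).trans (le_max_left _ _))
    (fun σ hσ => (hB' σ hσ).trans (le_max_right _ _)) fun σ hσ => ?_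
  obtain ⟨w, hw⟩ : ∃ w : R2, w = σ.2 := ⟨_, rfl⟩
  obtain ⟨Jw, hJw⟩ : ∃ Jw : R2, Jw = o.J σ.1 σ.2 := ⟨_, rfl⟩
  have hAd := A.hasFrameDeriv hσ hw hJw
  have hθd := θ.hasFrameDeriv o hσ hw hJw
  have hJd := θ.hasFrameDeriv_rotation o hσ hw hJw
  have hl := (hAd.clm_comp Complex.imCLM).add (hJd.clm_comp (-ContinuousLinearMap.id ℝ ℝ))
  rw [← thermostatFunction_eq A θ] at hl
  refine ⟨_, _, _, _, _, _, hl, (hAd.clm_comp Complex.reCLM).add hθd, ?_, ?_⟩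
  -- `V λ = m Re A + θ = p + q`
  · simp only [hp, hq, OneForm.toFunction]
    simp
    ring
  -- the curvature equation, where `∇A` enters through `∂̄A` only
  · have h1 := hA.re_covDeriv_sub hw hJw
    rw [hK σ.1, codifferential_eq o θ hσ hw hJw, normSq_eq A hσ, Complex.sq_norm,
      Complex.normSq_apply, thermostatFunction_eq]
    simp only [hp, hq, OneForm.toFunction]
    simp
    linear_combination h1
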